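/- **Setting.** Let $H\in\mathbb C^{L\times M}$, $\sigma_\omega,\sigma_\upsilon,P>0$, and let $\Theta$ be a random vector in $\mathbb R^K$ with Lebesgue density $f$. Let $G:\mathbb R^K\to\mathbb C^{T\times M}$ be measurable, differentiable at every $\theta$ with $f(\theta)>0$, and injective on a set of full $\Theta$-probability. When $x^N=(x_1,\dots,x_N)$, $x_n\in\mathbb C^M$, is sent, the user observes $y_n=Hx_n+\omega_n$ and the sensor observes $z_n=G(\Theta)x_n+\upsilon_n$, $n=1,\dots,N$, where $\omega_n\sim\mathcal{CN}(0,\sigma_\omega^2I)$ and $\upsilon_n\sim\mathcal{CN}(0,\sigma_\upsilon^2I)$ are independent over $n$, and $\Theta$ stays fixed over the block. A scheme consists of $M_N$ codewords $x^N(w)$ with $\frac1N\sum_n\|x_n(w)\|^2\le P$, a decoder $\hat w(y^N)$ and an estimator $\hat\theta(z^N,x^N(w))$. Its error probability is $\varepsilon_N=\max_w\Pr[\hat w\neq w\mid w]$, the risk of message $w$ is $\xi_N(w)=\mathbb E[\|\Theta-\hat\theta\|^2\mid w]$, and $\xi_N=\max_w\xi_N(w)$, $\xi_N^{\rm av}=\frac1{M_N}\sum_w\xi_N(w)$.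 The pair $(R,\Delta)$ is achievable if for every $\epsilon>0$ and all large enough $N$ there is a scheme with $\varepsilon_N\le\epsilon$, $\frac1N\log_2M_N\ge R-\epsilon$ and $N\xi_N\le\Delta+\epsilon$. Let $C(\Delta)$ be the supremum of all $R$ such that $(R,\Delta)$ is achievable, and $C^{\rm av}(\Delta)$ the same quantity with $\xi_N^{\rm av}$ in place of $\xi_N$ (suprema and maxima over empty sets are $-\infty$). Let $J(\theta|Q)$ be the $K\times K$ matrix $$[J(\theta|Q)]_{ij}=\frac{2}{\sigma_\upsilon^2}\,\Re\,\mathrm{tr}\Big(\frac{\partial G(\theta)}{\partial\theta_j}\,Q\,\frac{\partial G(\theta)^{\mathsf H}}{\partial\theta_i}\Big),$$ let $J_P=\mathbb E[\nabla\ln f(\Theta)\,\nabla\ln f(\Theta)^{\mathsf T}]$, $\hat Q(x^N)=\frac1N\sum_nx_nx_n^{\mathsf H}$, and let $\bar Q$ be the average of $\hat Q(x^N(w))$ over the messages of a scheme. Put $\mathrm{tr}\,A^{-1}=\infty$ for a singular positive semidefinite matrix $A$. Assume the regularity conditions of the Bayesian Cramér–Rao bound: $f$ is continuous on $\mathbb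 R^K$ and differentiable where it is positive, $J_P$ is finite, and $\mathbb E\,\|\partial G(\Theta)/\partial\theta_i\|^2<\infty$ for every $i$. Define $$C^{\rm ub}(\Delta)=\max_{Q\succeq0}\ \log_2\det\Big(I+\frac1{\sigma_\omega^2}HQH^{\mathsf H}\Big)\quad\text{s.t.}\quad \mathrm{tr}\big(\mathbb E[J(\Theta|Q)]^{-1}\big)\le\Delta,\quad \mathrm{tr}\,Q\le P,$$ and let $C^{\rm E}(\Delta)$ be the supremum of the same program with the sensing constraint replaced by $\mathrm{tr}\,\mathbb E[J(\Theta|Q)^{-1}]\le\Delta$. **Statement.** For every such channel: 1. If $f(\theta)>0$ and $\tilde x$ is a random input with finite second moments and $\mathbb E[\tilde x\tilde x^{\mathsf H}]=Q$, then $J(\theta|Q)=\mathbb E[J(\theta|\tilde x)]$, where $J(\theta|x)$ is the Fisher information matrix of the density of $\mathcal{CN}(G(\theta)x,\sigma_\upsilon^2I)$ with respect to $\theta$. 2. (van Trees) For every $N\ge1$, every $x^N$ and every estimator $\hat\theta(z^N)$, $\ N\,\mathbb E\|\Theta-\hat\theta\|^2\ge\mathrm{tr}\big(\mathbb E[J(\Theta|\hat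 Q(x^N))]+\tfrac1NJ_P\big)^{-1}$. 3. (Miller–Chang form) For every scheme with $N\ge1$, $\ N\,\xi_N^{\rm av}\ge\mathrm{tr}\big(\mathbb E[J(\Theta|\bar Q)]+\tfrac1NJ_P\big)^{-1}$. 4. For every real $\Delta$, $C(\Delta)\le C^{\rm ub}(\Delta)$ and $C^{\rm av}(\Delta)\le C^{\rm ub}(\Delta)$; the maximum defining $C^{\rm ub}(\Delta)$ is attained whenever the program is feasible. 5. For every $Q\succeq0$, $\mathrm{tr}(\mathbb E[J(\Theta|Q)]^{-1})\le\mathrm{tr}\,\mathbb E[J(\Theta|Q)^{-1}]$. If the right-hand side is finite, equality holds if and only if $J(\Theta|Q)$ is almost surely constant. Consequently $C^{\rm E}(\Delta)\le C^{\rm ub}(\Delta)$ for every real $\Delta$. The bound is strictly loose in general: there are such a channel and a $\Delta$ with $0\le C(\Delta)<C^{\rm ub}(\Delta)$ and $0<C^{\rm E}(\Delta)<C^{\rm ub}(\Delta)$. -/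

import Mathlib

open MeasureTheory
open scoped ENNReal Matrix ComplexOrder

noncomputable section

namespace JCAS

/-! ### Circularly symmetric complex Gaussian vectors -/

/-- Density at `z` of the law `CN(m, s² I)` on `ℂ^d`. -/
def cnDensity {d : ℕ} (s : ℝ) (m z : Fin d → ℂ) : ℝ :=
  ((Real.pi * s ^ 2) ^ d)⁻¹ * Real.exp (-(∑ t, ‖z t - m t‖ ^ 2) / s ^ 2)

/-- The law `CN(m, s² I)` on `ℂ^d`. -/
def cnLaw {d : ℕ} (s : ℝ) (m : Fin d → ℂ) : Measure (Fin d → ℂ) :=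
  volume.withDensity fun z => ENNReal.ofReal (cnDensity s m z)

/-! ### The channel model -/

/-- The joint communication and sensing channel: user channel `y = H x + ω` with
`ω ∼ CN(0, σω² I)`, sensor channel `z = G(θ) x + υ` with `υ ∼ CN(0, συ² I)`, average power
budget `P`, and a random parameter in `ℝ^K` with Lebesgue density `f`. -/
structure Model (M L T K : ℕ) where
  H : Matrix (Fin L) (Fin M) ℂ
  G : (Fin K → ℝ) → Matrix (Fin T) (Fin M) ℂ
  f : (Fin K → ℝ) → ℝ
  σω : ℝ
  συ : ℝ
  P : ℝ
  σω_pos : 0 < σω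
  συ_pos : 0 < συ
  P_pos : 0 < P
  f_meas : Measurable f
  f_nonneg : ∀ θ, 0 ≤ f θ
  f_lintegral : ∫⁻ θ, ENNReal.ofReal (f θ) = 1
  G_meas : ∀ t m, Measurable fun θ => G θ t m
  /-- `G` is differentiable wherever the prior density is positive. -/
  G_diff : ∀ θ, 0 < f θ → ∀ t m, DifferentiableAt ℝ (fun θ' => G θ' t m) θ
  /-- `G` is almost surely invertible. -/
  G_inj : ∃ S : Set (Fin K → ℝ),
    (∀ᵐ θ ∂(volume.withDensity fun θ => ENNReal.ofReal (f θ)), θ ∈ S) ∧ Set.InjOn G S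

namespace Model

variable {M L T K : ℕ} (𝓜 : Model M L T K)

/-- Law of the random parameter. -/
def prior : Measure (Fin K → ℝ) := volume.withDensity fun θ => ENNReal.ofReal (𝓜.f θ)

/-! ### Fisher information -/

/-- The matrix `∂G(θ)/∂θ_i`. -/
def dG (θ : Fin K → ℝ) (i : Fin K) : Matrix (Fin T) (Fin M) ℂ :=
  Matrix.of fun t m => fderiv ℝ (fun θ' => 𝓜.G θ' t m) θ (Pi.single i 1)

/-- The `i`-th entry of the score `∇_θ ln f(z | x, θ)` of one sensor observation. -/
def score (θ : Fin K → ℝ) (x : Fin M → ℂ) (z : Fin T → ℂ) (i : Fin K) : ℝ :=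
  fderiv ℝ (fun θ' => Real.log (cnDensity 𝓜.συ (𝓜.G θ' *ᵥ x) z)) θ (Pi.single i 1)

/-- Fisher information matrix `J(θ | x)` of one sensor observation under the input `x`. -/
def fisherInfo (θ : Fin K → ℝ) (x : Fin M → ℂ) : Matrix (Fin K) (Fin K) ℝ :=
  Matrix.of fun i j =>
    ∫ z, 𝓜.score θ x z i * 𝓜.score θ x z j ∂(cnLaw 𝓜.συ (𝓜.G θ *ᵥ x))

/-- Conditional Fisher information matrix `J(θ | Q)` under input covariance `Q`. -/
def condFIM (θ : Fin K → ℝ) (Q : Matrix (Fin M) (Fin M) ℂ) : Matrix (Fin K) (Fin K) ℝ :=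
  Matrix.of fun i j => 2 / 𝓜.συ ^ 2 * (Matrix.trace (𝓜.dG θ j * Q * (𝓜.dG θ i)ᴴ)).re

/-- The matrix `E[J(θ | Q)]`, the expectation being over the random parameter. -/
def expFIM (Q : Matrix (Fin M) (Fin M) ℂ) : Matrix (Fin K) (Fin K) ℝ :=
  Matrix.of fun i j => ∫ θ, 𝓜.condFIM θ Q i j ∂𝓜.prior

/-- The `i`-th entry of `∇ ln f(θ)` for the prior density `f`. -/
def priorScore (θ : Fin K → ℝ) (i : Fin K) : ℝ :=
  fderiv ℝ (fun θ' => Real.log (𝓜.f θ')) θ (Pi.single i 1)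

/-- Prior information matrix `J_P = E[∇ ln f (∇ ln f)ᵀ]`. -/
def priorInfo : Matrix (Fin K) (Fin K) ℝ :=
  Matrix.of fun i j => ∫ θ, 𝓜.priorScore θ i * 𝓜.priorScore θ j ∂𝓜.prior

/-- Regularity conditions under which the Bayesian Cramér-Rao bound is defined: the prior
density is continuous on `ℝ^K` (so it vanishes on the boundary of `{f > 0}`) and differentiable
where it is positive, and the matrices `E[J(θ | Q)]` and `J_P` are finite. -/
structure Regular : Prop where
  f_cont : Continuous 𝓜.f
  f_diff : ∀ θ, 0 < 𝓜.f θ → DifferentiableAt ℝ 𝓜.f θ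
  prior_info : ∀ i, Integrable (fun θ => 𝓜.priorScore θ i ^ 2) 𝓜.prior
  fim : ∀ i t m, Integrable (fun θ => ‖𝓜.dG θ i t m‖ ^ 2) 𝓜.prior

end Model

/-- `tr A⁻¹` for a positive definite matrix, and `∞` for any other matrix (it is only applied to
positive semidefinite matrices). -/
def invTrace {K : ℕ} (A : Matrix (Fin K) (Fin K) ℝ) : ℝ≥0∞ :=
  open Classical in if A.PosDef then ENNReal.ofReal (Matrix.trace A⁻¹) else ⊤

namespace Model

variable {M L T K : ℕ} (𝓜 : Model M L T K)

/-! ### The optimization programs -/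

/-- `tr E[J(θ | Q)⁻¹]`. -/
def ecrb (Q : Matrix (Fin M) (Fin M) ℂ) : ℝ≥0∞ :=
  ∫⁻ θ, invTrace (𝓜.condFIM θ Q) ∂𝓜.prior

/-- `tr (E[J(θ | Q)]⁻¹)`. -/
def bcrb (Q : Matrix (Fin M) (Fin M) ℂ) : ℝ≥0∞ := invTrace (𝓜.expFIM Q)

/-- `log det (I + H Q Hᴴ / σω²)`, in bits. -/
def rate (Q : Matrix (Fin M) (Fin M) ℂ) : ℝ :=
  Real.logb 2 (Matrix.det (1 + ((1 / 𝓜.σω ^ 2 : ℝ) : ℂ) • (𝓜.H * Q * 𝓜.Hᴴ))).re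

/-- `Q` is feasible: `Q ⪰ 0`, `S(Q) ≤ Δ` for the sensing cost `S`, and `tr Q ≤ P`. -/
def Feasible (S : Matrix (Fin M) (Fin M) ℂ → ℝ≥0∞) (Δ : ℝ)
    (Q : Matrix (Fin M) (Fin M) ℂ) : Prop :=
  Q.PosSemidef ∧ (S Q : EReal) ≤ (Δ : EReal) ∧ (Matrix.trace Q).re ≤ 𝓜.P

/-- Value of the program: maximize the rate over feasible `Q` (`-∞` if there is none). -/
def program (S : Matrix (Fin M) (Fin M) ℂ → ℝ≥0∞) (Δ : ℝ) : EReal :=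
  sSup {r : EReal | ∃ Q, 𝓜.Feasible S Δ Q ∧ r = (𝓜.rate Q : EReal)}

/-- The bound `C^ub(Δ)`. -/
def capUB (Δ : ℝ) : EReal := 𝓜.program 𝓜.bcrb Δ

/-! ### Coding and estimation schemes -/

/-- Law of the user's observations when `x^N` is sent. -/
def userLaw {N : ℕ} (x : Fin N → Fin M → ℂ) : Measure (Fin N → Fin L → ℂ) :=
  Measure.pi fun n => cnLaw 𝓜.σω (𝓜.H *ᵥ x n)

/-- Law of the sensor's observations given the parameter `θ` when `x^N` is sent. -/
def sensorLaw {N : ℕ} (θ : Fin K → ℝ) (x : Fin N → Fin M → ℂ) : Measure (Fin N → Fin T → ℂ) :=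
  Measure.pi fun n => cnLaw 𝓜.συ (𝓜.G θ *ᵥ x n)

/-- Trace of the mean square error matrix of the estimator `est` when `x^N` is sent. -/
def mse {N : ℕ} (x : Fin N → Fin M → ℂ) (est : (Fin N → Fin T → ℂ) → (Fin K → ℝ)) : ℝ≥0∞ :=
  ∑ i, ∫⁻ θ, ∫⁻ z, ENNReal.ofReal ((θ i - est z i) ^ 2) ∂(𝓜.sensorLaw θ x) ∂𝓜.prior

/-- Empirical covariance `N⁻¹ ∑ x_n x_nᴴ`. -/
def empCov {N : ℕ} (x : Fin N → Fin M → ℂ) : Matrix (Fin M) (Fin M) ℂ :=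
  ((1 / N : ℝ) : ℂ) • ∑ n, Matrix.vecMulVec (x n) (star (x n))

/-- A scheme with block length `N` and `m` messages. -/
structure Scheme (N m : ℕ) where
  enc : Fin m → Fin N → Fin M → ℂ
  power : ∀ w, (1 / N : ℝ) * ∑ n, ∑ a, ‖enc w n a‖ ^ 2 ≤ 𝓜.P
  dec : (Fin N → Fin L → ℂ) → Fin m
  dec_meas : Measurable dec
  est : (Fin N → Fin T → ℂ) → (Fin N → Fin M → ℂ) → (Fin K → ℝ)
  est_meas : ∀ w, Measurable fun z => est z (enc w)

namespace Scheme

variable {𝓜} {N m : ℕ} (S : 𝓜.Scheme N m)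

/-- Maximal probability of decoding error. -/
def maxErr : ℝ≥0∞ := ⨆ w, 𝓜.userLaw (S.enc w) {y | S.dec y ≠ w}

/-- Mean square error risk `ξ_N(w)` of message `w`. -/
def risk (w : Fin m) : ℝ≥0∞ := 𝓜.mse (S.enc w) fun z => S.est z (S.enc w)

/-- Maximal risk over the messages. -/
def maxRisk : ℝ≥0∞ := ⨆ w, S.risk w

/-- Average risk over the messages. -/
def avgRisk : ℝ≥0∞ := (∑ w, S.risk w) / m

/-- Empirical covariance averaged over the messages. -/
def avgCov : Matrix (Fin M) (Fin M) ℂ := ((1 / m : ℝ) : ℂ) • ∑ w, empCov (S.enc w)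

end Scheme

/-- Achievability of the pair `(R, Δ)` when the sensing risk of a scheme is `risk`. -/
def Achievable (risk : ∀ {N m : ℕ}, 𝓜.Scheme N m → ℝ≥0∞) (R Δ : ℝ) : Prop :=
  ∀ ε : ℝ, 0 < ε → ∃ N₀ : ℕ, ∀ N ≥ N₀, ∃ (m : ℕ) (S : 𝓜.Scheme N m),
    S.maxErr ≤ ENNReal.ofReal ε ∧
    R - ε ≤ 1 / N * Real.logb 2 m ∧
    (((N : ℝ≥0∞) * risk S : ℝ≥0∞) : EReal) ≤ ((Δ + ε : ℝ) : EReal)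

/-- The capacity-MSE function `C(Δ)` (`-∞` if no pair `(R, Δ)` is achievable). -/
def cap (Δ : ℝ) : EReal :=
  sSup {r : EReal | ∃ R : ℝ, 𝓜.Achievable Scheme.maxRisk R Δ ∧ r = (R : EReal)}

/-- The capacity-MSE function when the sensing risk is the average risk over the messages. -/
def capAvg (Δ : ℝ) : EReal :=
  sSup {r : EReal | ∃ R : ℝ, 𝓜.Achievable Scheme.avgRisk R Δ ∧ r = (R : EReal)}

end Model

end JCAS

end

/-!
# Capacity under a Bayesian Cramér–Rao constraint

The thread through all estimation bounds is the variational formula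
`tr A⁻¹ = sup_B (2 tr B - tr (B A Bᵀ))` for positive semidefinite `A`, with value `∞` when `A` is
singular (`ofReal_le_invTrace`, `invTrace_le_ofReal`). For fixed `B` its right-hand side is affine
in `A`, so it survives averages and limits without any discussion of inverses.

*Van Trees.* Let `s` be the score of the joint density of `(Θ, z^N)`. Integration by parts in `θ`
gives `E[(θ̂ - Θ) sᵀ] = 1` (`Model.Regular.integral_error_mul_score`), and
`E[s sᵀ] = N E[J(Θ|Q̂)] + J_P`. Expanding `E ‖θ̂ - Θ - B s / N‖² ≥ 0` is exactly the
variational formula paired with `B` (`Model.Regular.two_mul_trace_sub_le_mse`). The prior density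
is only continuous, and differentiable only where it is positive, so the integration by parts is
carried out with `(f - ε)₊² / f` in place of `f`; dominated convergence removes `ε`. Averaging over
the codebook gives the Miller–Chang form, because `Q ↦ E[J(Θ|Q)]` is linear
(`Model.Regular.two_mul_trace_sub_le_avgRisk`).

*Coding converse.* A change of measure from the output law of each codeword to one Gaussian law
with covariance `σω² I + H Q̄ Hᴴ` in each channel use bounds the probability of correct decoding.
The relative entropies average over the codebook to exactly `N log det (I + H Q̄ Hᴴ / σω²)`, which
gives a Fano-type inequality with the average covariance `Q̄` (`Model.Scheme.log_card_le`).

*The capacity bound.* The matrices `Q ⪰ 0` with `tr Q ≤ P` form a compact set. A limit point of the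
average covariances of good schemes supports the rate (`Model.exists_limit_of_achievable`) and
satisfies every inequality of the variational formula, since `J_P / N` vanishes in the limit
(`Model.Regular.capAvg_le_capUB`). The same compactness gives attainment. The comparison of the two
sensing constraints is the integral of the variational formula over the prior, with equality
precisely when the maximizer `B = J(θ|Q)⁻¹` does not depend on `θ`
(`Model.Regular.bcrb_eq_ecrb_iff`).

*Strictness.* The user listens to the first of two antennas, and the sensor sees the second one
through the response `t ↦ max t (2 t)`, of slope `1` on the left and `2` on the right of the origin.
The prior is an equal mixture of a density on `[0, 1]` and its mirror image (`kinkModel`). If `q`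
is the power on the second antenna, then the Fisher information is `8 q` or `2 q`, and the bound
uses its mean `5 q`. The van Trees inequality also holds in each component of the mixture, so the
limiting risk is at least the mean `5 / (16 q)` of the inverses, and the constraint `Δ = 5 / 16`
forces `q ≥ 1` (`cap_kinkModel_half_le`), while the bound admits `q = 16 / 25`
(`one_lt_capUB_kinkModel_half`). Inverting the response at the average observation shows that the
sensing constraint can be met (`cap_kinkModel_half_nonneg`).
-/

open Filter Topology
open MeasureTheory
open scoped ENNReal Matrix ComplexOrder

namespace JCAS

/-! ### Complex Gaussian laws and their second moments -/

/-- A product of laws with real densities has the product density. -/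
lemma pi_withDensity_ofReal {ι : Type*} [Fintype ι] {X : ι → Type*} [∀ i, MeasureSpace (X i)]
    [∀ i, SigmaFinite (volume : Measure (X i))] {g : ∀ i, X i → ℝ} (hg : ∀ i x, 0 ≤ g i x)
    (hint : ∀ i, Integrable (g i)) :
    Measure.pi (fun i => (volume : Measure (X i)).withDensity fun x => ENNReal.ofReal (g i x))
      = (volume : Measure (∀ i, X i)).withDensity
          fun x => ENNReal.ofReal (∏ i, g i (x i)) := by
  have : ∀ i, IsFiniteMeasure
      ((volume : Measure (X i)).withDensity fun x => ENNReal.ofReal (g i x)) := fun i =>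
    isFiniteMeasure_withDensity_ofReal (hint i).2
  refine Measure.pi_eq fun s hs => ?_
  have key : ∀ x : ∀ i, X i, (Set.pi Set.univ s).indicator (fun x => ∏ i, g i (x i)) x
      = ∏ i, (s i).indicator (g i) (x i) := by
    intro x
    by_cases h : ∀ i, x i ∈ s i
    · rw [Set.indicator_of_mem (by simpa using h)]
      exact Finset.prod_congr rfl fun i _ => (Set.indicator_of_mem (h i) _).symm
    · rw [Set.indicator_of_notMem (by simpa using h)]
      obtain ⟨i, hi⟩ := not_forall.1 h
      exact (Finset.prod_eq_zero (Finset.mem_univ i) (Set.indicator_of_notMem hi _)).symm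
  rw [withDensity_apply _ (MeasurableSet.univ_pi hs)]
  have hpi : Integrable (fun x : ∀ i, X i => ∏ i, (s i).indicator (g i) (x i)) :=
    Integrable.fintype_prod_dep fun i => (hint i).indicator (hs i)
  rw [← lintegral_indicator (MeasurableSet.univ_pi hs)]
  have e1 : ∀ x : ∀ i, X i,
      (Set.pi Set.univ s).indicator (fun x => ENNReal.ofReal (∏ i, g i (x i))) x
      = ENNReal.ofReal (∏ i, (s i).indicator (g i) (x i)) := by
    intro x
    rw [← key x]
    by_cases h : x ∈ Set.pi Set.univ s <;> simp [h]
  simp_rw [e1]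
  rw [← ofReal_integral_eq_lintegral_ofReal hpi
    (ae_of_all _ fun x => Finset.prod_nonneg fun i _ => Set.indicator_nonneg (fun y _ => hg i y) _),
    integral_fintype_prod_volume_eq_prod,
    ENNReal.ofReal_prod_of_nonneg fun i _ =>
      integral_nonneg fun y => Set.indicator_nonneg (fun y _ => hg i y) _]
  refine Finset.prod_congr rfl fun i _ => ?_
  rw [withDensity_apply _ (hs i), integral_indicator (hs i),
    ofReal_integral_eq_lintegral_ofReal (hint i).integrableOn (ae_of_all _ fun y => hg i y)]

/-- Density at `z` of the scalar law `CN(m, s²)`. -/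
noncomputable def cnDensityOne (s : ℝ) (m z : ℂ) : ℝ :=
  (Real.pi * s ^ 2)⁻¹ * Real.exp (-‖z - m‖ ^ 2 / s ^ 2)

/-- The scalar law `CN(m, s²)`. -/
noncomputable def cnLawOne (s : ℝ) (m : ℂ) : Measure ℂ :=
  volume.withDensity fun z => ENNReal.ofReal (cnDensityOne s m z)

lemma cnDensityOne_nonneg (s : ℝ) (m z : ℂ) : 0 ≤ cnDensityOne s m z := by
  unfold cnDensityOne; have := Real.pi_pos; positivity

lemma cnDensityOne_eq (s : ℝ) (m z : ℂ) : cnDensityOne s m z = cnDensityOne s 0 (z - m) := by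
  simp [cnDensityOne]

lemma continuous_cnDensityOne (s : ℝ) (m : ℂ) : Continuous (cnDensityOne s m) := by
  unfold cnDensityOne; fun_prop

lemma integral_cnDensityOne {s : ℝ} (hs : 0 < s) (m : ℂ) : ∫ z, cnDensityOne s m z = 1 := by
  simp_rw [cnDensityOne_eq s m]
  rw [integral_sub_right_eq_self (cnDensityOne s 0)]
  have h := Complex.integral_exp_neg_mul_rpow (p := 2) (b := 1 / s ^ 2) (by norm_num)
    (by positivity)
  simp only [cnDensityOne, sub_zero]
  rw [integral_const_mul]
  have e : ∀ z : ℂ, -‖z‖ ^ 2 / s ^ 2 = -(1 / s ^ 2) * ‖z‖ ^ (2 : ℝ) := by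
    intro z; rw [Real.rpow_two]; ring
  simp_rw [e, h]
  have := Real.pi_pos
  norm_num [Real.rpow_neg_one]
  field_simp

lemma integrable_cnDensityOne {s : ℝ} (hs : 0 < s) (m : ℂ) : Integrable (cnDensityOne s m) :=
  Integrable.of_integral_ne_zero (by rw [integral_cnDensityOne hs]; norm_num)

lemma isProbabilityMeasure_cnLawOne {s : ℝ} (hs : 0 < s) (m : ℂ) :
    IsProbabilityMeasure (cnLawOne s m) := by
  constructor
  rw [cnLawOne, withDensity_apply _ MeasurableSet.univ, setLIntegral_univ,
    ← ofReal_integral_eq_lintegral_ofReal (integrable_cnDensityOne hs m)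
      (ae_of_all _ (cnDensityOne_nonneg s m)), integral_cnDensityOne hs]
  simp

lemma integral_cnLawOne (s : ℝ) (m : ℂ) (F : ℂ → ℝ) :
    ∫ z, F z ∂(cnLawOne s m) = ∫ z, cnDensityOne s m z * F z := by
  rw [cnLawOne, integral_withDensity_eq_integral_toReal_smul
    (by exact (continuous_cnDensityOne s m).measurable.ennreal_ofReal) (by simp)]
  simp [ENNReal.toReal_ofReal (cnDensityOne_nonneg s m _)]

lemma integral_cnLawOne_sub (s : ℝ) (m : ℂ) (F : ℂ → ℝ) :
    ∫ z, F (z - m) ∂(cnLawOne s m) = ∫ z, F z ∂(cnLawOne s 0) := by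
  simp_rw [integral_cnLawOne, cnDensityOne_eq s m]
  exact integral_sub_right_eq_self (fun z => cnDensityOne s 0 z * F z) m

lemma integral_sq_norm_cnLawOne {s : ℝ} (hs : 0 < s) :
    ∫ z, ‖z‖ ^ 2 ∂(cnLawOne s 0) = s ^ 2 := by
  rw [integral_cnLawOne]
  have h := Complex.integral_rpow_mul_exp_neg_mul_rpow (p := 2) (q := 2) (b := 1 / s ^ 2)
    (by norm_num) (by norm_num) (by positivity)
  have e : ∀ z : ℂ, cnDensityOne s 0 z * ‖z‖ ^ 2
      = (Real.pi * s ^ 2)⁻¹ * (‖z‖ ^ (2 : ℝ) * Real.exp (-(1 / s ^ 2) * ‖z‖ ^ (2 : ℝ))) := by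
    intro z
    rw [Real.rpow_two, cnDensityOne, sub_zero,
      show -‖z‖ ^ 2 / s ^ 2 = -(1 / s ^ 2) * ‖z‖ ^ 2 by ring]
    ring
  simp_rw [e]
  rw [integral_const_mul, h]
  have := Real.pi_pos
  norm_num
  field_simp

lemma integrable_sq_norm_cnLawOne {s : ℝ} (hs : 0 < s) :
    Integrable (fun z => ‖z‖ ^ 2) (cnLawOne s 0) :=
  Integrable.of_integral_ne_zero (by rw [integral_sq_norm_cnLawOne hs]; positivity)

/-- The law `CN(0, s²)` is invariant under linear isometries of `ℂ = ℝ²`. -/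
lemma integral_cnLawOne_isometry (s : ℝ) (e : ℂ ≃ₗᵢ[ℝ] ℂ) (F : ℂ → ℝ) :
    ∫ z, F (e z) ∂(cnLawOne s 0) = ∫ z, F z ∂(cnLawOne s 0) := by
  simp_rw [integral_cnLawOne]
  rw [← e.measurePreserving.integral_comp e.toHomeomorph.measurableEmbedding
    (fun z => cnDensityOne s 0 z * F z)]
  simp [cnDensityOne]

lemma integrable_cnLawOne_of_sq {s : ℝ} (hs : 0 < s) {F : ℂ → ℝ} (hF : Continuous F) {C : ℝ}
    (hb : ∀ z, |F z| ≤ C * (1 + ‖z‖ ^ 2)) : Integrable F (cnLawOne s 0) := by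
  have := isProbabilityMeasure_cnLawOne hs 0
  refine Integrable.mono' (((integrable_const (1 : ℝ)).add
    (integrable_sq_norm_cnLawOne hs)).const_mul C) hF.aestronglyMeasurable
    (ae_of_all _ fun z => ?_)
  simpa using hb z

/-- The real-linear functional `z ↦ Re (conj a * z)`. -/
noncomputable def reMul (a z : ℂ) : ℝ := (star a * z).re

lemma reMul_eq (a z : ℂ) : reMul a z = a.re * z.re + a.im * z.im := by
  simp [reMul]

lemma continuous_reMul (a : ℂ) : Continuous (reMul a) := by unfold reMul; fun_prop

lemma integral_reMul_cnLawOne (s : ℝ) (a m : ℂ) :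
    ∫ z, reMul a (z - m) ∂(cnLawOne s m) = 0 := by
  rw [integral_cnLawOne_sub]
  have h := integral_cnLawOne_isometry s (LinearIsometryEquiv.neg ℝ) (reMul a)
  simp only [LinearIsometryEquiv.coe_neg, reMul, mul_neg, Complex.neg_re, integral_neg] at h
  simp only [reMul]
  linarith

lemma integral_reMul_mul_reMul_cnLawOne {s : ℝ} (hs : 0 < s) (a b m : ℂ) :
    ∫ z, reMul a (z - m) * reMul b (z - m) ∂(cnLawOne s m) = s ^ 2 / 2 * (star a * b).re := by
  rw [integral_cnLawOne_sub s m (fun z => reMul a z * reMul b z)]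
  have hn : ∀ z : ℂ, ‖z‖ ^ 2 = z.re ^ 2 + z.im ^ 2 := fun z => by
    rw [Complex.sq_norm, Complex.normSq_apply]; ring
  have irr : Integrable (fun z : ℂ => z.re ^ 2) (cnLawOne s 0) :=
    integrable_cnLawOne_of_sq hs (by fun_prop) (C := 1) fun z => by
      rw [abs_of_nonneg (sq_nonneg _), hn]; nlinarith [sq_nonneg z.im]
  have iii : Integrable (fun z : ℂ => z.im ^ 2) (cnLawOne s 0) :=
    integrable_cnLawOne_of_sq hs (by fun_prop) (C := 1) fun z => by
      rw [abs_of_nonneg (sq_nonneg _), hn]; nlinarith [sq_nonneg z.re]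
  have iri : Integrable (fun z : ℂ => z.re * z.im) (cnLawOne s 0) :=
    integrable_cnLawOne_of_sq hs (by fun_prop) (C := 1) fun z => by
      rw [abs_le, hn]
      constructor <;> nlinarith [sq_nonneg (z.re - z.im), sq_nonneg (z.re + z.im)]
  have h1 : ∫ z : ℂ, z.re * z.im ∂(cnLawOne s 0) = 0 := by
    have h := integral_cnLawOne_isometry s Complex.conjLIE (fun z => z.re * z.im)
    simp only [Complex.conjLIE_apply, Complex.conj_re, Complex.conj_im, mul_neg,
      integral_neg] at h
    linarith
  have h2 : ∫ z : ℂ, z.im ^ 2 ∂(cnLawOne s 0) = ∫ z : ℂ, z.re ^ 2 ∂(cnLawOne s 0) := by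
    have h := integral_cnLawOne_isometry s
      (rotation (⟨Complex.I, by simp [Submonoid.unitSphere]⟩ : Circle)) (fun z => z.re ^ 2)
    rw [← h]
    refine integral_congr_ae (ae_of_all _ fun z => ?_)
    have e : (rotation (⟨Complex.I, by simp [Submonoid.unitSphere]⟩ : Circle)) z
      = Complex.I * z := rfl
    simp only [e]
    simp
  have h3 := integral_sq_norm_cnLawOne hs
  simp_rw [hn] at h3
  rw [integral_add irr iii, h2] at h3
  have e : ∀ z : ℂ, reMul a z * reMul b z = (a.re * b.re) * z.re ^ 2
      + ((a.im * b.im) * z.im ^ 2 + (a.re * b.im + a.im * b.re) * (z.re * z.im)) := fun z => by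
    rw [reMul_eq, reMul_eq]; ring
  simp_rw [e]
  rw [integral_add (irr.const_mul _) (by exact (iii.const_mul _).add (iri.const_mul _)),
    integral_add (iii.const_mul _) (iri.const_mul _), integral_const_mul, integral_const_mul,
    integral_const_mul, h1, h2, show ∫ z : ℂ, z.re ^ 2 ∂(cnLawOne s 0) = s ^ 2 / 2 by linarith]
  simp
  ring


lemma memLp_reMul_cnLawOne {s : ℝ} (hs : 0 < s) (a m : ℂ) :
    MemLp (fun z => reMul a (z - m)) 2 (cnLawOne s m) := by
  have hc : Continuous fun z => reMul a (z - m) := (continuous_reMul a).comp (by fun_prop)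
  rw [memLp_two_iff_integrable_sq hc.aestronglyMeasurable]
  by_cases ha : a = 0
  · simp [ha, reMul]
  · refine Integrable.of_integral_ne_zero ?_
    simp_rw [pow_two]
    rw [integral_reMul_mul_reMul_cnLawOne hs]
    have : 0 < (star a * a).re := by
      have := Complex.normSq_pos.2 ha
      rw [Complex.normSq_apply] at this
      simpa using this
    positivity

/-- Second moments of sums of independent centred variables. -/
lemma integral_sum_mul_sum_pi {ι : Type*} [Fintype ι] {X : ι → Type*}
    [∀ i, MeasurableSpace (X i)] {μ : ∀ i, Measure (X i)} [∀ i, IsProbabilityMeasure (μ i)]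
    {f g : ∀ i, X i → ℝ} (hf : ∀ i, MemLp (f i) 2 (μ i)) (hg : ∀ i, MemLp (g i) 2 (μ i))
    (hf0 : ∀ i, ∫ x, f i x ∂(μ i) = 0) :
    ∫ x, (∑ i, f i (x i)) * ∑ i, g i (x i) ∂(Measure.pi μ) = ∑ i, ∫ x, f i x * g i x ∂(μ i) := by
  have hf' : ∀ i, MemLp (fun x : ∀ i, X i => f i (x i)) 2 (Measure.pi μ) := fun i =>
    (hf i).comp_measurePreserving (measurePreserving_eval μ i)
  have hg' : ∀ i, MemLp (fun x : ∀ i, X i => g i (x i)) 2 (Measure.pi μ) := fun i =>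
    (hg i).comp_measurePreserving (measurePreserving_eval μ i)
  have hfg : ∀ i j, Integrable (fun x : ∀ i, X i => f i (x i) * g j (x j)) (Measure.pi μ) :=
    fun i j => (hf' i).integrable_mul (hg' j)
  simp_rw [Finset.sum_mul_sum]
  rw [integral_finsetSum _ fun i _ => integrable_finsetSum _ fun j _ => hfg i j]
  refine Finset.sum_congr rfl fun i _ => ?_
  rw [integral_finsetSum _ fun j _ => hfg i j]
  rw [Finset.sum_eq_single i]
  · exact integral_comp_eval (f := fun x => f i x * g i x)
      ((hf i).aestronglyMeasurable.mul (hg i).aestronglyMeasurable)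
  · intro j _ hji
    have hind : ProbabilityTheory.IndepFun (fun x : ∀ i, X i => f i (x i))
        (fun x : ∀ i, X i => g j (x j)) (Measure.pi μ) := by
      classical
      have := (ProbabilityTheory.iIndepFun_pi (μ := μ) (X := fun k => if k = i then f k else g k)
        (fun k => by
          by_cases h : k = i
          · subst h
            simpa using (hf k).aestronglyMeasurable.aemeasurable
          · simpa [h] using (hg k).aestronglyMeasurable.aemeasurable)).indepFun hji.symm
      simpa [hji] using this
    rw [hind.integral_fun_mul_eq_mul_integral (hf' i).aestronglyMeasurable
      (hg' j).aestronglyMeasurable, integral_comp_eval (hf i).aestronglyMeasurable, hf0]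
    simp
  · simp

lemma memLp_sum_pi {ι : Type*} [Fintype ι] {X : ι → Type*}
    [∀ i, MeasurableSpace (X i)] {μ : ∀ i, Measure (X i)} [∀ i, IsProbabilityMeasure (μ i)]
    {f : ∀ i, X i → ℝ} (hf : ∀ i, MemLp (f i) 2 (μ i)) :
    MemLp (fun x : ∀ i, X i => ∑ i, f i (x i)) 2 (Measure.pi μ) :=
  memLp_finsetSum _ fun i _ => (hf i).comp_measurePreserving (measurePreserving_eval μ i)

lemma integral_sum_pi {ι : Type*} [Fintype ι] {X : ι → Type*}
    [∀ i, MeasurableSpace (X i)] {μ : ∀ i, Measure (X i)} [∀ i, IsProbabilityMeasure (μ i)]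
    {f : ∀ i, X i → ℝ} (hf : ∀ i, Integrable (f i) (μ i)) :
    ∫ x, ∑ i, f i (x i) ∂(Measure.pi μ) = ∑ i, ∫ x, f i x ∂(μ i) := by
  rw [integral_finsetSum _ fun i _ => integrable_comp_eval (hf i)]
  exact Finset.sum_congr rfl fun i _ => integral_comp_eval (hf i).aestronglyMeasurable

lemma cnDensity_eq_prod {d : ℕ} (s : ℝ) (m z : Fin d → ℂ) :
    cnDensity s m z = ∏ t, cnDensityOne s (m t) (z t) := by
  simp only [cnDensity, cnDensityOne]
  rw [Finset.prod_mul_distrib, ← Real.exp_sum, Finset.prod_const, Finset.card_univ,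
    Fintype.card_fin, inv_pow, ← Finset.sum_neg_distrib, Finset.sum_div]

lemma cnDensity_pos {d : ℕ} {s : ℝ} (hs : 0 < s) (m z : Fin d → ℂ) : 0 < cnDensity s m z := by
  unfold cnDensity; have := Real.pi_pos; positivity

lemma cnLaw_eq_pi {d : ℕ} {s : ℝ} (hs : 0 < s) (m : Fin d → ℂ) :
    cnLaw s m = Measure.pi fun t => cnLawOne s (m t) := by
  simp only [cnLaw, cnLawOne, cnDensity_eq_prod]
  exact (pi_withDensity_ofReal (fun t => cnDensityOne_nonneg s (m t))
    fun t => integrable_cnDensityOne hs (m t)).symm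

lemma isProbabilityMeasure_cnLaw {d : ℕ} {s : ℝ} (hs : 0 < s) (m : Fin d → ℂ) :
    IsProbabilityMeasure (cnLaw s m) := by
  rw [cnLaw_eq_pi hs]
  have := fun t => isProbabilityMeasure_cnLawOne hs (m t)
  infer_instance

lemma integrable_cnDensity {d : ℕ} {s : ℝ} (hs : 0 < s) (m : Fin d → ℂ) :
    Integrable (cnDensity s m) := by
  have h : Integrable (fun z : Fin d → ℂ => ∏ t, cnDensityOne s (m t) (z t)) :=
    Integrable.fintype_prod_dep fun t => integrable_cnDensityOne hs (m t)
  exact h.congr (ae_of_all _ fun z => (cnDensity_eq_prod s m z).symm)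

/-- The real inner product `Re ⟨a, z⟩` on `ℂ^d`. -/
noncomputable def reDot {d : ℕ} (a z : Fin d → ℂ) : ℝ := ∑ t, reMul (a t) (z t)

lemma memLp_reDot_cnLaw {d : ℕ} {s : ℝ} (hs : 0 < s) (a m : Fin d → ℂ) :
    MemLp (fun z => reDot a (z - m)) 2 (cnLaw s m) := by
  rw [cnLaw_eq_pi hs]
  have := fun t => isProbabilityMeasure_cnLawOne hs (m t)
  exact memLp_sum_pi (f := fun t z => reMul (a t) (z - m t))
    fun t => memLp_reMul_cnLawOne hs (a t) (m t)

lemma integral_reDot_cnLaw {d : ℕ} {s : ℝ} (hs : 0 < s) (a m : Fin d → ℂ) :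
    ∫ z, reDot a (z - m) ∂(cnLaw s m) = 0 := by
  rw [cnLaw_eq_pi hs]
  have := fun t => isProbabilityMeasure_cnLawOne hs (m t)
  exact (integral_sum_pi (f := fun t z => reMul (a t) (z - m t))
    fun t => (memLp_reMul_cnLawOne hs (a t) (m t)).integrable (by norm_num)).trans
      (by simp [integral_reMul_cnLawOne])

lemma integral_reDot_mul_reDot_cnLaw {d : ℕ} {s : ℝ} (hs : 0 < s) (a b m : Fin d → ℂ) :
    ∫ z, reDot a (z - m) * reDot b (z - m) ∂(cnLaw s m) = s ^ 2 / 2 * (star a ⬝ᵥ b).re := by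
  rw [cnLaw_eq_pi hs]
  have := fun t => isProbabilityMeasure_cnLawOne hs (m t)
  refine (integral_sum_mul_sum_pi (f := fun t z => reMul (a t) (z - m t))
    (g := fun t z => reMul (b t) (z - m t)) (fun t => memLp_reMul_cnLawOne hs (a t) (m t))
    (fun t => memLp_reMul_cnLawOne hs (b t) (m t))
    fun t => integral_reMul_cnLawOne _ _ _).trans ?_
  simp only [integral_reMul_mul_reMul_cnLawOne hs, dotProduct, Complex.re_sum, Pi.star_apply,
    Finset.mul_sum]

lemma memLp_sum_reDot {N d : ℕ} {s : ℝ} (hs : 0 < s) (a m : Fin N → Fin d → ℂ) :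
    MemLp (fun z : Fin N → Fin d → ℂ => ∑ n, reDot (a n) (z n - m n)) 2
      (Measure.pi fun n => cnLaw s (m n)) := by
  have := fun n => isProbabilityMeasure_cnLaw hs (m n)
  exact memLp_sum_pi (f := fun n z => reDot (a n) (z - m n))
    fun n => memLp_reDot_cnLaw hs (a n) (m n)

lemma integral_sum_reDot {N d : ℕ} {s : ℝ} (hs : 0 < s) (a m : Fin N → Fin d → ℂ) :
    ∫ z, ∑ n, reDot (a n) (z n - m n) ∂(Measure.pi fun n => cnLaw s (m n)) = 0 := by
  have := fun n => isProbabilityMeasure_cnLaw hs (m n)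
  exact (integral_sum_pi (f := fun n z => reDot (a n) (z - m n))
    fun n => (memLp_reDot_cnLaw hs (a n) (m n)).integrable (by norm_num)).trans
      (by simp [integral_reDot_cnLaw hs])

lemma integral_sum_reDot_mul_sum_reDot {N d : ℕ} {s : ℝ} (hs : 0 < s)
    (a b m : Fin N → Fin d → ℂ) :
    ∫ z, (∑ n, reDot (a n) (z n - m n)) * (∑ n, reDot (b n) (z n - m n))
      ∂(Measure.pi fun n => cnLaw s (m n)) = s ^ 2 / 2 * ∑ n, (star (a n) ⬝ᵥ b n).re := by
  have := fun n => isProbabilityMeasure_cnLaw hs (m n)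
  refine (integral_sum_mul_sum_pi (f := fun n z => reDot (a n) (z - m n))
    (g := fun n z => reDot (b n) (z - m n)) (fun n => memLp_reDot_cnLaw hs (a n) (m n))
    (fun n => memLp_reDot_cnLaw hs (b n) (m n))
    fun n => integral_reDot_cnLaw hs _ _).trans ?_
  simp only [integral_reDot_mul_reDot_cnLaw hs, Finset.mul_sum]

/-! ### A variational formula for the trace of the inverse -/

/-- Completing the square: the gap in the variational bound is `tr ((A⁻¹ - B) A (A⁻¹ - B)ᵀ)`. -/
lemma trace_gap {K : ℕ} {A : Matrix (Fin K) (Fin K) ℝ} (hA : A.PosDef)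
    (B : Matrix (Fin K) (Fin K) ℝ) :
    ((A⁻¹ - B) * A * (A⁻¹ - B)ᵀ).trace
      = A⁻¹.trace - (2 * B.trace - (B * A * Bᵀ).trace) := by
  have hu : IsUnit A.det := A.isUnit_iff_isUnit_det.1 hA.isUnit
  have hs : Aᵀ = A := by simpa using hA.isHermitian.eq
  have h1 : A⁻¹ * A = 1 := Matrix.nonsing_inv_mul A hu
  have h2 : A * A⁻¹ = 1 := Matrix.mul_nonsing_inv A hu
  have h3 : (A⁻¹)ᵀ = A⁻¹ := by rw [Matrix.transpose_nonsing_inv, hs]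
  have e : (A⁻¹ - B) * A * (A⁻¹ - B)ᵀ = A⁻¹ - Bᵀ - B + B * A * Bᵀ := by
    rw [Matrix.transpose_sub, h3, sub_mul, h1, sub_mul, one_mul, mul_sub, mul_assoc B A A⁻¹, h2,
      mul_one]
    abel
  rw [e]
  simp only [Matrix.trace_add, Matrix.trace_sub, Matrix.trace_transpose]
  ring

lemma two_mul_trace_sub_le_trace_inv {K : ℕ} {A : Matrix (Fin K) (Fin K) ℝ} (hA : A.PosDef)
    (B : Matrix (Fin K) (Fin K) ℝ) : 2 * B.trace - (B * A * Bᵀ).trace ≤ A⁻¹.trace := by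
  have h := (hA.posSemidef.mul_mul_conjTranspose_same (A⁻¹ - B)).trace_nonneg
  rw [Matrix.conjTranspose_eq_transpose_of_trivial, trace_gap hA] at h
  linarith

lemma ofReal_le_invTrace {K : ℕ} (A B : Matrix (Fin K) (Fin K) ℝ) :
    ENNReal.ofReal (2 * B.trace - (B * A * Bᵀ).trace) ≤ invTrace A := by
  unfold invTrace
  split_ifs with h
  · exact ENNReal.ofReal_le_ofReal (two_mul_trace_sub_le_trace_inv h B)
  · exact le_top

/-- For positive semidefinite `A`, `tr A⁻¹` is the supremum over all `B` of the affine functions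
`2 tr B - tr (B A Bᵀ)` of `A`; it is infinite in the singular case. -/
lemma invTrace_le_ofReal {K : ℕ} {A : Matrix (Fin K) (Fin K) ℝ} (hA : A.PosSemidef) {c : ℝ}
    (h : ∀ B : Matrix (Fin K) (Fin K) ℝ, 2 * B.trace - (B * A * Bᵀ).trace ≤ c) :
    invTrace A ≤ ENNReal.ofReal c := by
  unfold invTrace
  split_ifs with hp
  · refine ENNReal.ofReal_le_ofReal ?_
    have h0 := trace_gap hp A⁻¹
    simp only [sub_self, zero_mul, Matrix.trace_zero] at h0
    linarith [h A⁻¹]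
  · exfalso
    obtain ⟨v, hv, hv0⟩ : ∃ v, v ≠ 0 ∧ A *ᵥ v = 0 := by
      by_contra hcon
      push Not at hcon
      refine hp (Matrix.PosDef.of_dotProduct_mulVec_pos hA.isHermitian fun x hx => ?_)
      refine lt_of_le_of_ne (hA.dotProduct_mulVec_nonneg x) fun h0 => hcon x hx ?_
      exact (hA.dotProduct_mulVec_zero_iff x).1 h0.symm
    have hvv : 0 < v ⬝ᵥ v := by
      have := Matrix.dotProduct_star_self_pos_iff.2 hv
      simpa using this
    have h1 := h ((c / (v ⬝ᵥ v)) • Matrix.vecMulVec v v)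
    have h2 := h ((1 / (v ⬝ᵥ v)) • Matrix.vecMulVec v v)
    have hz : ∀ t : ℝ, (t • Matrix.vecMulVec v v) * A * (t • Matrix.vecMulVec v v)ᵀ = 0 := by
      intro t
      rw [Matrix.transpose_smul, Matrix.transpose_vecMulVec, mul_assoc, Matrix.mul_smul,
        Matrix.mul_vecMulVec, hv0, Matrix.zero_vecMulVec]
      simp
    rw [hz, Matrix.trace_zero, Matrix.trace_smul, Matrix.trace_vecMulVec, smul_eq_mul,
      div_mul_cancel₀ _ hvv.ne'] at h1 h2
    linarith

namespace Model

variable {M L T K : ℕ} (𝓜 : Model M L T K)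

/-! ### The conditional Fisher information matrix -/

lemma condFIM_apply (θ : Fin K → ℝ) (Q : Matrix (Fin M) (Fin M) ℂ) (i j : Fin K) :
    𝓜.condFIM θ Q i j = 2 / 𝓜.συ ^ 2 * (Matrix.trace (𝓜.dG θ j * Q * (𝓜.dG θ i)ᴴ)).re := rfl

lemma condFIM_add (θ : Fin K → ℝ) (Q Q' : Matrix (Fin M) (Fin M) ℂ) :
    𝓜.condFIM θ (Q + Q') = 𝓜.condFIM θ Q + 𝓜.condFIM θ Q' := by
  ext i j
  simp only [Matrix.add_apply, condFIM_apply, Matrix.mul_add, Matrix.add_mul, Matrix.trace_add,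
    Complex.add_re, mul_add]

lemma condFIM_smul (θ : Fin K → ℝ) (c : ℝ) (Q : Matrix (Fin M) (Fin M) ℂ) :
    𝓜.condFIM θ ((c : ℂ) • Q) = c • 𝓜.condFIM θ Q := by
  ext i j
  simp only [Matrix.smul_apply, condFIM_apply, Matrix.mul_smul, Matrix.smul_mul,
    Matrix.trace_smul, smul_eq_mul, Complex.re_ofReal_mul]
  ring

lemma condFIM_zero (θ : Fin K → ℝ) : 𝓜.condFIM θ 0 = 0 := by
  ext i j
  simp [condFIM_apply]

lemma condFIM_sum {ι : Type*} (s : Finset ι) (θ : Fin K → ℝ)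
    (Q : ι → Matrix (Fin M) (Fin M) ℂ) :
    𝓜.condFIM θ (∑ n ∈ s, Q n) = ∑ n ∈ s, 𝓜.condFIM θ (Q n) := by
  classical
  induction s using Finset.induction_on with
  | empty => simp [condFIM_zero]
  | insert a s ha ih => rw [Finset.sum_insert ha, Finset.sum_insert ha, condFIM_add, ih]

lemma condFIM_vecMulVec (θ : Fin K → ℝ) (x : Fin M → ℂ) (i j : Fin K) :
    𝓜.condFIM θ (Matrix.vecMulVec x (star x)) i j
      = 2 / 𝓜.συ ^ 2 * (star (𝓜.dG θ i *ᵥ x) ⬝ᵥ (𝓜.dG θ j *ᵥ x)).re := by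
  rw [condFIM_apply, Matrix.mul_vecMulVec, Matrix.vecMulVec_mul, Matrix.trace_vecMulVec,
    ← Matrix.star_mulVec, dotProduct_comm]

/-- Expansion of `J(θ | Q)` in the entries of `Q`. -/
lemma condFIM_eq_sum (θ : Fin K → ℝ) (Q : Matrix (Fin M) (Fin M) ℂ) (i j : Fin K) :
    𝓜.condFIM θ Q i j = ∑ t, ∑ b, ∑ a,
      (2 / 𝓜.συ ^ 2) * (𝓜.dG θ j t a * Q a b * star (𝓜.dG θ i t b)).re := by
  simp only [condFIM_apply, Matrix.trace, Matrix.diag, Matrix.mul_apply, Finset.sum_mul,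
    Complex.re_sum, Finset.mul_sum, Matrix.conjTranspose_apply]

lemma condFIM_posSemidef (θ : Fin K → ℝ) {Q : Matrix (Fin M) (Fin M) ℂ} (hQ : Q.PosSemidef) :
    (𝓜.condFIM θ Q).PosSemidef := by
  refine Matrix.PosSemidef.of_dotProduct_mulVec_nonneg ?_ fun v => ?_
  · ext i j
    simp only [Matrix.conjTranspose_apply, star_trivial, condFIM_apply]
    rw [← Complex.conj_re, starRingEnd_apply, ← Matrix.trace_conjTranspose]
    simp [Matrix.conjTranspose_mul, hQ.isHermitian.eq, Matrix.mul_assoc]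
  · have h := (hQ.mul_mul_conjTranspose_same (∑ i, (v i : ℂ) • 𝓜.dG θ i)).trace_nonneg
    have e : star v ⬝ᵥ 𝓜.condFIM θ Q *ᵥ v
        = 2 / 𝓜.συ ^ 2 * (Matrix.trace ((∑ i, (v i : ℂ) • 𝓜.dG θ i) * Q
          * (∑ i, (v i : ℂ) • 𝓜.dG θ i)ᴴ)).re := by
      simp only [dotProduct, Matrix.mulVec, star_trivial, condFIM_apply, Finset.mul_sum,
        Matrix.sum_mul, Matrix.mul_sum, Matrix.conjTranspose_sum, Matrix.conjTranspose_smul,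
        Matrix.trace_sum, Complex.re_sum, Matrix.smul_mul, Matrix.mul_smul, Matrix.trace_smul,
        smul_eq_mul, Pi.star_apply]
      refine Finset.sum_congr rfl fun i _ => Finset.sum_congr rfl fun j _ => ?_
      simp only [Complex.star_def, Complex.conj_ofReal, Complex.re_ofReal_mul]
      ring
    rw [e]
    have := (Complex.le_def.1 h).1
    simp only [Complex.zero_re] at this
    positivity

lemma measurable_dG (i : Fin K) (t : Fin T) (m : Fin M) : Measurable fun θ => 𝓜.dG θ i t m :=
  measurable_fderiv_apply_const ℝ (fun θ' => 𝓜.G θ' t m) (Pi.single i 1)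

lemma measurable_condFIM (Q : Matrix (Fin M) (Fin M) ℂ) (i j : Fin K) :
    Measurable fun θ => 𝓜.condFIM θ Q i j := by
  simp only [condFIM_eq_sum]
  refine Finset.measurable_fun_sum _ fun t _ => Finset.measurable_fun_sum _ fun b _ =>
    Finset.measurable_fun_sum _ fun a _ => Measurable.const_mul (Complex.measurable_re.comp ?_) _
  exact ((𝓜.measurable_dG j t a).mul_const _).mul
    (continuous_star.measurable.comp (𝓜.measurable_dG i t b))

lemma measurable_priorScore (i : Fin K) : Measurable fun θ => 𝓜.priorScore θ i :=
  measurable_fderiv_apply_const ℝ (fun θ' => Real.log (𝓜.f θ')) (Pi.single i 1)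

lemma isProbabilityMeasure_prior : IsProbabilityMeasure 𝓜.prior := by
  constructor
  rw [prior, withDensity_apply _ MeasurableSet.univ, setLIntegral_univ, 𝓜.f_lintegral]

lemma ae_prior_pos : ∀ᵐ θ ∂𝓜.prior, 0 < 𝓜.f θ := by
  rw [prior, ae_withDensity_iff 𝓜.f_meas.ennreal_ofReal]
  exact ae_of_all _ fun θ h => by simpa using h

variable {𝓜}

lemma Regular.memLp_dG (h : 𝓜.Regular) (i : Fin K) (t : Fin T) (m : Fin M) :
    MemLp (fun θ => 𝓜.dG θ i t m) 2 𝓜.prior :=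
  (memLp_two_iff_integrable_sq_norm (𝓜.measurable_dG i t m).aestronglyMeasurable).2 (h.fim i t m)

lemma Regular.memLp_priorScore (h : 𝓜.Regular) (i : Fin K) :
    MemLp (fun θ => 𝓜.priorScore θ i) 2 𝓜.prior :=
  (memLp_two_iff_integrable_sq (𝓜.measurable_priorScore i).aestronglyMeasurable).2
    (h.prior_info i)

lemma Regular.integrable_condFIM (h : 𝓜.Regular) (Q : Matrix (Fin M) (Fin M) ℂ) (i j : Fin K) :
    Integrable (fun θ => 𝓜.condFIM θ Q i j) 𝓜.prior := by
  simp only [condFIM_eq_sum]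
  refine integrable_finsetSum _ fun t _ => integrable_finsetSum _ fun b _ =>
    integrable_finsetSum _ fun a _ => Integrable.const_mul ?_ _
  have h1 := (h.memLp_dG j t a).integrable_mul (h.memLp_dG i t b).star
  refine ((h1.mul_const (Q a b)).re).congr (ae_of_all _ fun θ => ?_)
  simp only [Pi.mul_apply, Pi.star_apply, RCLike.re_to_complex]
  ring_nf

lemma Regular.expFIM_add (h : 𝓜.Regular) (Q Q' : Matrix (Fin M) (Fin M) ℂ) :
    𝓜.expFIM (Q + Q') = 𝓜.expFIM Q + 𝓜.expFIM Q' := by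
  ext i j
  simp only [expFIM, condFIM_add, Matrix.of_apply, Matrix.add_apply]
  exact integral_add (h.integrable_condFIM Q i j) (h.integrable_condFIM Q' i j)

lemma expFIM_smul (c : ℝ) (Q : Matrix (Fin M) (Fin M) ℂ) :
    𝓜.expFIM ((c : ℂ) • Q) = c • 𝓜.expFIM Q := by
  ext i j
  simp only [expFIM, condFIM_smul, Matrix.of_apply, Matrix.smul_apply, smul_eq_mul]
  exact integral_const_mul _ _

lemma Regular.expFIM_sum (h : 𝓜.Regular) {ι : Type*} (s : Finset ι)
    (Q : ι → Matrix (Fin M) (Fin M) ℂ) :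
    𝓜.expFIM (∑ n ∈ s, Q n) = ∑ n ∈ s, 𝓜.expFIM (Q n) := by
  classical
  induction s using Finset.induction_on with
  | empty => ext i j; simp [expFIM, condFIM_zero]
  | insert a s ha ih => rw [Finset.sum_insert ha, Finset.sum_insert ha, h.expFIM_add, ih]

/-- The trace `tr (B A Bᵀ)` written in the entries of `A`. -/
lemma trace_mul_mul_transpose (A B : Matrix (Fin K) (Fin K) ℝ) :
    (B * A * Bᵀ).trace = ∑ i, ∑ j, ∑ k, B i k * B i j * A k j := by
  simp only [Matrix.trace, Matrix.diag, Matrix.mul_apply, Matrix.transpose_apply, Finset.sum_mul]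
  refine Finset.sum_congr rfl fun i _ => Finset.sum_congr rfl fun j _ =>
    Finset.sum_congr rfl fun k _ => by ring

lemma Regular.integrable_trace_condFIM (h : 𝓜.Regular) (Q : Matrix (Fin M) (Fin M) ℂ)
    (B : Matrix (Fin K) (Fin K) ℝ) :
    Integrable (fun θ => (B * 𝓜.condFIM θ Q * Bᵀ).trace) 𝓜.prior := by
  simp only [trace_mul_mul_transpose]
  exact integrable_finsetSum _ fun i _ => integrable_finsetSum _ fun j _ =>
    integrable_finsetSum _ fun k _ => (h.integrable_condFIM Q k j).const_mul _

lemma Regular.integral_trace_condFIM (h : 𝓜.Regular) (Q : Matrix (Fin M) (Fin M) ℂ)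
    (B : Matrix (Fin K) (Fin K) ℝ) :
    ∫ θ, (B * 𝓜.condFIM θ Q * Bᵀ).trace ∂𝓜.prior = (B * 𝓜.expFIM Q * Bᵀ).trace := by
  simp only [trace_mul_mul_transpose]
  have hi : ∀ i j k, Integrable (fun θ => B i k * B i j * 𝓜.condFIM θ Q k j) 𝓜.prior :=
    fun i j k => (h.integrable_condFIM Q k j).const_mul _
  rw [integral_finsetSum _ fun i _ => integrable_finsetSum _ fun j _ =>
    integrable_finsetSum _ fun k _ => hi i j k]
  refine Finset.sum_congr rfl fun i _ => ?_
  rw [integral_finsetSum _ fun j _ => integrable_finsetSum _ fun k _ => hi i j k]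
  refine Finset.sum_congr rfl fun j _ => ?_
  rw [integral_finsetSum _ fun k _ => hi i j k]
  exact Finset.sum_congr rfl fun k _ => integral_const_mul _ _

lemma Regular.expFIM_posSemidef (h : 𝓜.Regular) {Q : Matrix (Fin M) (Fin M) ℂ}
    (hQ : Q.PosSemidef) : (𝓜.expFIM Q).PosSemidef := by
  refine Matrix.PosSemidef.of_dotProduct_mulVec_nonneg ?_ fun v => ?_
  · ext i j
    simp only [Matrix.conjTranspose_apply, star_trivial, expFIM, Matrix.of_apply]
    refine integral_congr_ae (ae_of_all _ fun θ => ?_)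
    simpa using congrFun₂ (𝓜.condFIM_posSemidef θ hQ).isHermitian.eq i j
  · have e : star v ⬝ᵥ 𝓜.expFIM Q *ᵥ v
        = ∫ θ, star v ⬝ᵥ 𝓜.condFIM θ Q *ᵥ v ∂𝓜.prior := by
      simp only [dotProduct, Matrix.mulVec, Finset.mul_sum]
      have hi : ∀ i j, Integrable (fun θ => star v i * (𝓜.condFIM θ Q i j * v j)) 𝓜.prior :=
        fun i j => ((h.integrable_condFIM Q i j).mul_const _).const_mul _
      rw [integral_finsetSum _ fun i _ => integrable_finsetSum _ fun j _ => hi i j]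
      refine Finset.sum_congr rfl fun i _ => ?_
      rw [integral_finsetSum _ fun j _ => hi i j]
      refine Finset.sum_congr rfl fun j _ => ?_
      rw [integral_const_mul, integral_mul_const]
      rfl
    rw [e]
    exact integral_nonneg fun θ => (𝓜.condFIM_posSemidef θ hQ).dotProduct_mulVec_nonneg v

lemma Regular.priorInfo_posSemidef (h : 𝓜.Regular) : 𝓜.priorInfo.PosSemidef := by
  refine Matrix.PosSemidef.of_dotProduct_mulVec_nonneg ?_ fun v => ?_
  · ext i j
    simp only [Matrix.conjTranspose_apply, star_trivial, priorInfo, Matrix.of_apply]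
    exact integral_congr_ae (ae_of_all _ fun θ => mul_comm _ _)
  · have e : star v ⬝ᵥ 𝓜.priorInfo *ᵥ v
        = ∫ θ, (∑ i, v i * 𝓜.priorScore θ i) ^ 2 ∂𝓜.prior := by
      simp only [dotProduct, Matrix.mulVec, Finset.mul_sum, pow_two, Finset.sum_mul]
      have hi : ∀ i j, Integrable (fun θ => v i * 𝓜.priorScore θ i * (v j * 𝓜.priorScore θ j))
          𝓜.prior := fun i j => by
        refine (((h.memLp_priorScore i).integrable_mul
          (h.memLp_priorScore j)).const_mul (v i * v j)).congr (ae_of_all _ fun θ => ?_)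
        simp only [Pi.mul_apply]; ring
      rw [integral_finsetSum _ fun j _ => integrable_finsetSum _ fun i _ => hi i j,
        Finset.sum_comm]
      refine Finset.sum_congr rfl fun j _ => ?_
      rw [integral_finsetSum _ fun i _ => hi i j]
      refine Finset.sum_congr rfl fun i _ => ?_
      simp only [priorInfo, Matrix.of_apply, star_trivial, Pi.star_apply]
      rw [← integral_mul_const, ← integral_const_mul]
      exact integral_congr_ae (ae_of_all _ fun θ => by ring)
    rw [e]
    exact integral_nonneg fun θ => sq_nonneg _

end Model

lemma Model.empCov_posSemidef {M N : ℕ} (x : Fin N → Fin M → ℂ) :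
    (Model.empCov x).PosSemidef := by
  refine (Matrix.posSemidef_sum _ fun n _ =>
    Matrix.posSemidef_vecMulVec_self_star (x n)).smul ?_
  rw [Complex.zero_le_real]
  positivity

namespace Model

variable {M L T K N : ℕ} (𝓜 : Model M L T K)

/-! ### Scores -/

lemma hasLineDerivAt_mulVec {θ : Fin K → ℝ} (hθ : 0 < 𝓜.f θ) (x : Fin M → ℂ) (i : Fin K)
    (t : Fin T) :
    HasLineDerivAt ℝ (fun θ' => (𝓜.G θ' *ᵥ x) t) ((𝓜.dG θ i *ᵥ x) t) θ (Pi.single i 1) := by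
  simp only [Matrix.mulVec, dotProduct]
  refine HasDerivAt.fun_sum fun m _ => HasDerivAt.mul_const ?_ _
  exact (𝓜.G_diff θ hθ t m).hasFDerivAt.hasLineDerivAt _

/-- The squared distance of `z` to the mean `G(θ) x`. -/
noncomputable def energy (x : Fin M → ℂ) (z : Fin T → ℂ) (θ : Fin K → ℝ) : ℝ :=
  ∑ t, ‖z t - (𝓜.G θ *ᵥ x) t‖ ^ 2

lemma hasLineDerivAt_energy {θ : Fin K → ℝ} (hθ : 0 < 𝓜.f θ) (x : Fin M → ℂ) (z : Fin T → ℂ)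
    (i : Fin K) :
    HasLineDerivAt ℝ (𝓜.energy x z) (-2 * reDot (𝓜.dG θ i *ᵥ x) (z - 𝓜.G θ *ᵥ x)) θ
      (Pi.single i 1) := by
  have h : ∀ t, HasLineDerivAt ℝ (fun θ' => ‖z t - (𝓜.G θ' *ᵥ x) t‖ ^ 2)
      (-2 * reMul ((𝓜.dG θ i *ᵥ x) t) (z t - (𝓜.G θ *ᵥ x) t)) θ (Pi.single i 1) := by
    intro t
    have h1 := ((𝓜.hasLineDerivAt_mulVec hθ x i t).const_sub (z t)).norm_sq
    unfold HasLineDerivAt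
    convert! h1 using 1
    simp only [zero_smul, add_zero, Complex.inner, reMul_eq]
    simp
    ring
  have h2 := HasDerivAt.fun_sum (u := Finset.univ) fun t _ => h t
  unfold HasLineDerivAt
  convert! h2 using 1
  simp [reDot, Finset.mul_sum]

lemma differentiableAt_energy {θ : Fin K → ℝ} (hθ : 0 < 𝓜.f θ) (x : Fin M → ℂ)
    (z : Fin T → ℂ) : DifferentiableAt ℝ (𝓜.energy x z) θ := by
  unfold energy
  refine DifferentiableAt.fun_sum fun t _ => DifferentiableAt.norm_sq ℝ ?_
  simp only [Matrix.mulVec, dotProduct]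
  exact (differentiableAt_const _).sub
    (DifferentiableAt.fun_sum fun m _ => (𝓜.G_diff θ hθ t m).mul_const _)

lemma cnDensity_eq_energy (x : Fin M → ℂ) (z : Fin T → ℂ) (θ : Fin K → ℝ) :
    cnDensity 𝓜.συ (𝓜.G θ *ᵥ x) z
      = ((Real.pi * 𝓜.συ ^ 2) ^ T)⁻¹ * Real.exp (-𝓜.energy x z θ / 𝓜.συ ^ 2) := rfl

lemma score_eq {θ : Fin K → ℝ} (hθ : 0 < 𝓜.f θ) (x : Fin M → ℂ) (z : Fin T → ℂ) (i : Fin K) :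
    𝓜.score θ x z i = 2 / 𝓜.συ ^ 2 * reDot (𝓜.dG θ i *ᵥ x) (z - 𝓜.G θ *ᵥ x) := by
  have hσ := 𝓜.συ_pos
  have hpi := Real.pi_pos
  have e : (fun θ' => Real.log (cnDensity 𝓜.συ (𝓜.G θ' *ᵥ x) z))
      = fun θ' => Real.log ((Real.pi * 𝓜.συ ^ 2) ^ T)⁻¹
        + -(1 / 𝓜.συ ^ 2) * 𝓜.energy x z θ' := by
    funext θ'
    rw [cnDensity_eq_energy, Real.log_mul (by positivity) (by positivity), Real.log_exp]
    ring
  have hd := 𝓜.differentiableAt_energy hθ x z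
  rw [score, e, fderiv_const_add, fderiv_const_mul hd, _root_.smul_apply,
    ← hd.lineDeriv_eq_fderiv, (𝓜.hasLineDerivAt_energy hθ x z i).lineDeriv, smul_eq_mul]
  ring

lemma fisherInfo_eq {θ : Fin K → ℝ} (hθ : 0 < 𝓜.f θ) (x : Fin M → ℂ) :
    𝓜.fisherInfo θ x = 𝓜.condFIM θ (Matrix.vecMulVec x (star x)) := by
  ext i j
  have hσ := 𝓜.συ_pos
  simp only [fisherInfo, Matrix.of_apply, 𝓜.score_eq hθ, condFIM_vecMulVec]
  have e : ∀ z : Fin T → ℂ, 2 / 𝓜.συ ^ 2 * reDot (𝓜.dG θ i *ᵥ x) (z - 𝓜.G θ *ᵥ x)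
      * (2 / 𝓜.συ ^ 2 * reDot (𝓜.dG θ j *ᵥ x) (z - 𝓜.G θ *ᵥ x))
      = (4 / 𝓜.συ ^ 4) * (reDot (𝓜.dG θ i *ᵥ x) (z - 𝓜.G θ *ᵥ x)
        * reDot (𝓜.dG θ j *ᵥ x) (z - 𝓜.G θ *ᵥ x)) := fun z => by ring
  simp_rw [e]
  rw [integral_const_mul, integral_reDot_mul_reDot_cnLaw hσ]
  field_simp
  ring

/-- `J(θ | Q)` is the expected Fisher information of any random input with covariance `Q`. -/
lemma condFIM_eq_integral_fisherInfo (μ : Measure (Fin M → ℂ)) (Q : Matrix (Fin M) (Fin M) ℂ)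
    (hμ : ∀ a, Integrable (fun x : Fin M → ℂ => ‖x a‖ ^ 2) μ)
    (hQ : ∀ a b, ∫ x, x a * star (x b) ∂μ = Q a b) {θ : Fin K → ℝ} (hθ : 0 < 𝓜.f θ)
    (i j : Fin K) : 𝓜.condFIM θ Q i j = ∫ x, 𝓜.fisherInfo θ x i j ∂μ := by
  have hL : ∀ a, MemLp (fun x : Fin M → ℂ => x a) 2 μ := fun a =>
    (memLp_two_iff_integrable_sq_norm (measurable_pi_apply a).aestronglyMeasurable).2 (hμ a)
  have hab : ∀ a b, Integrable (fun x : Fin M → ℂ => x a * star (x b)) μ := fun a b =>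
    (hL a).integrable_mul (hL b).star
  simp only [𝓜.fisherInfo_eq hθ, condFIM_eq_sum, Matrix.vecMulVec_apply, Pi.star_apply]
  have hI : ∀ t b a, Integrable (fun x : Fin M → ℂ => 2 / 𝓜.συ ^ 2
      * (𝓜.dG θ j t a * (x a * star (x b)) * star (𝓜.dG θ i t b)).re) μ := fun t b a =>
    (((hab a b).const_mul _).mul_const _).re.const_mul _
  rw [integral_finsetSum _ fun t _ => integrable_finsetSum _ fun b _ =>
    integrable_finsetSum _ fun a _ => hI t b a]
  refine Finset.sum_congr rfl fun t _ => ?_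
  rw [integral_finsetSum _ fun b _ => integrable_finsetSum _ fun a _ => hI t b a]
  refine Finset.sum_congr rfl fun b _ => ?_
  rw [integral_finsetSum _ fun a _ => hI t b a]
  refine Finset.sum_congr rfl fun a _ => ?_
  rw [integral_const_mul, ← hQ a b]
  congr 1
  have h1 := integral_re (𝕜 := ℂ) (((hab a b).const_mul (𝓜.dG θ j t a)).mul_const
    (star (𝓜.dG θ i t b)))
  simp only [RCLike.re_to_complex] at h1
  rw [h1, integral_mul_const, integral_const_mul]

/-! ### The joint law of the parameter and a block of observations -/

/-- Density of a block of sensor observations. -/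
noncomputable def blockDensity (x : Fin N → Fin M → ℂ) (θ : Fin K → ℝ)
    (z : Fin N → Fin T → ℂ) : ℝ :=
  ∏ n, cnDensity 𝓜.συ (𝓜.G θ *ᵥ x n) (z n)

/-- The `i`-th entry of the score of a block of sensor observations. -/
noncomputable def blockScore (x : Fin N → Fin M → ℂ) (θ : Fin K → ℝ) (z : Fin N → Fin T → ℂ)
    (i : Fin K) : ℝ :=
  2 / 𝓜.συ ^ 2 * ∑ n, reDot (𝓜.dG θ i *ᵥ x n) (z n - 𝓜.G θ *ᵥ x n)

lemma blockDensity_pos (x : Fin N → Fin M → ℂ) (θ : Fin K → ℝ) (z : Fin N → Fin T → ℂ) :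
    0 < 𝓜.blockDensity x θ z :=
  Finset.prod_pos fun _ _ => cnDensity_pos 𝓜.συ_pos _ _

lemma sensorLaw_eq (x : Fin N → Fin M → ℂ) (θ : Fin K → ℝ) :
    𝓜.sensorLaw θ x = volume.withDensity fun z => ENNReal.ofReal (𝓜.blockDensity x θ z) :=
  pi_withDensity_ofReal (fun _ _ => (cnDensity_pos 𝓜.συ_pos _ _).le)
    fun _ => integrable_cnDensity 𝓜.συ_pos _

lemma isProbabilityMeasure_sensorLaw (x : Fin N → Fin M → ℂ) (θ : Fin K → ℝ) :
    IsProbabilityMeasure (𝓜.sensorLaw θ x) := by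
  have := fun n => isProbabilityMeasure_cnLaw 𝓜.συ_pos (𝓜.G θ *ᵥ x n)
  unfold sensorLaw
  infer_instance

lemma hasLineDerivAt_blockDensity {θ : Fin K → ℝ} (hθ : 0 < 𝓜.f θ) (x : Fin N → Fin M → ℂ)
    (z : Fin N → Fin T → ℂ) (i : Fin K) :
    HasLineDerivAt ℝ (fun θ' => 𝓜.blockDensity x θ' z)
      (𝓜.blockDensity x θ z * 𝓜.blockScore x θ z i) θ (Pi.single i 1) := by
  have hf : ∀ θ', 𝓜.blockDensity x θ' z = (((Real.pi * 𝓜.συ ^ 2) ^ T)⁻¹) ^ N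
      * Real.exp (-(∑ n, 𝓜.energy (x n) (z n) θ') / 𝓜.συ ^ 2) := by
    intro θ'
    simp only [blockDensity, cnDensity_eq_energy]
    rw [Finset.prod_mul_distrib, Finset.prod_const, ← Real.exp_sum, Finset.card_univ,
      Fintype.card_fin, ← Finset.sum_neg_distrib, Finset.sum_div]
  have h := (((HasDerivAt.fun_sum (u := Finset.univ) fun n _ =>
    𝓜.hasLineDerivAt_energy hθ (x n) (z n) i).neg.div_const (𝓜.συ ^ 2)).exp.const_mul
      ((((Real.pi * 𝓜.συ ^ 2) ^ T)⁻¹) ^ N))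
  simp only [hf]
  unfold HasLineDerivAt
  convert! h using 1
  simp only [Pi.neg_apply, zero_smul, add_zero, blockScore, ← Finset.mul_sum]
  ring

lemma measurable_mulVec_G (x : Fin M → ℂ) (t : Fin T) :
    Measurable fun θ => (𝓜.G θ *ᵥ x) t := by
  simp only [Matrix.mulVec, dotProduct]
  exact Finset.measurable_fun_sum _ fun m _ => (𝓜.G_meas t m).mul_const _

lemma measurable_mulVec_dG (i : Fin K) (x : Fin M → ℂ) (t : Fin T) :
    Measurable fun θ => (𝓜.dG θ i *ᵥ x) t := by
  simp only [Matrix.mulVec, dotProduct]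
  exact Finset.measurable_fun_sum _ fun m _ => (𝓜.measurable_dG i t m).mul_const _

lemma measurable_coord (n : Fin N) (t : Fin T) :
    Measurable fun q : (Fin K → ℝ) × (Fin N → Fin T → ℂ) => q.2 n t :=
  (measurable_pi_apply t).comp ((measurable_pi_apply n).comp measurable_snd)

lemma measurable_blockDensity (x : Fin N → Fin M → ℂ) :
    Measurable fun q : (Fin K → ℝ) × (Fin N → Fin T → ℂ) => 𝓜.blockDensity x q.1 q.2 := by
  simp only [blockDensity, cnDensity_eq_energy, energy]
  refine Finset.measurable_fun_prod _ fun n _ => Measurable.const_mul (Real.measurable_exp.comp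
    (Measurable.div_const (Measurable.neg (Finset.measurable_fun_sum _ fun t _ =>
      Measurable.pow_const (Measurable.norm ?_) _)) _)) _
  exact (measurable_coord n t).sub ((𝓜.measurable_mulVec_G (x n) t).comp measurable_fst)

lemma measurable_blockScore (x : Fin N → Fin M → ℂ) (i : Fin K) :
    Measurable fun q : (Fin K → ℝ) × (Fin N → Fin T → ℂ) => 𝓜.blockScore x q.1 q.2 i := by
  simp only [blockScore, reDot, reMul]
  refine Measurable.const_mul (Finset.measurable_fun_sum _ fun n _ =>
    Finset.measurable_fun_sum _ fun t _ => Complex.measurable_re.comp (Measurable.mul ?_ ?_)) _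
  · exact continuous_star.measurable.comp
      ((𝓜.measurable_mulVec_dG i (x n) t).comp measurable_fst)
  · exact (measurable_coord n t).sub ((𝓜.measurable_mulVec_G (x n) t).comp measurable_fst)

/-- Lebesgue density of the pair `(Θ, z^N)`. -/
noncomputable def jointDensity (x : Fin N → Fin M → ℂ)
    (q : (Fin K → ℝ) × (Fin N → Fin T → ℂ)) : ℝ := 𝓜.f q.1 * 𝓜.blockDensity x q.1 q.2

/-- Law of the pair `(Θ, z^N)`. -/
noncomputable def joint (x : Fin N → Fin M → ℂ) :
    Measure ((Fin K → ℝ) × (Fin N → Fin T → ℂ)) :=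
  ((volume : Measure (Fin K → ℝ)).prod volume).withDensity
    fun q => ENNReal.ofReal (𝓜.jointDensity x q)

lemma jointDensity_nonneg (x : Fin N → Fin M → ℂ) (q) : 0 ≤ 𝓜.jointDensity x q :=
  mul_nonneg (𝓜.f_nonneg _) (𝓜.blockDensity_pos x _ _).le

lemma measurable_jointDensity (x : Fin N → Fin M → ℂ) : Measurable (𝓜.jointDensity x) :=
  (𝓜.f_meas.comp measurable_fst).mul (𝓜.measurable_blockDensity x)

lemma lintegral_joint (x : Fin N → Fin M → ℂ)
    {F : (Fin K → ℝ) × (Fin N → Fin T → ℂ) → ℝ≥0∞} (hF : Measurable F) :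
    ∫⁻ q, F q ∂(𝓜.joint x) = ∫⁻ θ, ∫⁻ z, F (θ, z) ∂(𝓜.sensorLaw θ x) ∂𝓜.prior := by
  have hj := (𝓜.measurable_jointDensity x).ennreal_ofReal
  rw [joint, lintegral_withDensity_eq_lintegral_mul _ hj hF,
    lintegral_prod _ (hj.mul hF).aemeasurable]
  have hin : ∀ θ, ∫⁻ z, F (θ, z) ∂(𝓜.sensorLaw θ x)
      = ∫⁻ z, ENNReal.ofReal (𝓜.blockDensity x θ z) * F (θ, z) := fun θ => by
    rw [sensorLaw_eq]
    exact lintegral_withDensity_eq_lintegral_mul _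
      ((𝓜.measurable_blockDensity x).comp measurable_prodMk_left).ennreal_ofReal
      (hF.comp measurable_prodMk_left)
  simp_rw [hin]
  rw [prior, lintegral_withDensity_eq_lintegral_mul _ 𝓜.f_meas.ennreal_ofReal]
  · refine lintegral_congr fun θ => ?_
    simp only [Pi.mul_apply, jointDensity]
    rw [← lintegral_const_mul _ (by
      exact (((𝓜.measurable_blockDensity x).comp measurable_prodMk_left).ennreal_ofReal).mul
        (hF.comp measurable_prodMk_left))]
    refine lintegral_congr fun z => ?_
    rw [ENNReal.ofReal_mul (𝓜.f_nonneg θ), mul_assoc]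
  · exact Measurable.lintegral_prod_right'
      (f := fun q => ENNReal.ofReal (𝓜.blockDensity x q.1 q.2) * F q)
      ((𝓜.measurable_blockDensity x).ennreal_ofReal.mul hF)

lemma integral_joint_eq_volume (x : Fin N → Fin M → ℂ)
    (F : (Fin K → ℝ) × (Fin N → Fin T → ℂ) → ℝ) :
    ∫ q, F q ∂(𝓜.joint x) = ∫ q, 𝓜.jointDensity x q * F q ∂(volume.prod volume) := by
  rw [joint, integral_withDensity_eq_integral_toReal_smul
    (𝓜.measurable_jointDensity x).ennreal_ofReal (by simp)]
  simp [ENNReal.toReal_ofReal (𝓜.jointDensity_nonneg x _)]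

lemma integrable_joint_iff (x : Fin N → Fin M → ℂ)
    {F : (Fin K → ℝ) × (Fin N → Fin T → ℂ) → ℝ} :
    Integrable F (𝓜.joint x)
      ↔ Integrable (fun q => 𝓜.jointDensity x q * F q) (volume.prod volume) := by
  rw [joint, integrable_withDensity_iff_integrable_smul'
    (𝓜.measurable_jointDensity x).ennreal_ofReal (by simp)]
  simp [ENNReal.toReal_ofReal (𝓜.jointDensity_nonneg x _)]

lemma integral_joint (x : Fin N → Fin M → ℂ)
    {F : (Fin K → ℝ) × (Fin N → Fin T → ℂ) → ℝ} (hF : Integrable F (𝓜.joint x)) :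
    ∫ q, F q ∂(𝓜.joint x) = ∫ θ, ∫ z, F (θ, z) ∂(𝓜.sensorLaw θ x) ∂𝓜.prior := by
  rw [integral_joint_eq_volume, integral_prod _ ((𝓜.integrable_joint_iff x).1 hF), prior,
    integral_withDensity_eq_integral_toReal_smul 𝓜.f_meas.ennreal_ofReal (by simp)]
  refine integral_congr_ae (ae_of_all _ fun θ => ?_)
  simp only [jointDensity]
  rw [sensorLaw_eq, integral_withDensity_eq_integral_toReal_smul
    (by exact ((𝓜.measurable_blockDensity x).comp measurable_prodMk_left).ennreal_ofReal)
    (by simp), ENNReal.toReal_ofReal (𝓜.f_nonneg θ), smul_eq_mul, ← integral_const_mul]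
  refine integral_congr_ae (ae_of_all _ fun z => ?_)
  simp only [ENNReal.toReal_ofReal (𝓜.blockDensity_pos x _ _).le, smul_eq_mul]
  ring

lemma isProbabilityMeasure_joint (x : Fin N → Fin M → ℂ) :
    IsProbabilityMeasure (𝓜.joint x) := by
  have := 𝓜.isProbabilityMeasure_prior
  have := 𝓜.isProbabilityMeasure_sensorLaw x
  constructor
  have h := 𝓜.lintegral_joint x (F := fun _ => 1) measurable_const
  simpa using h

lemma ae_joint_pos (x : Fin N → Fin M → ℂ) : ∀ᵐ q ∂(𝓜.joint x), 0 < 𝓜.f q.1 := by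
  rw [joint, ae_withDensity_iff (𝓜.measurable_jointDensity x).ennreal_ofReal]
  refine ae_of_all _ fun q h => ?_
  simp only [ne_eq, ENNReal.ofReal_eq_zero, not_le, jointDensity] at h
  exact (pos_iff_pos_of_mul_pos h).2 (𝓜.blockDensity_pos x _ _)

lemma memLp_joint_of_lintegral (x : Fin N → Fin M → ℂ)
    {F : (Fin K → ℝ) × (Fin N → Fin T → ℂ) → ℝ} (hF : Measurable F)
    (h : ∫⁻ θ, ∫⁻ z, ENNReal.ofReal (F (θ, z) ^ 2) ∂(𝓜.sensorLaw θ x) ∂𝓜.prior ≠ ⊤) :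
    MemLp F 2 (𝓜.joint x) := by
  rw [memLp_two_iff_integrable_sq hF.aestronglyMeasurable]
  refine ⟨(hF.pow_const 2).aestronglyMeasurable, ?_⟩
  rw [hasFiniteIntegral_iff_ofReal (ae_of_all _ fun q => sq_nonneg _),
    𝓜.lintegral_joint x (hF.pow_const 2).ennreal_ofReal]
  exact lt_top_iff_ne_top.2 h

lemma memLp_blockScore (x : Fin N → Fin M → ℂ) (θ : Fin K → ℝ) (i : Fin K) :
    MemLp (fun z => 𝓜.blockScore x θ z i) 2 (𝓜.sensorLaw θ x) :=
  (memLp_sum_reDot 𝓜.συ_pos (fun n => 𝓜.dG θ i *ᵥ x n) fun n => 𝓜.G θ *ᵥ x n).const_mul _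

lemma integral_blockScore (x : Fin N → Fin M → ℂ) (θ : Fin K → ℝ) (i : Fin K) :
    ∫ z, 𝓜.blockScore x θ z i ∂(𝓜.sensorLaw θ x) = 0 := by
  simp only [blockScore]
  rw [integral_const_mul]
  simp only [sensorLaw]
  rw [integral_sum_reDot 𝓜.συ_pos, mul_zero]

lemma integral_blockScore_mul (hN : 0 < N) (x : Fin N → Fin M → ℂ) (θ : Fin K → ℝ)
    (i j : Fin K) :
    ∫ z, 𝓜.blockScore x θ z i * 𝓜.blockScore x θ z j ∂(𝓜.sensorLaw θ x)
      = N * 𝓜.condFIM θ (empCov x) i j := by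
  have hσ := 𝓜.συ_pos
  have hN' : (0 : ℝ) < N := by exact_mod_cast hN
  have e : ∀ z, 𝓜.blockScore x θ z i * 𝓜.blockScore x θ z j = (4 / 𝓜.συ ^ 4)
      * ((∑ n, reDot (𝓜.dG θ i *ᵥ x n) (z n - 𝓜.G θ *ᵥ x n))
        * ∑ n, reDot (𝓜.dG θ j *ᵥ x n) (z n - 𝓜.G θ *ᵥ x n)) := fun z => by
    simp only [blockScore]; ring
  simp_rw [e]
  rw [integral_const_mul]
  simp only [sensorLaw]
  rw [integral_sum_reDot_mul_sum_reDot hσ, empCov, condFIM_smul, condFIM_sum,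
    Matrix.smul_apply, Matrix.sum_apply]
  simp only [condFIM_vecMulVec, ← Finset.mul_sum, smul_eq_mul]
  field_simp
  ring

end Model

/-! ### Truncation of the prior density -/

lemma hasDerivAt_sq_posPart (t : ℝ) : HasDerivAt (fun t : ℝ => max t 0 ^ 2) (2 * max t 0) t := by
  rcases lt_trichotomy t 0 with h | h | h
  · have e : (fun t : ℝ => max t 0 ^ 2) =ᶠ[𝓝 t] fun _ => 0 := by
      filter_upwards [eventually_lt_nhds h] with s hs
      simp [max_eq_right hs.le]
    rw [max_eq_right h.le, mul_zero]
    exact (hasDerivAt_const t (0 : ℝ)).congr_of_eventuallyEq e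
  · subst h
    simp only [max_self, mul_zero]
    rw [hasDerivAt_iff_isLittleO_nhds_zero]
    have hb : (fun h : ℝ => max (0 + h) 0 ^ 2 - max 0 0 ^ 2 - h • (0 : ℝ))
        =O[𝓝 0] fun h : ℝ => h ^ 2 := by
      refine Asymptotics.IsBigO.of_bound 1 (Eventually.of_forall fun h => ?_)
      rcases le_total h 0 with h0 | h0
      · simp [max_eq_right h0, sq_nonneg]
      · simp [max_eq_left h0]
    exact hb.trans_isLittleO (by
      simpa using Asymptotics.isLittleO_pow_pow (𝕜 := ℝ) (m := 1) (n := 2) (by norm_num))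
  · have e : (fun t : ℝ => max t 0 ^ 2) =ᶠ[𝓝 t] fun t => t ^ 2 := by
      filter_upwards [eventually_gt_nhds h] with s hs
      simp [max_eq_left hs.le]
    rw [max_eq_left h.le]
    exact (by simpa using hasDerivAt_pow 2 t : HasDerivAt (fun t : ℝ => t ^ 2) (2 * t) t)
      |>.congr_of_eventuallyEq e

/-- The truncation `(t - ε)₊² / t`: it vanishes for `t ≤ ε`, is `C¹` on `(0, ∞)` and increases to
`t` as `ε` decreases to `0`. -/
noncomputable def trunc (ε t : ℝ) : ℝ := max (t - ε) 0 ^ 2 / t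

/-- The derivative of the truncation. -/
noncomputable def truncDeriv (ε t : ℝ) : ℝ :=
  (2 * max (t - ε) 0 * t - max (t - ε) 0 ^ 2) / t ^ 2

lemma trunc_of_le {ε t : ℝ} (h : t ≤ ε) : trunc ε t = 0 := by
  simp [trunc, max_eq_right (sub_nonpos.2 h)]

lemma hasDerivAt_trunc (ε : ℝ) {t : ℝ} (ht : 0 < t) :
    HasDerivAt (trunc ε) (truncDeriv ε t) t := by
  have h1 : HasDerivAt (fun t : ℝ => max (t - ε) 0 ^ 2) (2 * max (t - ε) 0) t := by
    simpa using (hasDerivAt_sq_posPart (t - ε)).comp_sub_const t ε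
  have h := h1.div (hasDerivAt_id t) ht.ne'
  unfold truncDeriv
  convert! h using 1
  simp

lemma trunc_div_mem {ε t : ℝ} (hε : 0 < ε) (ht : 0 ≤ t) :
    0 ≤ trunc ε t / t ∧ trunc ε t / t ≤ 1 := by
  rcases ht.eq_or_lt with rfl | ht
  · simp
  · have h0 := le_max_right (t - ε) 0
    have h1 : max (t - ε) 0 ≤ t := max_le (by linarith) ht.le
    refine ⟨by unfold trunc; positivity, ?_⟩
    rw [trunc, div_div, div_le_one (by positivity)]
    nlinarith

lemma truncDeriv_mem {ε t : ℝ} (hε : 0 < ε) (ht : 0 ≤ t) :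
    0 ≤ truncDeriv ε t ∧ truncDeriv ε t ≤ 1 := by
  rcases ht.eq_or_lt with rfl | ht
  · simp [truncDeriv]
  · have h0 := le_max_right (t - ε) 0
    have h1 : max (t - ε) 0 ≤ t := max_le (by linarith) ht.le
    unfold truncDeriv
    constructor
    · apply div_nonneg _ (by positivity)
      nlinarith
    · rw [div_le_one (by positivity)]
      nlinarith [sq_nonneg (t - max (t - ε) 0)]

lemma tendsto_trunc_div {t : ℝ} (ht : 0 < t) :
    Tendsto (fun n : ℕ => trunc (1 / ((n : ℝ) + 1)) t / t) atTop (𝓝 1) := by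
  have hc : Continuous fun ε : ℝ => trunc ε t / t := by unfold trunc; fun_prop
  have h := (hc.tendsto 0).comp (tendsto_one_div_add_atTop_nhds_zero_nat (𝕜 := ℝ))
  have e : trunc 0 t / t = 1 := by
    rw [trunc, sub_zero, max_eq_left ht.le]; field_simp
  rwa [e] at h

lemma tendsto_truncDeriv {t : ℝ} (ht : 0 < t) :
    Tendsto (fun n : ℕ => truncDeriv (1 / ((n : ℝ) + 1)) t) atTop (𝓝 1) := by
  have hc : Continuous fun ε : ℝ => truncDeriv ε t := by unfold truncDeriv; fun_prop
  have h := (hc.tendsto 0).comp (tendsto_one_div_add_atTop_nhds_zero_nat (𝕜 := ℝ))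
  have e : truncDeriv 0 t = 1 := by
    rw [truncDeriv, sub_zero, max_eq_left ht.le]; field_simp; ring
  rwa [e] at h

lemma measurable_trunc (ε : ℝ) : Measurable (trunc ε) := by
  unfold trunc; fun_prop

lemma measurable_truncDeriv (ε : ℝ) : Measurable (truncDeriv ε) := by
  unfold truncDeriv; fun_prop

namespace Model

variable {M L T K N : ℕ} {𝓜 : Model M L T K}

/-! ### The van Trees inequality -/

/-- The joint density with the prior density truncated has partial derivatives at every `θ`,
although the joint density itself need not have them on the boundary of `{f > 0}`. -/
lemma Regular.hasLineDerivAt_trunc (h : 𝓜.Regular) (x : Fin N → Fin M → ℂ)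
    (z : Fin N → Fin T → ℂ) {ε : ℝ} (hε : 0 < ε) (i : Fin K) (θ : Fin K → ℝ) :
    HasLineDerivAt ℝ (fun θ' => 𝓜.blockDensity x θ' z * trunc ε (𝓜.f θ'))
      (𝓜.jointDensity x (θ, z) * (trunc ε (𝓜.f θ) / 𝓜.f θ * 𝓜.blockScore x θ z i
        + truncDeriv ε (𝓜.f θ) * 𝓜.priorScore θ i)) θ (Pi.single i 1) := by
  rcases (𝓜.f_nonneg θ).eq_or_lt with h0 | hpos
  · have e : (fun θ' => 𝓜.blockDensity x θ' z * trunc ε (𝓜.f θ')) =ᶠ[𝓝 θ] fun _ => 0 := by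
      have : ∀ᶠ θ' in 𝓝 θ, 𝓜.f θ' < ε :=
        h.f_cont.continuousAt.eventually_lt continuousAt_const (by rw [← h0]; exact hε)
      filter_upwards [this] with θ' hθ'
      rw [trunc_of_le hθ'.le, mul_zero]
    simp only [jointDensity, ← h0, zero_mul]
    exact ((hasFDerivAt_const (0 : ℝ) θ).congr_of_eventuallyEq e).hasLineDerivAt _
  · have hd := h.f_diff θ hpos
    have hf : HasLineDerivAt ℝ 𝓜.f (𝓜.f θ * 𝓜.priorScore θ i) θ (Pi.single i 1) := by
      have e : 𝓜.f θ * 𝓜.priorScore θ i = fderiv ℝ 𝓜.f θ (Pi.single i 1) := by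
        rw [priorScore, fderiv.log hd hpos.ne', _root_.smul_apply, smul_eq_mul]
        field_simp
      rw [e]
      exact hd.hasFDerivAt.hasLineDerivAt _
    have h1 := 𝓜.hasLineDerivAt_blockDensity hpos x z i
    have h2 : HasLineDerivAt ℝ (fun θ' => trunc ε (𝓜.f θ'))
        (truncDeriv ε (𝓜.f θ) * (𝓜.f θ * 𝓜.priorScore θ i)) θ (Pi.single i 1) :=
      HasDerivAt.comp (h₂ := trunc ε) 0 (by simpa using hasDerivAt_trunc ε hpos) hf
    have h3 := HasDerivAt.fun_mul h1 h2
    unfold HasLineDerivAt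
    convert! h3 using 1
    simp only [jointDensity, zero_smul, add_zero]
    field_simp

/-- Integration by parts for the truncated prior. -/
lemma Regular.integral_error_mul_truncScore (h : 𝓜.Regular) (x : Fin N → Fin M → ℂ)
    {est : (Fin N → Fin T → ℂ) → (Fin K → ℝ)} {ε : ℝ} (hε : 0 < ε) (i j : Fin K)
    (h1 : Integrable (fun q => est q.2 i - q.1 i) (𝓜.joint x))
    (h2 : Integrable (fun q => (est q.2 i - q.1 i) * (trunc ε (𝓜.f q.1) / 𝓜.f q.1
      * 𝓜.blockScore x q.1 q.2 j + truncDeriv ε (𝓜.f q.1) * 𝓜.priorScore q.1 j)) (𝓜.joint x)) :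
    ∫ q, (est q.2 i - q.1 i) * (trunc ε (𝓜.f q.1) / 𝓜.f q.1
      * 𝓜.blockScore x q.1 q.2 j + truncDeriv ε (𝓜.f q.1) * 𝓜.priorScore q.1 j) ∂(𝓜.joint x)
      = (1 : Matrix (Fin K) (Fin K) ℝ) i j * ∫ q, trunc ε (𝓜.f q.1) / 𝓜.f q.1 ∂(𝓜.joint x) := by
  have := 𝓜.isProbabilityMeasure_joint x
  have hm : Measurable fun q : (Fin K → ℝ) × (Fin N → Fin T → ℂ) =>
      trunc ε (𝓜.f q.1) / 𝓜.f q.1 :=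
    ((measurable_trunc ε).comp (𝓜.f_meas.comp measurable_fst)).div
      (𝓜.f_meas.comp measurable_fst)
  have hb : ∀ q : (Fin K → ℝ) × (Fin N → Fin T → ℂ), ‖trunc ε (𝓜.f q.1) / 𝓜.f q.1‖ ≤ 1 :=
    fun q => by
      have := trunc_div_mem hε (𝓜.f_nonneg q.1)
      rw [Real.norm_of_nonneg this.1]; exact this.2
  have h0 : Integrable (fun q : (Fin K → ℝ) × (Fin N → Fin T → ℂ) =>
      trunc ε (𝓜.f q.1) / 𝓜.f q.1) (𝓜.joint x) :=
    Integrable.of_bound hm.aestronglyMeasurable 1 (ae_of_all _ hb)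
  have h3 : Integrable (fun q : (Fin K → ℝ) × (Fin N → Fin T → ℂ) =>
      trunc ε (𝓜.f q.1) / 𝓜.f q.1 * (est q.2 i - q.1 i)) (𝓜.joint x) :=
    h1.bdd_mul hm.aestronglyMeasurable (ae_of_all _ hb)
  rw [𝓜.integrable_joint_iff] at h0 h2 h3
  rw [integral_joint_eq_volume, integral_joint_eq_volume, integral_prod_symm _ h2,
    integral_prod_symm _ h0, ← integral_const_mul]
  refine integral_congr_ae ?_
  filter_upwards [h0.prod_left_ae, h2.prod_left_ae, h3.prod_left_ae] with z h0 h2 h3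
  have hu : ∀ θ, 𝓜.jointDensity x (θ, z) * (trunc ε (𝓜.f θ) / 𝓜.f θ)
      = 𝓜.blockDensity x θ z * trunc ε (𝓜.f θ) := by
    intro θ
    rcases (𝓜.f_nonneg θ).eq_or_lt with hz | hpos
    · simp [jointDensity, ← hz, trunc_of_le hε.le]
    · simp only [jointDensity]; field_simp
  have hd : ∀ θ : Fin K → ℝ, HasLineDerivAt ℝ (fun θ' : Fin K → ℝ => est z i - θ' i)
      (-(1 : Matrix (Fin K) (Fin K) ℝ) i j) θ (Pi.single j 1) := by
    intro θ
    have h1 := (((ContinuousLinearMap.proj (R := ℝ) (φ := fun _ : Fin K => ℝ)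
      i).hasFDerivAt (x := θ)).const_sub (est z i)).hasLineDerivAt (Pi.single j 1)
    convert! h1 using 1
    simp [Matrix.one_apply, Pi.single_apply]
  have key := integral_bilinear_hasLineDerivAt_right_eq_neg_left_of_integrable
    (μ := (volume : Measure (Fin K → ℝ))) (B := ContinuousLinearMap.mul ℝ ℝ)
    (f := fun θ' : Fin K → ℝ => est z i - θ' i)
    (f' := fun _ => -(1 : Matrix (Fin K) (Fin K) ℝ) i j)
    (g := fun θ' => 𝓜.blockDensity x θ' z * trunc ε (𝓜.f θ'))
    (g' := fun θ => 𝓜.jointDensity x (θ, z) * (trunc ε (𝓜.f θ) / 𝓜.f θ * 𝓜.blockScore x θ z j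
        + truncDeriv ε (𝓜.f θ) * 𝓜.priorScore θ j)) (v := Pi.single j 1)
    (by
      simp only [ContinuousLinearMap.mul_apply', ← hu]
      exact h0.const_mul _)
    (by
      simp only [ContinuousLinearMap.mul_apply']
      exact h2.congr (ae_of_all _ fun θ => by ring))
    (by
      simp only [ContinuousLinearMap.mul_apply', ← hu]
      exact h3.congr (ae_of_all _ fun θ => by ring))
    (fun θ _ => hd θ) (fun θ _ => h.hasLineDerivAt_trunc x z hε j θ)
  simp only [ContinuousLinearMap.mul_apply', ← hu] at key
  rw [integral_const_mul, neg_mul, neg_neg] at key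
  rw [← key]
  exact integral_congr_ae (ae_of_all _ fun θ => by ring)

lemma memLp_joint_blockScore (h : 𝓜.Regular) (hN : 0 < N) (x : Fin N → Fin M → ℂ) (i : Fin K) :
    MemLp (fun q => 𝓜.blockScore x q.1 q.2 i) 2 (𝓜.joint x) := by
  refine 𝓜.memLp_joint_of_lintegral x (𝓜.measurable_blockScore x i) ?_
  have e : ∀ θ, ∫⁻ z, ENNReal.ofReal (𝓜.blockScore x θ z i ^ 2) ∂(𝓜.sensorLaw θ x)
      = ENNReal.ofReal (N * 𝓜.condFIM θ (empCov x) i i) := fun θ => by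
    rw [← ofReal_integral_eq_lintegral_ofReal
      ((𝓜.memLp_blockScore x θ i).integrable_sq) (ae_of_all _ fun _ => sq_nonneg _)]
    simp_rw [pow_two]
    rw [𝓜.integral_blockScore_mul hN]
  simp_rw [e]
  exact ((h.integrable_condFIM (empCov x) i i).const_mul _).lintegral_lt_top.ne

lemma memLp_joint_priorScore (h : 𝓜.Regular) (x : Fin N → Fin M → ℂ) (i : Fin K) :
    MemLp (fun q : (Fin K → ℝ) × (Fin N → Fin T → ℂ) => 𝓜.priorScore q.1 i) 2 (𝓜.joint x) := by
  have := 𝓜.isProbabilityMeasure_sensorLaw x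
  refine 𝓜.memLp_joint_of_lintegral x ((𝓜.measurable_priorScore i).comp measurable_fst) ?_
  simp only [lintegral_const, measure_univ, mul_one]
  exact (h.prior_info i).lintegral_lt_top.ne

/-- The error of an estimator and the score of the joint density have the identity matrix as
their cross-covariance. -/
lemma Regular.integral_error_mul_score (h : 𝓜.Regular) (hN : 0 < N) (x : Fin N → Fin M → ℂ)
    {est : (Fin N → Fin T → ℂ) → (Fin K → ℝ)} (i j : Fin K)
    (he : MemLp (fun q => est q.2 i - q.1 i) 2 (𝓜.joint x)) :
    ∫ q, (est q.2 i - q.1 i) * (𝓜.blockScore x q.1 q.2 j + 𝓜.priorScore q.1 j) ∂(𝓜.joint x)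
      = (1 : Matrix (Fin K) (Fin K) ℝ) i j := by
  have := 𝓜.isProbabilityMeasure_joint x
  have hs := memLp_joint_blockScore h hN x j
  have hp := memLp_joint_priorScore h x j
  have hes : Integrable (fun q => (est q.2 i - q.1 i) * 𝓜.blockScore x q.1 q.2 j)
    (𝓜.joint x) := he.integrable_mul hs
  have hep : Integrable (fun q => (est q.2 i - q.1 i) * 𝓜.priorScore q.1 j)
    (𝓜.joint x) := he.integrable_mul hp
  have hfm : Measurable fun q : (Fin K → ℝ) × (Fin N → Fin T → ℂ) => 𝓜.f q.1 :=
    𝓜.f_meas.comp measurable_fst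
  have hm1 : ∀ ε, Measurable fun q : (Fin K → ℝ) × (Fin N → Fin T → ℂ) =>
      trunc ε (𝓜.f q.1) / 𝓜.f q.1 := fun ε => ((measurable_trunc ε).comp hfm).div hfm
  have hm2 : ∀ ε, Measurable fun q : (Fin K → ℝ) × (Fin N → Fin T → ℂ) =>
      truncDeriv ε (𝓜.f q.1) := fun ε => (measurable_truncDeriv ε).comp hfm
  have hmeas : ∀ ε, AEStronglyMeasurable (fun q => (est q.2 i - q.1 i)
      * (trunc ε (𝓜.f q.1) / 𝓜.f q.1 * 𝓜.blockScore x q.1 q.2 j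
        + truncDeriv ε (𝓜.f q.1) * 𝓜.priorScore q.1 j)) (𝓜.joint x) := fun ε =>
    he.aestronglyMeasurable.mul (((hm1 ε).aestronglyMeasurable.mul hs.aestronglyMeasurable).add
      ((hm2 ε).aestronglyMeasurable.mul hp.aestronglyMeasurable))
  have hbound : ∀ ε : ℝ, 0 < ε → ∀ q : (Fin K → ℝ) × (Fin N → Fin T → ℂ),
      ‖(est q.2 i - q.1 i) * (trunc ε (𝓜.f q.1) / 𝓜.f q.1 * 𝓜.blockScore x q.1 q.2 j
        + truncDeriv ε (𝓜.f q.1) * 𝓜.priorScore q.1 j)‖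
      ≤ ‖(est q.2 i - q.1 i) * 𝓜.blockScore x q.1 q.2 j‖
        + ‖(est q.2 i - q.1 i) * 𝓜.priorScore q.1 j‖ := by
    intro ε hε q
    have ha := trunc_div_mem hε (𝓜.f_nonneg q.1)
    have hb := truncDeriv_mem hε (𝓜.f_nonneg q.1)
    rw [mul_add]
    refine (norm_add_le _ _).trans (add_le_add ?_ ?_)
    · rw [mul_left_comm, norm_mul, Real.norm_of_nonneg ha.1]
      exact mul_le_of_le_one_left (norm_nonneg _) ha.2
    · rw [mul_left_comm, norm_mul, Real.norm_of_nonneg hb.1]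
      exact mul_le_of_le_one_left (norm_nonneg _) hb.2
  have hpos : ∀ n : ℕ, (0 : ℝ) < 1 / ((n : ℝ) + 1) := fun n => by positivity
  have lim1 : Tendsto (fun n : ℕ => ∫ q, (est q.2 i - q.1 i)
      * (trunc (1 / ((n : ℝ) + 1)) (𝓜.f q.1) / 𝓜.f q.1 * 𝓜.blockScore x q.1 q.2 j
        + truncDeriv (1 / ((n : ℝ) + 1)) (𝓜.f q.1) * 𝓜.priorScore q.1 j) ∂(𝓜.joint x)) atTop
      (𝓝 (∫ q, (est q.2 i - q.1 i) * (𝓜.blockScore x q.1 q.2 j + 𝓜.priorScore q.1 j)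
        ∂(𝓜.joint x))) := by
    refine tendsto_integral_of_dominated_convergence _ (fun n => hmeas _)
      (hes.norm.add hep.norm) (fun n => ae_of_all _ (hbound _ (hpos n))) ?_
    filter_upwards [𝓜.ae_joint_pos x] with q hq
    have := (((tendsto_trunc_div hq).mul_const (𝓜.blockScore x q.1 q.2 j)).add
      ((tendsto_truncDeriv hq).mul_const (𝓜.priorScore q.1 j))).const_mul (est q.2 i - q.1 i)
    simpa using this
  have lim2 : Tendsto (fun n : ℕ => ∫ q, trunc (1 / ((n : ℝ) + 1)) (𝓜.f q.1) / 𝓜.f q.1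
      ∂(𝓜.joint x)) atTop (𝓝 (∫ _, (1 : ℝ) ∂(𝓜.joint x))) := by
    refine tendsto_integral_of_dominated_convergence (fun _ => 1)
      (fun n => (hm1 _).aestronglyMeasurable) (integrable_const _)
      (fun n => ae_of_all _ fun q => ?_) ?_
    · have ha := trunc_div_mem (hpos n) (𝓜.f_nonneg q.1)
      rw [Real.norm_of_nonneg ha.1]; exact ha.2
    · filter_upwards [𝓜.ae_joint_pos x] with q hq using tendsto_trunc_div hq
  have heq : ∀ n : ℕ, ∫ q, (est q.2 i - q.1 i)
      * (trunc (1 / ((n : ℝ) + 1)) (𝓜.f q.1) / 𝓜.f q.1 * 𝓜.blockScore x q.1 q.2 j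
        + truncDeriv (1 / ((n : ℝ) + 1)) (𝓜.f q.1) * 𝓜.priorScore q.1 j) ∂(𝓜.joint x)
      = (1 : Matrix (Fin K) (Fin K) ℝ) i j
        * ∫ q, trunc (1 / ((n : ℝ) + 1)) (𝓜.f q.1) / 𝓜.f q.1 ∂(𝓜.joint x) := fun n =>
    h.integral_error_mul_truncScore x (hpos n) i j (he.integrable (by norm_num))
      ((hes.norm.add hep.norm).mono' (hmeas _) (ae_of_all _ (hbound _ (hpos n))))
  simp_rw [heq] at lim1
  have := tendsto_nhds_unique lim1 (lim2.const_mul _)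
  simpa using this

/-- The second moments of the score of the joint density. -/
lemma Regular.integral_score_mul_score (h : 𝓜.Regular) (hN : 0 < N) (x : Fin N → Fin M → ℂ)
    (i j : Fin K) :
    ∫ q, (𝓜.blockScore x q.1 q.2 i + 𝓜.priorScore q.1 i)
        * (𝓜.blockScore x q.1 q.2 j + 𝓜.priorScore q.1 j) ∂(𝓜.joint x)
      = N * (𝓜.expFIM (empCov x) + (1 / N : ℝ) • 𝓜.priorInfo) i j := by
  have hN' : (0 : ℝ) < N := by exact_mod_cast hN
  have := 𝓜.isProbabilityMeasure_sensorLaw x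
  have hS : ∀ i, MemLp (fun q : (Fin K → ℝ) × (Fin N → Fin T → ℂ) =>
      𝓜.blockScore x q.1 q.2 i + 𝓜.priorScore q.1 i) 2 (𝓜.joint x) := fun i =>
    (memLp_joint_blockScore h hN x i).add (memLp_joint_priorScore h x i)
  have hSS : Integrable (fun q : (Fin K → ℝ) × (Fin N → Fin T → ℂ) =>
      (𝓜.blockScore x q.1 q.2 i + 𝓜.priorScore q.1 i)
        * (𝓜.blockScore x q.1 q.2 j + 𝓜.priorScore q.1 j)) (𝓜.joint x) :=
    (hS i).integrable_mul (hS j)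
  rw [𝓜.integral_joint x hSS]
  have e : ∀ θ, ∫ z, (𝓜.blockScore x θ z i + 𝓜.priorScore θ i)
      * (𝓜.blockScore x θ z j + 𝓜.priorScore θ j) ∂(𝓜.sensorLaw θ x)
      = N * 𝓜.condFIM θ (empCov x) i j + 𝓜.priorScore θ i * 𝓜.priorScore θ j := fun θ => by
    have hi := 𝓜.memLp_blockScore x θ i
    have hj := 𝓜.memLp_blockScore x θ j
    have hij : Integrable (fun z => 𝓜.blockScore x θ z i * 𝓜.blockScore x θ z j)
      (𝓜.sensorLaw θ x) := hi.integrable_mul hj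
    have e1 : ∀ z, (𝓜.blockScore x θ z i + 𝓜.priorScore θ i)
        * (𝓜.blockScore x θ z j + 𝓜.priorScore θ j)
        = 𝓜.blockScore x θ z i * 𝓜.blockScore x θ z j
          + (𝓜.priorScore θ j * 𝓜.blockScore x θ z i
            + (𝓜.priorScore θ i * 𝓜.blockScore x θ z j
              + 𝓜.priorScore θ i * 𝓜.priorScore θ j)) := fun z => by ring
    simp_rw [e1]
    have c1 := (hi.integrable (by norm_num)).const_mul (𝓜.priorScore θ j)
    have c2 := (hj.integrable (by norm_num)).const_mul (𝓜.priorScore θ i)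
    rw [integral_add hij (by exact c1.add (c2.add (integrable_const _))),
      integral_add c1 (by exact c2.add (integrable_const _)), integral_add c2 (integrable_const _),
      integral_const_mul, integral_const_mul, 𝓜.integral_blockScore, 𝓜.integral_blockScore,
      𝓜.integral_blockScore_mul hN]
    simp
  simp_rw [e]
  rw [integral_add ((h.integrable_condFIM _ i j).const_mul _)
    (by exact (h.memLp_priorScore i).integrable_mul (h.memLp_priorScore j)), integral_const_mul]
  simp only [Matrix.add_apply, Matrix.smul_apply, smul_eq_mul, expFIM, priorInfo,
    Matrix.of_apply]
  field_simp

/-- The van Trees inequality, paired with an arbitrary matrix `B`: it expresses that the squared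
norm of `N (est - Θ) - B s`, `s` the score of the joint density, is nonnegative. -/
lemma Regular.two_mul_trace_sub_le_mse (h : 𝓜.Regular) (hN : 0 < N) (x : Fin N → Fin M → ℂ)
    {est : (Fin N → Fin T → ℂ) → (Fin K → ℝ)} (hest : Measurable est)
    (hfin : 𝓜.mse x est ≠ ⊤) (B : Matrix (Fin K) (Fin K) ℝ) :
    2 * B.trace - (B * (𝓜.expFIM (empCov x) + (1 / N : ℝ) • 𝓜.priorInfo) * Bᵀ).trace
      ≤ N * (𝓜.mse x est).toReal := by
  have hN' : (0 : ℝ) < N := by exact_mod_cast hN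
  set A := 𝓜.expFIM (empCov x) + (1 / N : ℝ) • 𝓜.priorInfo with hA
  have hmE : ∀ i, Measurable fun q : (Fin K → ℝ) × (Fin N → Fin T → ℂ) =>
      est q.2 i - q.1 i := fun i =>
    ((measurable_pi_apply i).comp (hest.comp measurable_snd)).sub
      ((measurable_pi_apply i).comp measurable_fst)
  have hsq : ∀ (i) (θ : Fin K → ℝ) z, (θ i - est z i) ^ 2 = (est z i - θ i) ^ 2 :=
    fun i θ z => by ring
  have hmse : 𝓜.mse x est = ∑ i, ∫⁻ q, ENNReal.ofReal ((est q.2 i - q.1 i) ^ 2)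
      ∂(𝓜.joint x) := by
    simp only [mse, hsq]
    refine Finset.sum_congr rfl fun i _ => ?_
    rw [𝓜.lintegral_joint x ((hmE i).pow_const 2).ennreal_ofReal]
  have hE : ∀ i, MemLp (fun q : (Fin K → ℝ) × (Fin N → Fin T → ℂ) => est q.2 i - q.1 i) 2
      (𝓜.joint x) := fun i => by
    refine 𝓜.memLp_joint_of_lintegral x (hmE i) ?_
    rw [← 𝓜.lintegral_joint x ((hmE i).pow_const 2).ennreal_ofReal]
    rw [hmse] at hfin
    exact (ENNReal.sum_ne_top.1 hfin i (Finset.mem_univ i))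
  have hS : ∀ i, MemLp (fun q : (Fin K → ℝ) × (Fin N → Fin T → ℂ) =>
      𝓜.blockScore x q.1 q.2 i + 𝓜.priorScore q.1 i) 2 (𝓜.joint x) := fun i =>
    (memLp_joint_blockScore h hN x i).add (memLp_joint_priorScore h x i)
  have hreal : (𝓜.mse x est).toReal = ∑ i, ∫ q, (est q.2 i - q.1 i) ^ 2 ∂(𝓜.joint x) := by
    rw [hmse, ENNReal.toReal_sum (by rw [hmse] at hfin; exact ENNReal.sum_ne_top.1 hfin)]
    refine Finset.sum_congr rfl fun i _ => ?_
    rw [← ofReal_integral_eq_lintegral_ofReal (hE i).integrable_sq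
      (ae_of_all _ fun _ => sq_nonneg _), ENNReal.toReal_ofReal
      (integral_nonneg fun _ => sq_nonneg _)]
  have hi : ∀ i, N * (2 * B i i) - N * ∑ j, ∑ k, B i k * B i j * A k j
      ≤ N ^ 2 * ∫ q, (est q.2 i - q.1 i) ^ 2 ∂(𝓜.joint x) := by
    intro i
    have h0 : 0 ≤ ∫ q, (N * (est q.2 i - q.1 i)
        - ∑ j, B i j * (𝓜.blockScore x q.1 q.2 j + 𝓜.priorScore q.1 j)) ^ 2 ∂(𝓜.joint x) :=
      integral_nonneg fun _ => sq_nonneg _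
    have iES : ∀ j, Integrable (fun q => (2 * N * B i j) * ((est q.2 i - q.1 i)
        * (𝓜.blockScore x q.1 q.2 j + 𝓜.priorScore q.1 j))) (𝓜.joint x) := fun j =>
      ((hE i).integrable_mul (hS j)).const_mul _
    have iSS : ∀ j k, Integrable (fun q => (B i k * B i j)
        * ((𝓜.blockScore x q.1 q.2 k + 𝓜.priorScore q.1 k)
          * (𝓜.blockScore x q.1 q.2 j + 𝓜.priorScore q.1 j))) (𝓜.joint x) := fun j k =>
      ((hS k).integrable_mul (hS j)).const_mul _
    have iEE : Integrable (fun q => (N : ℝ) ^ 2 * (est q.2 i - q.1 i) ^ 2) (𝓜.joint x) :=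
      (hE i).integrable_sq.const_mul _
    have e : ∀ q : (Fin K → ℝ) × (Fin N → Fin T → ℂ), (N * (est q.2 i - q.1 i)
        - ∑ j, B i j * (𝓜.blockScore x q.1 q.2 j + 𝓜.priorScore q.1 j)) ^ 2
        = (N : ℝ) ^ 2 * (est q.2 i - q.1 i) ^ 2
          - ∑ j, (2 * N * B i j) * ((est q.2 i - q.1 i)
            * (𝓜.blockScore x q.1 q.2 j + 𝓜.priorScore q.1 j))
          + ∑ j, ∑ k, (B i k * B i j) * ((𝓜.blockScore x q.1 q.2 k + 𝓜.priorScore q.1 k)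
            * (𝓜.blockScore x q.1 q.2 j + 𝓜.priorScore q.1 j)) := by
      intro q
      rw [sub_sq, mul_pow]
      congr 1
      · congr 1
        rw [Finset.mul_sum]
        exact Finset.sum_congr rfl fun j _ => by ring
      · rw [pow_two, Finset.sum_mul_sum, Finset.sum_comm]
        exact Finset.sum_congr rfl fun j _ => Finset.sum_congr rfl fun k _ => by ring
    simp_rw [e] at h0
    rw [integral_add (by exact iEE.sub (integrable_finsetSum _ fun j _ => iES j))
      (integrable_finsetSum _ fun j _ => integrable_finsetSum _ fun k _ => iSS j k),
      integral_sub iEE (integrable_finsetSum _ fun j _ => iES j),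
      integral_finsetSum _ fun j _ => iES j,
      integral_finsetSum _ fun j _ => integrable_finsetSum _ fun k _ => iSS j k] at h0
    have e2 : ∀ j, ∫ q, ∑ k, (B i k * B i j) * ((𝓜.blockScore x q.1 q.2 k + 𝓜.priorScore q.1 k)
        * (𝓜.blockScore x q.1 q.2 j + 𝓜.priorScore q.1 j)) ∂(𝓜.joint x)
        = N * ∑ k, B i k * B i j * A k j := fun j => by
      rw [integral_finsetSum _ fun k _ => iSS j k, Finset.mul_sum]
      refine Finset.sum_congr rfl fun k _ => ?_
      rw [integral_const_mul, h.integral_score_mul_score hN]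
      ring
    simp_rw [e2, integral_const_mul, h.integral_error_mul_score hN x i _ (hE i)] at h0
    simp only [Matrix.one_apply, mul_ite, mul_one, mul_zero, Finset.sum_ite_eq,
      Finset.mem_univ, if_true, ← Finset.mul_sum] at h0
    linarith
  have hsum := Finset.sum_le_sum fun i (_ : i ∈ Finset.univ) => hi i
  rw [Finset.sum_sub_distrib, ← Finset.mul_sum, ← Finset.mul_sum, ← Finset.mul_sum,
    ← Finset.mul_sum, ← hreal, ← trace_mul_mul_transpose] at hsum
  have : (N : ℝ) * (2 * B.trace - (B * A * Bᵀ).trace) ≤ N * (N * (𝓜.mse x est).toReal) := by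
    simp only [Matrix.trace, Matrix.diag] at hsum ⊢
    linarith
  exact le_of_mul_le_mul_left this hN'

/-- The Bayesian information matrix of a block is positive semidefinite. -/
lemma Regular.posSemidef_add_priorInfo (h : 𝓜.Regular) {Q : Matrix (Fin M) (Fin M) ℂ}
    (hQ : Q.PosSemidef) (N : ℕ) : (𝓜.expFIM Q + (1 / N : ℝ) • 𝓜.priorInfo).PosSemidef :=
  (h.expFIM_posSemidef hQ).add (h.priorInfo_posSemidef.smul (by positivity))

lemma Regular.vanTrees (h : 𝓜.Regular) (hN : 0 < N) (x : Fin N → Fin M → ℂ)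
    {est : (Fin N → Fin T → ℂ) → (Fin K → ℝ)} (hest : Measurable est) :
    invTrace (𝓜.expFIM (empCov x) + (1 / N : ℝ) • 𝓜.priorInfo) ≤ N * 𝓜.mse x est := by
  by_cases hfin : 𝓜.mse x est = ⊤
  · rw [hfin, ENNReal.mul_top (by exact_mod_cast hN.ne')]
    exact le_top
  · refine (invTrace_le_ofReal (h.posSemidef_add_priorInfo (empCov_posSemidef x) N)
      (h.two_mul_trace_sub_le_mse hN x hest hfin)).trans (le_of_eq ?_)
    rw [ENNReal.ofReal_mul (by positivity), ENNReal.ofReal_natCast, ENNReal.ofReal_toReal hfin]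

end Model

/-! ### Change of measure and Gaussian reference laws -/

/-- Variational bound on the relative entropy, tested on `c` times the indicator of `D`: it follows
from `t + 1 ≤ exp t` at `t = c 1_D - log (p / q)`. -/
lemma mul_measureReal_le_integral_log {E : Type*} [MeasureSpace E] {p q : E → ℝ}
    (hp : ∀ y, 0 < p y) (hq : ∀ y, 0 < q y) (hpm : Measurable p) (hqm : Measurable q)
    {P Q : Measure E} [IsProbabilityMeasure P] [IsProbabilityMeasure Q]
    (hP : P = volume.withDensity fun y => ENNReal.ofReal (p y))
    (hQ : Q = volume.withDensity fun y => ENNReal.ofReal (q y)) {D : Set E}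
    (hD : MeasurableSet D) (c : ℝ) (hlog : Integrable (fun y => Real.log (p y / q y)) P) :
    c * P.real D ≤ ∫ y, Real.log (p y / q y) ∂P + (Real.exp c - 1) * Q.real D := by
  set φ : E → ℝ := D.indicator fun _ => c with hφ
  have hφi : Integrable φ P := (integrable_const c).indicator hD
  have hexp : ∀ y, Real.exp (φ y) = 1 + D.indicator (fun _ => Real.exp c - 1) y := by
    intro y
    by_cases h : y ∈ D <;> simp [hφ, h]
  have hQi : Integrable (fun y => D.indicator (fun _ => Real.exp c - 1) y) Q :=
    (integrable_const _).indicator hD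
  have hexpQ : Integrable (fun y => Real.exp (φ y)) Q := by
    simp_rw [hexp]; exact (integrable_const _).add hQi
  have hexpInt : ∫ y, Real.exp (φ y) ∂Q = 1 + (Real.exp c - 1) * Q.real D := by
    simp_rw [hexp]
    rw [integral_add (integrable_const _) hQi, integral_indicator_const _ hD]
    simp [mul_comm]
  have hw : ∀ y, p y * (Real.exp (φ y) * (q y / p y)) = q y * Real.exp (φ y) := fun y => by
    have := (hp y).ne'
    field_simp
  have hR : Integrable (fun y => Real.exp (φ y) * (q y / p y)) P := by
    rw [hP, integrable_withDensity_iff_integrable_smul' hpm.ennreal_ofReal (by simp)]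
    rw [hQ, integrable_withDensity_iff_integrable_smul' hqm.ennreal_ofReal (by simp)] at hexpQ
    simpa only [ENNReal.toReal_ofReal (hp _).le, ENNReal.toReal_ofReal (hq _).le, smul_eq_mul, hw]
      using hexpQ
  have hRint : ∫ y, Real.exp (φ y) * (q y / p y) ∂P = ∫ y, Real.exp (φ y) ∂Q := by
    rw [hP, hQ, integral_withDensity_eq_integral_toReal_smul hpm.ennreal_ofReal (by simp),
      integral_withDensity_eq_integral_toReal_smul hqm.ennreal_ofReal (by simp)]
    simp only [ENNReal.toReal_ofReal (hp _).le, ENNReal.toReal_ofReal (hq _).le, smul_eq_mul, hw]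
  have hpt : ∀ y, φ y - Real.log (p y / q y) + 1 ≤ Real.exp (φ y) * (q y / p y) := fun y => by
    refine (Real.add_one_le_exp _).trans (le_of_eq ?_)
    rw [Real.exp_sub, Real.exp_log (div_pos (hp y) (hq y)), div_eq_mul_inv, inv_div]
  have hsub : Integrable (fun y => φ y - Real.log (p y / q y)) P := hφi.sub hlog
  have := integral_mono (f := fun y => φ y - Real.log (p y / q y) + 1)
    (hsub.add (integrable_const 1)) hR hpt
  rw [integral_add hsub (integrable_const _), hRint, hexpInt] at this
  rw [integral_sub hφi hlog, hφ, integral_indicator_const _ hD] at this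
  simp only [integral_const, probReal_univ, smul_eq_mul, one_mul] at this
  linarith

/-- Second moment of an affine function of a complex Gaussian vector. -/
lemma integral_sq_norm_affine {d : ℕ} {s : ℝ} (hs : 0 < s) (v : ℂ) (a m : Fin d → ℂ) :
    Integrable (fun z => ‖v + a ⬝ᵥ (z - m)‖ ^ 2) (cnLaw s m) ∧
    ∫ z, ‖v + a ⬝ᵥ (z - m)‖ ^ 2 ∂(cnLaw s m) = ‖v‖ ^ 2 + s ^ 2 * ∑ t, ‖a t‖ ^ 2 := by
  have := isProbabilityMeasure_cnLaw hs m
  have hn : ∀ z : ℂ, ‖z‖ ^ 2 = z.re ^ 2 + z.im ^ 2 := fun z => by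
    rw [Complex.sq_norm, Complex.normSq_apply]; ring
  have hre : ∀ z, (a ⬝ᵥ z).re = reDot (star a) z := fun z => by
    simp [dotProduct, reDot, reMul]
  have him : ∀ z, (a ⬝ᵥ z).im = reDot (Complex.I • star a) z := fun z => by
    simp only [dotProduct, reDot, reMul_eq, Complex.im_sum]
    refine Finset.sum_congr rfl fun t _ => ?_
    simp
    ring
  have key : ∀ (α : ℝ) (b : Fin d → ℂ),
      Integrable (fun z => (α + reDot b (z - m)) ^ 2) (cnLaw s m) ∧
      ∫ z, (α + reDot b (z - m)) ^ 2 ∂(cnLaw s m) = α ^ 2 + s ^ 2 / 2 * (star b ⬝ᵥ b).re := by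
    intro α b
    have hL := memLp_reDot_cnLaw hs b m
    have e : ∀ z, (α + reDot b (z - m)) ^ 2 = α ^ 2 + (2 * α * reDot b (z - m)
        + reDot b (z - m) * reDot b (z - m)) := fun z => by ring
    have i1 := (hL.integrable (by norm_num)).const_mul (2 * α)
    have i2 : Integrable (fun z => reDot b (z - m) * reDot b (z - m)) (cnLaw s m) :=
      hL.integrable_mul hL
    simp_rw [e]
    refine ⟨(integrable_const _).add (i1.add i2), ?_⟩
    rw [integral_add (integrable_const _) (by exact i1.add i2), integral_add i1 i2,
      integral_const_mul, integral_reDot_cnLaw hs, integral_reDot_mul_reDot_cnLaw hs]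
    simp
  have e : ∀ z, ‖v + a ⬝ᵥ (z - m)‖ ^ 2 = (v.re + reDot (star a) (z - m)) ^ 2
      + (v.im + reDot (Complex.I • star a) (z - m)) ^ 2 := fun z => by
    rw [hn, Complex.add_re, Complex.add_im, hre, him]
  simp_rw [e]
  have h1 := key v.re (star a)
  have h2 := key v.im (Complex.I • star a)
  refine ⟨h1.1.add h2.1, ?_⟩
  rw [integral_add h1.1 h2.1, h1.2, h2.2, hn]
  have e1 : (star (star a) ⬝ᵥ star a).re = ∑ t, ‖a t‖ ^ 2 := by
    simp only [dotProduct, Complex.re_sum]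
    exact Finset.sum_congr rfl fun t _ => by rw [hn]; simp; ring
  have e2 : (star (Complex.I • star a) ⬝ᵥ (Complex.I • star a)).re = ∑ t, ‖a t‖ ^ 2 := by
    simp only [dotProduct, Complex.re_sum]
    exact Finset.sum_congr rfl fun t _ => by rw [hn]; simp; ring
  rw [e1, e2]
  ring

/-- Density of the image of `CN(0, s² I)` under the inverse of an invertible matrix `C`, that is of
the centred complex Gaussian law with covariance `s² (Cᴴ C)⁻¹`. -/
noncomputable def refDensity {d : ℕ} (s : ℝ) (C : Matrix (Fin d) (Fin d) ℂ) (y : Fin d → ℂ) : ℝ :=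
  ‖C.det‖ ^ 2 * cnDensity s 0 (C *ᵥ y)

lemma refDensity_pos {d : ℕ} {s : ℝ} (hs : 0 < s) {C : Matrix (Fin d) (Fin d) ℂ}
    (hC : C.det ≠ 0) (y : Fin d → ℂ) : 0 < refDensity s C y :=
  mul_pos (by positivity) (cnDensity_pos hs _ _)

lemma continuous_cnDensity {d : ℕ} (s : ℝ) (m : Fin d → ℂ) : Continuous (cnDensity s m) := by
  unfold cnDensity; fun_prop

lemma continuous_refDensity {d : ℕ} (s : ℝ) (C : Matrix (Fin d) (Fin d) ℂ) :
    Continuous (refDensity s C) := by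
  unfold refDensity
  exact continuous_const.mul ((continuous_cnDensity s 0).comp (by fun_prop))

lemma integral_cnDensity {d : ℕ} {s : ℝ} (hs : 0 < s) (m : Fin d → ℂ) :
    ∫ y, cnDensity s m y = 1 := by
  simp_rw [cnDensity_eq_prod]
  rw [integral_fintype_prod_volume_eq_prod]
  simp [integral_cnDensityOne hs]

lemma integral_refDensity {d : ℕ} {s : ℝ} (hs : 0 < s) {C : Matrix (Fin d) (Fin d) ℂ}
    (hC : C.det ≠ 0) : ∫ y, refDensity s C y = 1 := by
  -- A complex linear map with determinant `δ` has determinant `|δ|²` over the reals.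
  set F : (Fin d → ℂ) →ₗ[ℝ] (Fin d → ℂ) := (Matrix.toLin' C).restrictScalars ℝ with hF
  have hdet : LinearMap.det F = ‖C.det‖ ^ 2 := by
    rw [hF, LinearMap.det_restrictScalars, LinearMap.det_toLin', Algebra.norm_complex_apply,
      Complex.normSq_eq_norm_sq]
  have hne : LinearMap.det F ≠ 0 := by rw [hdet]; positivity
  have hmap := Measure.map_linearMap_addHaar_eq_smul_addHaar
    (volume : Measure (Fin d → ℂ)) hne
  have hFm : Measurable F := (LinearMap.continuous_of_finiteDimensional F).measurable
  have h : ∫ y, cnDensity s 0 (F y) = (‖C.det‖ ^ 2)⁻¹ := by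
    rw [← integral_map hFm.aemeasurable
      (continuous_cnDensity s 0).measurable.aestronglyMeasurable, hmap, integral_smul_measure,
      integral_cnDensity hs, hdet, abs_of_nonneg (by positivity),
      ENNReal.toReal_ofReal (by positivity)]
    simp
  have e : ∀ y, refDensity s C y = ‖C.det‖ ^ 2 * cnDensity s 0 (F y) := fun y => rfl
  simp_rw [e]
  rw [integral_const_mul, h]
  have : ‖C.det‖ ≠ 0 := by simpa using hC
  field_simp

/-- The relative entropy of `CN(m, s² I)` with respect to the centred Gaussian law with covariance
`s² (Cᴴ C)⁻¹`. -/
lemma integral_log_cnDensity_div_refDensity {d : ℕ} {s : ℝ} (hs : 0 < s)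
    {C : Matrix (Fin d) (Fin d) ℂ} (hC : C.det ≠ 0) (m : Fin d → ℂ) :
    Integrable (fun y => Real.log (cnDensity s m y / refDensity s C y)) (cnLaw s m) ∧
    ∫ y, Real.log (cnDensity s m y / refDensity s C y) ∂(cnLaw s m)
      = -Real.log (‖C.det‖ ^ 2) - d + (∑ r, ‖(C *ᵥ m) r‖ ^ 2) / s ^ 2
        + ∑ r, ∑ t, ‖C r t‖ ^ 2 := by
  have := isProbabilityMeasure_cnLaw hs m
  have hCn : 0 < ‖C.det‖ := norm_pos_iff.2 hC
  have hpi := Real.pi_pos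
  have e : ∀ y, Real.log (cnDensity s m y / refDensity s C y) = -Real.log (‖C.det‖ ^ 2)
      + ((1 / s ^ 2) * (∑ r, ‖(C *ᵥ m) r + C r ⬝ᵥ (y - m)‖ ^ 2)
        - (1 / s ^ 2) * ∑ r, ‖0 + (1 : Matrix (Fin d) (Fin d) ℂ) r ⬝ᵥ (y - m)‖ ^ 2) := by
    intro y
    have e1 : ∀ r, (C *ᵥ m) r + C r ⬝ᵥ (y - m) = (C *ᵥ y) r := fun r => by
      rw [dotProduct_sub]; simp [Matrix.mulVec]
    have e2 : ∀ r, (1 : Matrix (Fin d) (Fin d) ℂ) r ⬝ᵥ (y - m) = y r - m r := fun r => by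
      simpa [Matrix.mulVec] using congrFun (Matrix.one_mulVec (y - m)) r
    simp only [e1, e2, zero_add]
    rw [refDensity, Real.log_div (cnDensity_pos hs _ _).ne'
      (mul_pos (by positivity) (cnDensity_pos hs _ _)).ne', Real.log_mul (by positivity)
      (cnDensity_pos hs _ _).ne', cnDensity, cnDensity, Real.log_mul (by positivity)
      (by positivity), Real.log_mul (by positivity) (by positivity), Real.log_exp, Real.log_exp]
    simp only [Pi.zero_apply, sub_zero]
    ring
  have i1 : Integrable (fun y => (1 / s ^ 2) * ∑ r, ‖(C *ᵥ m) r + C r ⬝ᵥ (y - m)‖ ^ 2)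
      (cnLaw s m) :=
    (integrable_finsetSum _ fun r _ => (integral_sq_norm_affine hs _ (C r) m).1).const_mul _
  have i2 : Integrable (fun y => (1 / s ^ 2)
      * ∑ r, ‖0 + (1 : Matrix (Fin d) (Fin d) ℂ) r ⬝ᵥ (y - m)‖ ^ 2) (cnLaw s m) :=
    (integrable_finsetSum _ fun r _ => (integral_sq_norm_affine hs _ _ m).1).const_mul _
  simp_rw [e]
  refine ⟨(integrable_const _).add (i1.sub i2), ?_⟩
  rw [integral_add (integrable_const _) (by exact i1.sub i2), integral_sub i1 i2,
    integral_const_mul, integral_const_mul]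
  have s1 : ∫ y, ∑ r, ‖(C *ᵥ m) r + C r ⬝ᵥ (y - m)‖ ^ 2 ∂(cnLaw s m)
      = ∑ r, (‖(C *ᵥ m) r‖ ^ 2 + s ^ 2 * ∑ t, ‖C r t‖ ^ 2) :=
    (integral_finsetSum _ fun r _ => (integral_sq_norm_affine hs _ (C r) m).1).trans
      (Finset.sum_congr rfl fun r _ => (integral_sq_norm_affine hs _ (C r) m).2)
  have s2 : ∫ y, ∑ r, ‖0 + (1 : Matrix (Fin d) (Fin d) ℂ) r ⬝ᵥ (y - m)‖ ^ 2 ∂(cnLaw s m)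
      = ∑ r, (‖(0 : ℂ)‖ ^ 2 + s ^ 2 * ∑ t, ‖(1 : Matrix (Fin d) (Fin d) ℂ) r t‖ ^ 2) :=
    (integral_finsetSum _ fun r _ => (integral_sq_norm_affine hs _ _ m).1).trans
      (Finset.sum_congr rfl fun r _ => (integral_sq_norm_affine hs _ _ m).2)
  rw [s1, s2]
  have e3 : ∀ r, ∑ t, ‖(1 : Matrix (Fin d) (Fin d) ℂ) r t‖ ^ 2 = 1 := fun r => by
    rw [Finset.sum_eq_single r]
    · simp
    · intro t _ ht; simp [Matrix.one_apply_ne ht.symm]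
    · simp
  simp only [e3, Finset.sum_add_distrib, ← Finset.mul_sum]
  simp
  field_simp
  ring

open scoped MatrixOrder in
/-- A positive definite matrix has the form `(Cᴴ C)⁻¹`. -/
lemma exists_conjTranspose_mul_self_eq_inv {d : ℕ} {A : Matrix (Fin d) (Fin d) ℂ}
    (hA : A.PosDef) : ∃ C : Matrix (Fin d) (Fin d) ℂ, Cᴴ * C = A⁻¹ ∧ C.det ≠ 0 := by
  obtain ⟨C, hC⟩ := CStarAlgebra.nonneg_iff_eq_star_mul_self.mp hA.inv.posSemidef.nonneg
  rw [Matrix.star_eq_conjTranspose] at hC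
  refine ⟨C, hC.symm, fun h => ?_⟩
  have h1 : (A⁻¹).det = 0 := by rw [hC, Matrix.det_mul, h, mul_zero]
  have h2 := A⁻¹.isUnit_iff_isUnit_det.1 hA.inv.isUnit
  rw [h1] at h2
  exact not_isUnit_zero h2

namespace Model

variable {M L T K N m : ℕ} {𝓜 : Model M L T K}

/-! ### Averages over a codebook -/

lemma Scheme.pos (S : 𝓜.Scheme N m) : 0 < m :=
  Fin.pos (S.dec 0)

lemma trace_empCov (x : Fin N → Fin M → ℂ) :
    (empCov x).trace = ((1 / N * ∑ n, ∑ a, ‖x n a‖ ^ 2 : ℝ) : ℂ) := by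
  simp only [empCov, Matrix.trace_smul, Matrix.trace_sum, Matrix.trace_vecMulVec, dotProduct,
    Pi.star_apply, Complex.star_def, Complex.mul_conj, Complex.normSq_eq_norm_sq, smul_eq_mul]
  push_cast
  rfl

lemma Scheme.avgCov_posSemidef (S : 𝓜.Scheme N m) : S.avgCov.PosSemidef := by
  refine (Matrix.posSemidef_sum _ fun w _ => empCov_posSemidef (S.enc w)).smul ?_
  rw [Complex.zero_le_real]
  positivity

lemma Scheme.trace_avgCov_le (S : 𝓜.Scheme N m) : S.avgCov.trace.re ≤ 𝓜.P := by
  have hm : (0 : ℝ) < m := by exact_mod_cast S.pos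
  simp only [avgCov, Matrix.trace_smul, Matrix.trace_sum, trace_empCov, smul_eq_mul,
    Complex.re_ofReal_mul, Complex.re_sum, Complex.ofReal_re]
  have := Finset.sum_le_sum fun w (_ : w ∈ Finset.univ) => S.power w
  simp only [Finset.sum_const, Finset.card_univ, Fintype.card_fin, nsmul_eq_mul] at this
  rw [div_mul_eq_mul_div, one_mul, div_le_iff₀ hm]
  linarith

lemma Regular.expFIM_avgCov (h : 𝓜.Regular) (S : 𝓜.Scheme N m) :
    𝓜.expFIM S.avgCov = (1 / m : ℝ) • ∑ w, 𝓜.expFIM (empCov (S.enc w)) := by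
  rw [Scheme.avgCov, expFIM_smul, h.expFIM_sum]

/-- The van Trees inequality averaged over a codebook, paired with an arbitrary matrix `B`. -/
lemma Regular.two_mul_trace_sub_le_avgRisk (h : 𝓜.Regular) (hN : 0 < N) (S : 𝓜.Scheme N m)
    (hfin : S.avgRisk ≠ ⊤) (B : Matrix (Fin K) (Fin K) ℝ) :
    2 * B.trace - (B * (𝓜.expFIM S.avgCov + (1 / N : ℝ) • 𝓜.priorInfo) * Bᵀ).trace
      ≤ N * S.avgRisk.toReal := by
  have hm : (0 : ℝ) < m := by exact_mod_cast S.pos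
  have hr : ∀ w, S.risk w ≠ ⊤ := by
    intro w hw
    apply hfin
    have : ∑ w, S.risk w = ⊤ := ENNReal.sum_eq_top.2 ⟨w, Finset.mem_univ w, hw⟩
    rw [Scheme.avgRisk, this, ENNReal.top_div_of_ne_top (ENNReal.natCast_ne_top m)]
  have hw := Finset.sum_le_sum fun w (_ : w ∈ Finset.univ) =>
    h.two_mul_trace_sub_le_mse hN (S.enc w) (S.est_meas w) (hr w) B
  have e : S.avgRisk.toReal = (∑ w, (S.risk w).toReal) / m := by
    rw [Scheme.avgRisk, ENNReal.toReal_div, ENNReal.toReal_sum fun w _ => hr w]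
    simp
  have e2 : (B * (𝓜.expFIM S.avgCov + (1 / N : ℝ) • 𝓜.priorInfo) * Bᵀ).trace
      = (1 / m : ℝ) * ∑ w, (B * (𝓜.expFIM (empCov (S.enc w)) + (1 / N : ℝ) • 𝓜.priorInfo)
        * Bᵀ).trace := by
    simp only [h.expFIM_avgCov, mul_add, add_mul, Matrix.trace_add, Finset.sum_add_distrib,
      Finset.sum_const, Finset.card_univ, Fintype.card_fin, nsmul_eq_mul, Matrix.mul_smul,
      Matrix.smul_mul, Matrix.trace_smul, Matrix.mul_sum, Matrix.sum_mul, Matrix.trace_sum,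
      smul_eq_mul]
    field_simp
  rw [Finset.sum_sub_distrib, Finset.sum_const, Finset.card_univ, Fintype.card_fin,
    nsmul_eq_mul, ← Finset.mul_sum] at hw
  rw [e, e2]
  have hw' := div_le_div_of_nonneg_right hw hm.le
  calc _ = (m * (2 * B.trace) - ∑ w, (B * (𝓜.expFIM (empCov (S.enc w))
        + (1 / N : ℝ) • 𝓜.priorInfo) * Bᵀ).trace) / m := by field_simp
    _ ≤ _ := hw'
    _ = _ := by rw [mul_div_assoc]; rfl

lemma Regular.millerChang (h : 𝓜.Regular) (hN : 0 < N) (S : 𝓜.Scheme N m) :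
    invTrace (𝓜.expFIM S.avgCov + (1 / N : ℝ) • 𝓜.priorInfo) ≤ N * S.avgRisk := by
  by_cases hfin : S.avgRisk = ⊤
  · rw [hfin, ENNReal.mul_top (by exact_mod_cast hN.ne')]
    exact le_top
  · refine (invTrace_le_ofReal (h.posSemidef_add_priorInfo S.avgCov_posSemidef N)
      (h.two_mul_trace_sub_le_avgRisk hN S hfin)).trans (le_of_eq ?_)
    rw [ENNReal.ofReal_mul (by positivity), ENNReal.ofReal_natCast, ENNReal.ofReal_toReal hfin]

lemma Scheme.avgRisk_le_maxRisk (S : 𝓜.Scheme N m) : S.avgRisk ≤ S.maxRisk := by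
  have hm : (m : ℝ≥0∞) ≠ 0 := by exact_mod_cast S.pos.ne'
  rw [avgRisk, ENNReal.div_le_iff hm (ENNReal.natCast_ne_top m)]
  refine (Finset.sum_le_sum fun w _ => le_iSup S.risk w).trans (le_of_eq ?_)
  rw [Finset.sum_const, Finset.card_univ, Fintype.card_fin, nsmul_eq_mul, mul_comm]
  rfl

/-! ### The coding converse -/

variable (𝓜)

/-- The matrix `I + H Q Hᴴ / σω²`, whose determinant gives the rate. -/
noncomputable def rateMatrix (Q : Matrix (Fin M) (Fin M) ℂ) : Matrix (Fin L) (Fin L) ℂ :=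
  1 + ((1 / 𝓜.σω ^ 2 : ℝ) : ℂ) • (𝓜.H * Q * 𝓜.Hᴴ)

lemma rateMatrix_posDef {Q : Matrix (Fin M) (Fin M) ℂ} (hQ : Q.PosSemidef) :
    (𝓜.rateMatrix Q).PosDef := by
  refine Matrix.PosDef.one.add_posSemidef ((hQ.mul_mul_conjTranspose_same 𝓜.H).smul ?_)
  rw [Complex.zero_le_real]
  positivity

lemma rate_eq (Q : Matrix (Fin M) (Fin M) ℂ) :
    𝓜.rate Q * Real.log 2 = Real.log (𝓜.rateMatrix Q).det.re := by
  have : Real.log 2 ≠ 0 := (Real.log_pos (by norm_num)).ne'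
  rw [rate, Real.logb, div_mul_cancel₀ _ this]
  rfl

variable {𝓜}

lemma sum_sq_norm_mulVec_eq_trace {d : ℕ} (C : Matrix (Fin d) (Fin L) ℂ) (x : Fin M → ℂ) :
    ((∑ r, ‖(C *ᵥ (𝓜.H *ᵥ x)) r‖ ^ 2 : ℝ) : ℂ)
      = (C * (𝓜.H * Matrix.vecMulVec x (star x) * 𝓜.Hᴴ) * Cᴴ).trace := by
  rw [Matrix.mul_vecMulVec, Matrix.vecMulVec_mul, Matrix.mul_vecMulVec, Matrix.vecMulVec_mul,
    Matrix.trace_vecMulVec, ← Matrix.star_mulVec, ← Matrix.star_mulVec]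
  simp only [dotProduct, Pi.star_apply, Complex.star_def, Complex.mul_conj,
    Complex.normSq_eq_norm_sq]
  push_cast
  rfl

/-- The relative entropy of the output law of a codeword with respect to a product of centred
Gaussian laws with covariance `σω² (Cᴴ C)⁻¹`. -/
lemma integral_log_userLaw (hN : 0 < N) {C : Matrix (Fin L) (Fin L) ℂ} (hC : C.det ≠ 0)
    (x : Fin N → Fin M → ℂ) :
    Integrable (fun y : Fin N → Fin L → ℂ => Real.log
      ((∏ n, cnDensity 𝓜.σω (𝓜.H *ᵥ x n) (y n)) / ∏ n, refDensity 𝓜.σω C (y n))) (𝓜.userLaw x) ∧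
    ∫ y : Fin N → Fin L → ℂ, Real.log
      ((∏ n, cnDensity 𝓜.σω (𝓜.H *ᵥ x n) (y n)) / ∏ n, refDensity 𝓜.σω C (y n)) ∂(𝓜.userLaw x)
      = N * (-Real.log (‖C.det‖ ^ 2) - L + ∑ r, ∑ t, ‖C r t‖ ^ 2)
        + N * (1 / 𝓜.σω ^ 2 * (C * (𝓜.H * empCov x * 𝓜.Hᴴ) * Cᴴ).trace.re) := by
  have hσ := 𝓜.σω_pos
  have hN' : (0 : ℝ) < N := by exact_mod_cast hN
  have hcn := fun n : Fin N => isProbabilityMeasure_cnLaw hσ (𝓜.H *ᵥ x n)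
  have hlogeq : ∀ y : Fin N → Fin L → ℂ, Real.log
      ((∏ n, cnDensity 𝓜.σω (𝓜.H *ᵥ x n) (y n)) / ∏ n, refDensity 𝓜.σω C (y n))
      = ∑ n, Real.log (cnDensity 𝓜.σω (𝓜.H *ᵥ x n) (y n) / refDensity 𝓜.σω C (y n)) :=
    fun y => by
      rw [← Finset.prod_div_distrib, Real.log_prod]
      exact fun n _ => (div_pos (cnDensity_pos hσ _ _) (refDensity_pos hσ hC _)).ne'
  have hk := fun n : Fin N => integral_log_cnDensity_div_refDensity hσ hC (𝓜.H *ᵥ x n)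
  simp_rw [hlogeq]
  rw [show 𝓜.userLaw x = Measure.pi fun n => cnLaw 𝓜.σω (𝓜.H *ᵥ x n) from rfl]
  constructor
  · refine integrable_finsetSum _ fun n _ => ?_
    exact integrable_comp_eval (μ := fun n => cnLaw 𝓜.σω (𝓜.H *ᵥ x n)) (i := n)
      (f := fun y => Real.log (cnDensity 𝓜.σω (𝓜.H *ᵥ x n) y / refDensity 𝓜.σω C y)) (hk n).1
  · refine (integral_sum_pi (f := fun n y => Real.log
      (cnDensity 𝓜.σω (𝓜.H *ᵥ x n) y / refDensity 𝓜.σω C y)) fun n => (hk n).1).trans ?_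
    simp only [(hk _).2]
    have e : (C * (𝓜.H * empCov x * 𝓜.Hᴴ) * Cᴴ).trace.re
        = 1 / N * ∑ n, ∑ r, ‖(C *ᵥ (𝓜.H *ᵥ x n)) r‖ ^ 2 := by
      simp only [empCov, Matrix.mul_smul, Matrix.smul_mul, Matrix.trace_smul, smul_eq_mul,
        Complex.re_ofReal_mul, Matrix.mul_sum, Matrix.sum_mul, Matrix.trace_sum,
        ← sum_sq_norm_mulVec_eq_trace, Complex.re_sum, Complex.ofReal_re]
    rw [e]
    simp only [Finset.sum_add_distrib, Finset.sum_sub_distrib, Finset.sum_const,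
      Finset.card_univ, Fintype.card_fin, nsmul_eq_mul, ← Finset.sum_div]
    field_simp
    ring

/-- Converse for the user channel: if every message is decoded with error probability at most `ε`,
then the size of the codebook is bounded through the relative entropies of the output laws with
respect to the Gaussian law of covariance `σω² I + H Q̄ Hᴴ`. Averaged over the codebook, these add
up to exactly `N log det (I + H Q̄ Hᴴ / σω²)`. -/
lemma Scheme.log_card_le (S : 𝓜.Scheme N m) (hN : 0 < N) {ε : ℝ} (hε : 0 ≤ ε)
    (herr : S.maxErr ≤ ENNReal.ofReal ε) :
    (1 - ε) * Real.log m ≤ N * (𝓜.rate S.avgCov * Real.log 2) + 1 := by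
  have hσ := 𝓜.σω_pos
  have hm : (0 : ℝ) < m := by exact_mod_cast S.pos
  have hN' : (0 : ℝ) < N := by exact_mod_cast hN
  have hQ := S.avgCov_posSemidef
  have hA := 𝓜.rateMatrix_posDef hQ
  obtain ⟨C, hC, hdet⟩ := exists_conjTranspose_mul_self_eq_inv hA
  -- The reference law of a block is the product of centred Gaussian laws.
  set q : (Fin N → Fin L → ℂ) → ℝ := fun y => ∏ n, refDensity 𝓜.σω C (y n) with hq
  have hqpos : ∀ y, 0 < q y := fun y => Finset.prod_pos fun n _ => refDensity_pos hσ hdet _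
  have hqm : Measurable q := Finset.measurable_fun_prod _ fun n _ =>
    (continuous_refDensity 𝓜.σω C).measurable.comp (measurable_pi_apply n)
  have hqi : Integrable q := Integrable.fintype_prod_dep fun _ =>
    Integrable.of_integral_ne_zero (by rw [integral_refDensity hσ hdet]; norm_num)
  set Q : Measure (Fin N → Fin L → ℂ) :=
    volume.withDensity fun y => ENNReal.ofReal (q y) with hQdef
  have hQp : IsProbabilityMeasure Q := by
    constructor
    rw [hQdef, withDensity_apply _ MeasurableSet.univ, setLIntegral_univ,
      ← ofReal_integral_eq_lintegral_ofReal hqi (ae_of_all _ fun y => (hqpos y).le), hq,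
      integral_fintype_prod_volume_eq_prod]
    simp [integral_refDensity hσ hdet]
  have hcn := fun (w : Fin m) (n : Fin N) =>
    isProbabilityMeasure_cnLaw hσ (𝓜.H *ᵥ S.enc w n)
  have hPp : ∀ w, IsProbabilityMeasure (𝓜.userLaw (S.enc w)) := fun w => by
    unfold userLaw; infer_instance
  set p : Fin m → (Fin N → Fin L → ℂ) → ℝ :=
    fun w y => ∏ n, cnDensity 𝓜.σω (𝓜.H *ᵥ S.enc w n) (y n) with hp
  have hppos : ∀ w y, 0 < p w y := fun w y => Finset.prod_pos fun n _ => cnDensity_pos hσ _ _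
  have hpm : ∀ w, Measurable (p w) := fun w => Finset.measurable_fun_prod _ fun n _ =>
    (continuous_cnDensity 𝓜.σω _).measurable.comp (measurable_pi_apply n)
  have hPd : ∀ w, 𝓜.userLaw (S.enc w) = volume.withDensity fun y => ENNReal.ofReal (p w y) :=
    fun w => pi_withDensity_ofReal (fun _ _ => (cnDensity_pos hσ _ _).le)
      fun _ => integrable_cnDensity hσ _
  have hlogi : ∀ w, Integrable (fun y => Real.log (p w y / q y)) (𝓜.userLaw (S.enc w)) :=
    fun w => (integral_log_userLaw (𝓜 := 𝓜) hN hdet (S.enc w)).1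
  have hlogint : ∀ w, ∫ y, Real.log (p w y / q y) ∂(𝓜.userLaw (S.enc w))
      = N * (-Real.log (‖C.det‖ ^ 2) - L + ∑ r, ∑ t, ‖C r t‖ ^ 2)
        + N * (1 / 𝓜.σω ^ 2 * (C * (𝓜.H * empCov (S.enc w) * 𝓜.Hᴴ) * Cᴴ).trace.re) :=
    fun w => (integral_log_userLaw (𝓜 := 𝓜) hN hdet (S.enc w)).2
  have hD : ∀ w, MeasurableSet {y | S.dec y = w} := fun w =>
    S.dec_meas (measurableSet_singleton w)
  have hPD : ∀ w, 1 - ε ≤ (𝓜.userLaw (S.enc w)).real {y | S.dec y = w} := by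
    intro w
    have h1 := probReal_compl_eq_one_sub (μ := 𝓜.userLaw (S.enc w)) (hD w)
    have h2 : (𝓜.userLaw (S.enc w)).real {y | S.dec y = w}ᶜ ≤ ε :=
      ENNReal.toReal_le_of_le_ofReal hε
        ((le_iSup (fun w => 𝓜.userLaw (S.enc w) {y | S.dec y ≠ w}) w).trans herr)
    linarith
  have hQsum : ∑ w, Q.real {y | S.dec y = w} = 1 := by
    have h1 := sum_measureReal_preimage_singleton (μ := Q) (f := S.dec) Finset.univ
      (fun w _ => hD w)
    simpa [Set.preimage] using h1
  have hlogm : 0 ≤ Real.log m := Real.log_natCast_nonneg m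
  have hmain : ∀ w, (1 - ε) * Real.log m
      ≤ ∫ y, Real.log (p w y / q y) ∂(𝓜.userLaw (S.enc w))
        + (m - 1) * Q.real {y | S.dec y = w} := by
    intro w
    have h1 := mul_measureReal_le_integral_log (hppos w) hqpos (hpm w) hqm (hPd w) hQdef (hD w)
      (Real.log m) (hlogi w)
    rw [Real.exp_log hm] at h1
    have h2 := mul_le_mul_of_nonneg_left (hPD w) hlogm
    linarith
  have hsum := Finset.sum_le_sum fun w (_ : w ∈ Finset.univ) => hmain w
  simp only [hlogint, Finset.sum_add_distrib, Finset.sum_const, Finset.card_univ,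
    Fintype.card_fin, nsmul_eq_mul, ← Finset.mul_sum, hQsum] at hsum
  -- The quadratic terms average to `tr (C (I + H Q̄ Hᴴ / σω²) Cᴴ) = L`.
  have htr : ∑ r, ∑ t, ‖C r t‖ ^ 2
      + 1 / 𝓜.σω ^ 2 * (C * (𝓜.H * S.avgCov * 𝓜.Hᴴ) * Cᴴ).trace.re = L := by
    have h1 : (C * 𝓜.rateMatrix S.avgCov * Cᴴ).trace = L := by
      rw [Matrix.mul_assoc, Matrix.trace_mul_comm, Matrix.mul_assoc, hC,
        Matrix.mul_nonsing_inv _ ((Matrix.isUnit_iff_isUnit_det _).1 hA.isUnit)]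
      simp
    have h2 : (C * 𝓜.rateMatrix S.avgCov * Cᴴ).trace.re = ∑ r, ∑ t, ‖C r t‖ ^ 2
        + 1 / 𝓜.σω ^ 2 * (C * (𝓜.H * S.avgCov * 𝓜.Hᴴ) * Cᴴ).trace.re := by
      rw [rateMatrix, Matrix.mul_add, Matrix.add_mul, Matrix.trace_add, Complex.add_re,
        Matrix.mul_one, Matrix.mul_smul, Matrix.smul_mul, Matrix.trace_smul, smul_eq_mul,
        Complex.re_ofReal_mul]
      congr 1
      simp only [Matrix.trace, Matrix.diag, Matrix.mul_apply, Matrix.conjTranspose_apply,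
        Complex.star_def, Complex.mul_conj, Complex.normSq_eq_norm_sq, Complex.re_sum,
        Complex.ofReal_re]
    rw [← h2, h1]
    simp
  have havg : (C * (𝓜.H * S.avgCov * 𝓜.Hᴴ) * Cᴴ).trace.re
      = 1 / m * ∑ w, (C * (𝓜.H * empCov (S.enc w) * 𝓜.Hᴴ) * Cᴴ).trace.re := by
    simp only [avgCov, Matrix.mul_smul, Matrix.smul_mul, Matrix.trace_smul, smul_eq_mul,
      Complex.re_ofReal_mul, Matrix.mul_sum, Matrix.sum_mul, Matrix.trace_sum, Complex.re_sum]
  have hdetlog : 𝓜.rate S.avgCov * Real.log 2 = -Real.log (‖C.det‖ ^ 2) := by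
    rw [rate_eq, ← Real.log_inv]
    congr 1
    have h1 : ((‖C.det‖ ^ 2 : ℝ) : ℂ) = (𝓜.rateMatrix S.avgCov).det⁻¹ := by
      have h2 := congrArg Matrix.det hC
      rw [Matrix.det_mul, Matrix.det_conjTranspose, Matrix.det_nonsing_inv,
        Ring.inverse_eq_inv', Complex.star_def, mul_comm, Complex.mul_conj,
        Complex.normSq_eq_norm_sq] at h2
      exact h2
    rw [← inv_inv (𝓜.rateMatrix S.avgCov).det, ← h1, ← Complex.ofReal_inv, Complex.ofReal_re]
  rw [hdetlog]
  have hfin : m * ((1 - ε) * Real.log m) ≤ m * (N * (-Real.log (‖C.det‖ ^ 2)) + 1) := by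
    have h3 : ∑ w, (C * (𝓜.H * empCov (S.enc w) * 𝓜.Hᴴ) * Cᴴ).trace.re
        = m * (C * (𝓜.H * S.avgCov * 𝓜.Hᴴ) * Cᴴ).trace.re := by
      rw [havg]; field_simp
    rw [h3] at hsum
    have h4 : (m : ℝ) * (N * (-Real.log (‖C.det‖ ^ 2) - L + ∑ r, ∑ t, ‖C r t‖ ^ 2))
        + N * (1 / 𝓜.σω ^ 2 * (m * (C * (𝓜.H * S.avgCov * 𝓜.Hᴴ) * Cᴴ).trace.re))
        = m * (N * (-Real.log (‖C.det‖ ^ 2))) := by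
      rw [← htr]; ring
    linarith
  exact le_of_mul_le_mul_left hfin hm

end Model

/-! ### The optimization programs -/

lemma isClosed_posSemidef {d : ℕ} :
    IsClosed {Q : Matrix (Fin d) (Fin d) ℂ | Q.PosSemidef} := by
  have e : {Q : Matrix (Fin d) (Fin d) ℂ | Q.PosSemidef} = {Q | Qᴴ = Q} ∩
      ⋂ x : Fin d → ℂ, ({Q | 0 ≤ (star x ⬝ᵥ Q *ᵥ x).re} ∩ {Q | 0 = (star x ⬝ᵥ Q *ᵥ x).im}) := by
    ext Q
    simp only [Matrix.posSemidef_iff_dotProduct_mulVec, Set.mem_ofPred_eq, Set.mem_inter_iff,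
      Set.mem_iInter, Complex.le_def, Complex.zero_re, Complex.zero_im, Matrix.IsHermitian]
  have hc : ∀ x : Fin d → ℂ, Continuous fun Q : Matrix (Fin d) (Fin d) ℂ => star x ⬝ᵥ Q *ᵥ x :=
    fun x => by fun_prop
  rw [e]
  refine (isClosed_eq (by fun_prop) continuous_id).inter (isClosed_iInter fun x => ?_)
  exact (isClosed_le continuous_const (Complex.continuous_re.comp (hc x))).inter
    (isClosed_eq continuous_const (Complex.continuous_im.comp (hc x)))

open scoped MatrixOrder in
lemma norm_apply_le_trace {d : ℕ} {Q : Matrix (Fin d) (Fin d) ℂ} (hQ : Q.PosSemidef)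
    (a b : Fin d) : ‖Q a b‖ ≤ Q.trace.re := by
  obtain ⟨C, rfl⟩ := CStarAlgebra.nonneg_iff_eq_star_mul_self.mp hQ.nonneg
  rw [Matrix.star_eq_conjTranspose]
  have hd : ∀ a, ((Cᴴ * C) a a).re = ∑ r, ‖C r a‖ ^ 2 := fun a => by
    rw [Matrix.mul_apply, Complex.re_sum]
    refine Finset.sum_congr rfl fun r _ => ?_
    rw [Matrix.conjTranspose_apply, Complex.star_def, mul_comm, Complex.mul_conj,
      Complex.normSq_eq_norm_sq, Complex.ofReal_re]
  have htr : (Cᴴ * C).trace.re = ∑ a, ∑ r, ‖C r a‖ ^ 2 := by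
    simp only [Matrix.trace, Matrix.diag, Complex.re_sum, hd]
  have hle : ∀ a, ∑ r, ‖C r a‖ ^ 2 ≤ (Cᴴ * C).trace.re := fun a => by
    rw [htr]
    exact Finset.single_le_sum (f := fun a => ∑ r, ‖C r a‖ ^ 2)
      (fun a _ => Finset.sum_nonneg fun r _ => sq_nonneg _) (Finset.mem_univ a)
  calc ‖(Cᴴ * C) a b‖ ≤ ∑ r, ‖C r a‖ * ‖C r b‖ := by
        rw [Matrix.mul_apply]
        refine (norm_sum_le _ _).trans (le_of_eq (Finset.sum_congr rfl fun r _ => ?_))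
        rw [norm_mul, Matrix.conjTranspose_apply, norm_star]
    _ ≤ ∑ r, (‖C r a‖ ^ 2 + ‖C r b‖ ^ 2) / 2 :=
        Finset.sum_le_sum fun r _ => by nlinarith [sq_nonneg (‖C r a‖ - ‖C r b‖)]
    _ = ((∑ r, ‖C r a‖ ^ 2) + ∑ r, ‖C r b‖ ^ 2) / 2 := by
        rw [← Finset.sum_div, Finset.sum_add_distrib]
    _ ≤ (Cᴴ * C).trace.re := by linarith [hle a, hle b]

/-- The set of covariance matrices that satisfy a power constraint is compact. -/
lemma isCompact_posSemidef_trace_le {d : ℕ} (P : ℝ) :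
    IsCompact {Q : Matrix (Fin d) (Fin d) ℂ | Q.PosSemidef ∧ Q.trace.re ≤ P} := by
  have hK : IsCompact (Set.pi Set.univ fun _ : Fin d => Set.pi Set.univ fun _ : Fin d =>
      Metric.closedBall (0 : ℂ) P) :=
    isCompact_univ_pi fun _ => isCompact_univ_pi fun _ => isCompact_closedBall _ _
  refine hK.of_isClosed_subset ?_ ?_
  · exact isClosed_posSemidef.inter
      (isClosed_le (Complex.continuous_re.comp (by fun_prop)) continuous_const)
  · intro Q hQ a _ b _
    rw [mem_closedBall_zero_iff]
    exact (norm_apply_le_trace hQ.1 a b).trans hQ.2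

lemma coe_ennreal_le_coe_real {a : ℝ≥0∞} {Δ : ℝ} :
    ((a : EReal) ≤ (Δ : EReal)) ↔ 0 ≤ Δ ∧ a ≤ ENNReal.ofReal Δ := by
  constructor
  · intro h
    have h0 : 0 ≤ Δ := by exact_mod_cast (EReal.coe_ennreal_nonneg a).trans h
    refine ⟨h0, ?_⟩
    rw [← EReal.coe_ennreal_le_coe_ennreal_iff, EReal.coe_ennreal_ofReal, max_eq_left h0]
    exact h
  · rintro ⟨h0, h⟩
    rw [← EReal.coe_ennreal_le_coe_ennreal_iff, EReal.coe_ennreal_ofReal, max_eq_left h0] at h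
    exact h

namespace Model

variable {M L T K : ℕ} {𝓜 : Model M L T K}

lemma det_rateMatrix_re_pos {Q : Matrix (Fin M) (Fin M) ℂ} (hQ : Q.PosSemidef) :
    0 < (𝓜.rateMatrix Q).det.re := by
  have := (𝓜.rateMatrix_posDef hQ).det_pos
  exact (Complex.lt_def.1 this).1

lemma continuousAt_rate {Q : Matrix (Fin M) (Fin M) ℂ} (hQ : Q.PosSemidef) :
    ContinuousAt 𝓜.rate Q := by
  have hc : Continuous fun Q => (𝓜.rateMatrix Q).det.re := by
    unfold rateMatrix
    exact Complex.continuous_re.comp (Continuous.matrix_det (by fun_prop))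
  exact (hc.continuousAt.log (det_rateMatrix_re_pos hQ).ne').div_const _

lemma Regular.continuous_trace_expFIM (h : 𝓜.Regular) (B : Matrix (Fin K) (Fin K) ℝ) :
    Continuous fun Q => (B * 𝓜.expFIM Q * Bᵀ).trace := by
  let F : Matrix (Fin M) (Fin M) ℂ →ₗ[ℝ] ℝ :=
    { toFun := fun Q => (B * 𝓜.expFIM Q * Bᵀ).trace
      map_add' := fun Q Q' => by
        rw [h.expFIM_add, Matrix.mul_add, Matrix.add_mul, Matrix.trace_add]
      map_smul' := fun c Q => by
        rw [show c • Q = (c : ℂ) • Q from (Complex.coe_smul c Q).symm, expFIM_smul,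
          Matrix.mul_smul, Matrix.smul_mul, Matrix.trace_smul, RingHom.id_apply] }
  exact F.continuous_of_finiteDimensional

/-- The sensing constraint `tr (E[J(Θ | Q)]⁻¹) ≤ Δ` is a family of affine constraints. -/
lemma Regular.feasible_bcrb_iff (h : 𝓜.Regular) {Δ : ℝ} {Q : Matrix (Fin M) (Fin M) ℂ} :
    𝓜.Feasible 𝓜.bcrb Δ Q ↔ (Q.PosSemidef ∧ Q.trace.re ≤ 𝓜.P) ∧
      ∀ B : Matrix (Fin K) (Fin K) ℝ, 2 * B.trace - (B * 𝓜.expFIM Q * Bᵀ).trace ≤ Δ := by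
  rw [Feasible, coe_ennreal_le_coe_real]
  constructor
  · rintro ⟨h1, ⟨h0, h2⟩, h3⟩
    refine ⟨⟨h1, h3⟩, fun B => ?_⟩
    exact (ENNReal.ofReal_le_ofReal_iff h0).1 ((ofReal_le_invTrace _ B).trans h2)
  · rintro ⟨⟨h1, h3⟩, h2⟩
    refine ⟨h1, ⟨by simpa using h2 0, ?_⟩, h3⟩
    exact invTrace_le_ofReal (h.expFIM_posSemidef h1) h2

/-- The variational formula describes the sensing constraint by closed half-spaces, so the feasible
set is compact. -/
lemma Regular.exists_feasible_capUB_eq (h : 𝓜.Regular) (Δ : ℝ)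
    (hne : ∃ Q, 𝓜.Feasible 𝓜.bcrb Δ Q) :
    ∃ Q, 𝓜.Feasible 𝓜.bcrb Δ Q ∧ 𝓜.capUB Δ = (𝓜.rate Q : EReal) := by
  have e : {Q | 𝓜.Feasible 𝓜.bcrb Δ Q} = {Q | Q.PosSemidef ∧ Q.trace.re ≤ 𝓜.P} ∩
      ⋂ B : Matrix (Fin K) (Fin K) ℝ,
        {Q | 2 * B.trace - (B * 𝓜.expFIM Q * Bᵀ).trace ≤ Δ} := by
    ext Q
    simp only [Set.mem_ofPred_eq, h.feasible_bcrb_iff, Set.mem_inter_iff, Set.mem_iInter]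
  have hc : IsCompact {Q | 𝓜.Feasible 𝓜.bcrb Δ Q} := by
    rw [e]
    exact (isCompact_posSemidef_trace_le 𝓜.P).inter_right (isClosed_iInter fun B =>
      isClosed_le (continuous_const.sub (h.continuous_trace_expFIM B)) continuous_const)
  obtain ⟨Q, hQ, hmax⟩ := hc.exists_isMaxOn hne
    (f := 𝓜.rate) fun Q hQ => (continuousAt_rate hQ.1).continuousWithinAt
  refine ⟨Q, hQ, le_antisymm (sSup_le ?_) (le_sSup ⟨Q, hQ, rfl⟩)⟩
  rintro r ⟨Q', hQ', rfl⟩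
  exact_mod_cast hmax hQ'

/-- Achievability provides schemes of unbounded block length whose average covariances converge to
a matrix that supports the rate. -/
lemma exists_limit_of_achievable {R Δ : ℝ} (hach : 𝓜.Achievable Scheme.avgRisk R Δ) :
    ∃ (N m : ℕ → ℕ) (S : ∀ k, 𝓜.Scheme (N k) (m k)) (δ : ℕ → ℝ)
      (Q : Matrix (Fin M) (Fin M) ℂ),
      (∀ k, 0 < N k) ∧ Tendsto N atTop atTop ∧ Tendsto δ atTop (𝓝 0) ∧
      (∀ k, (S k).avgRisk ≠ ⊤) ∧ (∀ k, N k * (S k).avgRisk.toReal ≤ Δ + δ k) ∧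
      Tendsto (fun k => (S k).avgCov) atTop (𝓝 Q) ∧ Q.PosSemidef ∧ Q.trace.re ≤ 𝓜.P ∧
      R ≤ 𝓜.rate Q := by
  have hstep : ∀ k : ℕ, ∃ (N m : ℕ) (S : 𝓜.Scheme N m), k + 1 ≤ N ∧
      S.maxErr ≤ ENNReal.ofReal (1 / ((k : ℝ) + 1)) ∧
      R - 1 / ((k : ℝ) + 1) ≤ 1 / N * Real.logb 2 m ∧
      (((N : ℝ≥0∞) * S.avgRisk : ℝ≥0∞) : EReal) ≤ ((Δ + 1 / ((k : ℝ) + 1) : ℝ) : EReal) := by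
    intro k
    obtain ⟨N₀, hN₀⟩ := hach (1 / ((k : ℝ) + 1)) (by positivity)
    obtain ⟨m, S, hS⟩ := hN₀ (max N₀ (k + 1)) (le_max_left _ _)
    exact ⟨_, m, S, le_max_right _ _, hS⟩
  choose N m S hN herr hrate hrisk using hstep
  have : FirstCountableTopology (Matrix (Fin M) (Fin M) ℂ) :=
    inferInstanceAs (FirstCountableTopology (Fin M → Fin M → ℂ))
  obtain ⟨Q, hQ, φ, hφ, hlim⟩ := (isCompact_posSemidef_trace_le (d := M) 𝓜.P).tendsto_subseq
    (x := fun k => (S k).avgCov) fun k => ⟨(S k).avgCov_posSemidef, (S k).trace_avgCov_le⟩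
  have hNtop : Tendsto N atTop atTop :=
    tendsto_atTop_mono (fun k => (Nat.le_succ k).trans (hN k)) tendsto_id
  have hNφ : Tendsto (fun k => N (φ k)) atTop atTop := hNtop.comp hφ.tendsto_atTop
  have hδ : Tendsto (fun k => 1 / ((φ k : ℝ) + 1)) atTop (𝓝 0) :=
    (tendsto_one_div_add_atTop_nhds_zero_nat (𝕜 := ℝ)).comp hφ.tendsto_atTop
  have hNpos : ∀ k, 0 < N k := fun k => (Nat.succ_pos k).trans_le (hN k)
  have hr : ∀ k : ℕ, 0 ≤ Δ + 1 / ((k : ℝ) + 1) ∧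
      N k * (S k).avgRisk ≤ ENNReal.ofReal (Δ + 1 / ((k : ℝ) + 1)) :=
    fun k => coe_ennreal_le_coe_real.1 (hrisk k)
  refine ⟨fun k => N (φ k), fun k => m (φ k), fun k => S (φ k), fun k => 1 / ((φ k : ℝ) + 1), Q,
    fun k => hNpos _, hNφ, hδ, fun k => ?_, fun k => ?_, hlim, hQ.1, hQ.2, ?_⟩
  · intro htop
    have := (hr (φ k)).2
    rw [htop, ENNReal.mul_top (by exact_mod_cast (hNpos _).ne')] at this
    exact ENNReal.ofReal_ne_top (top_le_iff.1 this)
  · have := ENNReal.toReal_mono ENNReal.ofReal_ne_top (hr (φ k)).2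
    rwa [ENNReal.toReal_mul, ENNReal.toReal_natCast, ENNReal.toReal_ofReal (hr (φ k)).1] at this
  · have hlog2 : 0 < Real.log 2 := Real.log_pos (by norm_num)
    have hpt : ∀ k, (1 - 1 / ((φ k : ℝ) + 1)) * (R - 1 / ((φ k : ℝ) + 1))
        ≤ 𝓜.rate (S (φ k)).avgCov + 1 / (N (φ k) : ℝ) * (1 / Real.log 2) := by
      intro k
      have hNk : (0 : ℝ) < N (φ k) := by exact_mod_cast hNpos _
      have h1 := (S (φ k)).log_card_le (hNpos _) (by positivity) (herr (φ k))
      have h2 : (R - 1 / ((φ k : ℝ) + 1)) * (N (φ k) * Real.log 2) ≤ Real.log (m (φ k)) := by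
        have := hrate (φ k)
        rw [Real.logb, one_div_mul_eq_div, div_div, le_div_iff₀ (by positivity)] at this
        linarith
      have h3 : 0 ≤ 1 - 1 / ((φ k : ℝ) + 1) := by
        rw [sub_nonneg, div_le_one (by positivity)]
        linarith [(Nat.cast_nonneg (φ k) : (0 : ℝ) ≤ φ k)]
      have h4 := mul_le_mul_of_nonneg_left h2 h3
      have h5 : (1 - 1 / ((φ k : ℝ) + 1)) * (R - 1 / ((φ k : ℝ) + 1))
          * (N (φ k) * Real.log 2) ≤ (𝓜.rate (S (φ k)).avgCov
            + 1 / (N (φ k) : ℝ) * (1 / Real.log 2)) * (N (φ k) * Real.log 2) := by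
        have : (𝓜.rate (S (φ k)).avgCov + 1 / (N (φ k) : ℝ) * (1 / Real.log 2))
            * (N (φ k) * Real.log 2)
            = N (φ k) * (𝓜.rate (S (φ k)).avgCov * Real.log 2) + 1 := by
          field_simp
        rw [this]
        linarith
      exact le_of_mul_le_mul_right h5 (by positivity)
    have hL : Tendsto (fun k => (1 - 1 / ((φ k : ℝ) + 1)) * (R - 1 / ((φ k : ℝ) + 1))) atTop
        (𝓝 ((1 - 0) * (R - 0))) :=
      (tendsto_const_nhds.sub hδ).mul (tendsto_const_nhds.sub hδ)
    have hRt : Tendsto (fun k => 𝓜.rate (S (φ k)).avgCov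
        + 1 / (N (φ k) : ℝ) * (1 / Real.log 2)) atTop (𝓝 (𝓜.rate Q + 0 * (1 / Real.log 2))) :=
      ((continuousAt_rate hQ.1).tendsto.comp hlim).add
        ((tendsto_one_div_atTop_nhds_zero_nat.comp hNφ).mul_const _)
    simpa using le_of_tendsto_of_tendsto' hL hRt hpt

/-- For fixed `B` the Miller–Chang bound is affine in the covariance, so it passes to the limit of
the average covariances; the term with the prior information is of order `1 / N`. -/
lemma Regular.capAvg_le_capUB (h : 𝓜.Regular) (Δ : ℝ) : 𝓜.capAvg Δ ≤ 𝓜.capUB Δ := by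
  refine sSup_le ?_
  rintro r ⟨R, hR, rfl⟩
  obtain ⟨N, m, S, δ, Q, hN, hNtop, hδ, hfin, hrisk, hlim, hQ, htr, hrate⟩ :=
    exists_limit_of_achievable hR
  refine le_trans (b := (𝓜.rate Q : EReal)) (by exact_mod_cast hrate) (le_sSup ⟨Q, ?_, rfl⟩)
  refine h.feasible_bcrb_iff.2 ⟨⟨hQ, htr⟩, fun B => ?_⟩
  have hpt : ∀ k, 2 * B.trace - (B * 𝓜.expFIM (S k).avgCov * Bᵀ).trace
      - 1 / (N k : ℝ) * (B * 𝓜.priorInfo * Bᵀ).trace ≤ Δ + δ k := fun k => by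
    have := h.two_mul_trace_sub_le_avgRisk (hN k) (S k) (hfin k) B
    rw [Matrix.mul_add, Matrix.add_mul, Matrix.trace_add, Matrix.mul_smul, Matrix.smul_mul,
      Matrix.trace_smul, smul_eq_mul] at this
    linarith [hrisk k]
  have h1 : Tendsto (fun k => 2 * B.trace - (B * 𝓜.expFIM (S k).avgCov * Bᵀ).trace
      - 1 / (N k : ℝ) * (B * 𝓜.priorInfo * Bᵀ).trace) atTop
      (𝓝 (2 * B.trace - (B * 𝓜.expFIM Q * Bᵀ).trace - 0 * (B * 𝓜.priorInfo * Bᵀ).trace)) :=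
    (tendsto_const_nhds.sub (((h.continuous_trace_expFIM B).tendsto Q).comp hlim)).sub
      ((tendsto_one_div_atTop_nhds_zero_nat.comp hNtop).mul_const _)
  have h2 := le_of_tendsto_of_tendsto' h1 (tendsto_const_nhds.add hδ) hpt
  simpa using h2

lemma Achievable.avgRisk_of_maxRisk {R Δ : ℝ} (h : 𝓜.Achievable Scheme.maxRisk R Δ) :
    𝓜.Achievable Scheme.avgRisk R Δ := by
  intro ε hε
  obtain ⟨N₀, hN₀⟩ := h ε hε
  refine ⟨N₀, fun N hN => ?_⟩
  obtain ⟨m, S, h1, h2, h3⟩ := hN₀ N hN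
  refine ⟨m, S, h1, h2, le_trans ?_ h3⟩
  exact EReal.coe_ennreal_le_coe_ennreal_iff.2 (mul_le_mul_right S.avgRisk_le_maxRisk _)

lemma cap_le_capAvg (Δ : ℝ) : 𝓜.cap Δ ≤ 𝓜.capAvg Δ := by
  refine sSup_le_sSup ?_
  rintro r ⟨R, hR, rfl⟩
  exact ⟨R, hR.avgRisk_of_maxRisk, rfl⟩

/-! ### Comparison of the two sensing constraints -/

/-- Jensen's inequality: for fixed `B` the variational formula is affine in the matrix. -/
lemma Regular.bcrb_le_ecrb (h : 𝓜.Regular) {Q : Matrix (Fin M) (Fin M) ℂ} (hQ : Q.PosSemidef) :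
    𝓜.bcrb Q ≤ 𝓜.ecrb Q := by
  have := 𝓜.isProbabilityMeasure_prior
  by_cases hfin : 𝓜.ecrb Q = ⊤
  · rw [hfin]; exact le_top
  rw [← ENNReal.ofReal_toReal hfin]
  refine invTrace_le_ofReal (h.expFIM_posSemidef hQ) fun B => ?_
  have hi : Integrable (fun θ => 2 * B.trace - (B * 𝓜.condFIM θ Q * Bᵀ).trace) 𝓜.prior :=
    (integrable_const _).sub (h.integrable_trace_condFIM Q B)
  have e : ∫ θ, (2 * B.trace - (B * 𝓜.condFIM θ Q * Bᵀ).trace) ∂𝓜.prior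
      = 2 * B.trace - (B * 𝓜.expFIM Q * Bᵀ).trace := by
    rw [integral_sub (integrable_const _) (h.integrable_trace_condFIM Q B),
      h.integral_trace_condFIM]
    simp
  rw [← e, integral_eq_lintegral_pos_part_sub_lintegral_neg_part hi]
  refine (sub_le_self _ ENNReal.toReal_nonneg).trans (ENNReal.toReal_mono hfin ?_)
  exact lintegral_mono fun θ => ofReal_le_invTrace _ B

lemma trace_inv_eq_mul {A : Matrix (Fin K) (Fin K) ℝ} :
    A⁻¹.trace = A.det⁻¹ * A.adjugate.trace := by
  rw [Matrix.inv_def, Matrix.trace_smul, Ring.inverse_eq_inv', smul_eq_mul]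

lemma measurable_comp_condFIM (Q : Matrix (Fin M) (Fin M) ℂ)
    {F : Matrix (Fin K) (Fin K) ℝ → ℝ} (hF : Continuous F) :
    Measurable fun θ => F (𝓜.condFIM θ Q) := by
  have hm : Measurable fun θ : Fin K → ℝ => (fun i j => 𝓜.condFIM θ Q i j : Fin K → Fin K → ℝ) :=
    measurable_pi_lambda _ fun i => measurable_pi_lambda _ fun j => 𝓜.measurable_condFIM Q i j
  have hc : Continuous fun A : Fin K → Fin K → ℝ => F (Matrix.of A) := hF.comp (by fun_prop)
  exact hc.measurable.comp hm

lemma measurable_det_condFIM (Q : Matrix (Fin M) (Fin M) ℂ) :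
    Measurable fun θ => (𝓜.condFIM θ Q).det :=
  measurable_comp_condFIM Q (Continuous.matrix_det continuous_id)

lemma measurable_trace_inv_condFIM (Q : Matrix (Fin M) (Fin M) ℂ) :
    Measurable fun θ => (𝓜.condFIM θ Q)⁻¹.trace := by
  simp only [trace_inv_eq_mul]
  exact (measurable_det_condFIM Q).inv.mul
    (measurable_comp_condFIM Q (Continuous.matrix_adjugate continuous_id).matrix_trace)

/-- In the case of equality the variational formula at `B = E[J(Θ|Q)]⁻¹` is tight for almost every
`θ`, and the gap `tr ((J⁻¹ - B) J (J⁻¹ - B)ᵀ)` vanishes only if `J(θ|Q)⁻¹ = B`. -/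
lemma Regular.bcrb_eq_ecrb_iff (h : 𝓜.Regular) {Q : Matrix (Fin M) (Fin M) ℂ}
    (hQ : Q.PosSemidef) (hfin : 𝓜.ecrb Q ≠ ⊤) :
    𝓜.bcrb Q = 𝓜.ecrb Q ↔ ∀ᵐ θ ∂𝓜.prior, 𝓜.condFIM θ Q = 𝓜.expFIM Q := by
  have := 𝓜.isProbabilityMeasure_prior
  constructor
  · intro heq
    rcases Nat.eq_zero_or_pos K with rfl | hK
    · exact ae_of_all _ fun θ => Subsingleton.elim _ _
    -- Test the variational formula with the inverse of the mean.
    set B := (𝓜.expFIM Q)⁻¹ with hB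
    have hA : (𝓜.expFIM Q).PosDef := by
      by_contra hcon
      apply hfin
      rw [← heq, bcrb, invTrace, if_neg hcon]
    have hbc : 𝓜.bcrb Q = ENNReal.ofReal (2 * B.trace - (B * 𝓜.expFIM Q * Bᵀ).trace) := by
      have h0 := trace_gap hA B
      simp only [hB, sub_self, zero_mul, Matrix.trace_zero] at h0
      rw [bcrb, invTrace, if_pos hA]
      congr 1
      rw [hB]
      linarith
    set g : (Fin K → ℝ) → ℝ := fun θ => 2 * B.trace - (B * 𝓜.condFIM θ Q * Bᵀ).trace with hg
    have hgi : Integrable g 𝓜.prior :=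
      (integrable_const _).sub (h.integrable_trace_condFIM Q B)
    have hgint : ∫ θ, g θ ∂𝓜.prior = 2 * B.trace - (B * 𝓜.expFIM Q * Bᵀ).trace := by
      rw [hg, integral_sub (integrable_const _) (h.integrable_trace_condFIM Q B),
        h.integral_trace_condFIM]
      simp
    have hpd : ∀ᵐ θ ∂𝓜.prior, (𝓜.condFIM θ Q).PosDef := by
      have hsing : ∀ᵐ θ ∂𝓜.prior, (𝓜.condFIM θ Q).det ≠ 0 → (𝓜.condFIM θ Q).PosDef :=
        ae_of_all _ fun θ hdet => (𝓜.condFIM_posSemidef θ hQ).posDef_iff_isUnit.2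
          ((Matrix.isUnit_iff_isUnit_det _).2 (isUnit_iff_ne_zero.2 hdet))
      have hz : MeasurableSet {θ | (𝓜.condFIM θ Q).det = 0} :=
        measurable_det_condFIM Q (measurableSet_singleton 0)
      have hne : ∀ᵐ θ ∂𝓜.prior, (𝓜.condFIM θ Q).det ≠ 0 := by
        rw [ae_iff]
        simp only [not_not]
        by_contra hpos
        apply hfin
        rw [eq_top_iff]
        calc (⊤ : ℝ≥0∞) = ∫⁻ θ in {θ | (𝓜.condFIM θ Q).det = 0}, ⊤ ∂𝓜.prior := by
              rw [setLIntegral_const, ENNReal.top_mul hpos]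
          _ ≤ ∫⁻ θ in {θ | (𝓜.condFIM θ Q).det = 0}, invTrace (𝓜.condFIM θ Q) ∂𝓜.prior := by
              refine setLIntegral_mono' hz fun θ hθ => ?_
              rw [invTrace, if_neg fun hp => ?_]
              exact hp.det_pos.ne' hθ
          _ ≤ 𝓜.ecrb Q := setLIntegral_le_lintegral _ _
      filter_upwards [hsing, hne] with θ h1 h2 using h1 h2
    have hinv : ∀ᵐ θ ∂𝓜.prior, invTrace (𝓜.condFIM θ Q)
        = ENNReal.ofReal (𝓜.condFIM θ Q)⁻¹.trace := by
      filter_upwards [hpd] with θ hθ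
      rw [invTrace, if_pos hθ]
    have haem : AEMeasurable (fun θ => invTrace (𝓜.condFIM θ Q)) 𝓜.prior :=
      ⟨_, (measurable_trace_inv_condFIM Q).ennreal_ofReal, hinv⟩
    have hle : (fun θ => ENNReal.ofReal (g θ)) ≤ fun θ => invTrace (𝓜.condFIM θ Q) :=
      fun θ => ofReal_le_invTrace _ B
    have hlow : 𝓜.ecrb Q ≤ ∫⁻ θ, ENNReal.ofReal (g θ) ∂𝓜.prior := by
      rw [← heq, hbc, ← hgint, integral_eq_lintegral_pos_part_sub_lintegral_neg_part hgi]
      refine (ENNReal.ofReal_le_ofReal (sub_le_self _ ENNReal.toReal_nonneg)).trans ?_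
      exact ENNReal.ofReal_toReal_le
    have hae := ae_eq_of_ae_le_of_lintegral_le (ae_of_all _ hle)
      (ne_top_of_le_ne_top hfin (lintegral_mono hle)) haem hlow
    filter_upwards [hae, hinv, hpd] with θ h1 h2 h3
    have h4 : 0 < (𝓜.condFIM θ Q)⁻¹.trace := by
      have : Nonempty (Fin K) := ⟨⟨0, hK⟩⟩
      exact h3.inv.trace_pos
    have h5 : g θ = (𝓜.condFIM θ Q)⁻¹.trace := by
      have h6 : ENNReal.ofReal (g θ) = ENNReal.ofReal (𝓜.condFIM θ Q)⁻¹.trace := h1.trans h2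
      have h7 : 0 < g θ := by
        rw [← ENNReal.ofReal_pos, h6, ENNReal.ofReal_pos]; exact h4
      exact (ENNReal.ofReal_eq_ofReal_iff h7.le h4.le).1 h6
    have h8 := trace_gap h3 B
    rw [← h5, hg, sub_self] at h8
    have h9 : ((𝓜.condFIM θ Q)⁻¹ - B) * 𝓜.condFIM θ Q * ((𝓜.condFIM θ Q)⁻¹ - B)ᵀ = 0 := by
      have hps := h3.posSemidef.mul_mul_conjTranspose_same ((𝓜.condFIM θ Q)⁻¹ - B)
      rw [Matrix.conjTranspose_eq_transpose_of_trivial] at hps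
      exact hps.trace_eq_zero_iff.1 h8
    have h10 : (𝓜.condFIM θ Q)⁻¹ - B = 0 := by
      by_contra hne
      obtain ⟨i, hi⟩ : ∃ i, ((𝓜.condFIM θ Q)⁻¹ - B) i ≠ 0 := by
        by_contra hcon
        push Not at hcon
        exact hne (funext hcon)
      have hp := h3.dotProduct_mulVec_pos hi
      have h11 := congrFun₂ h9 i i
      rw [Matrix.mul_assoc, Matrix.mul_apply_eq_vecMul] at h11
      simp only [star_trivial] at hp
      refine hp.ne' ?_
      simpa [Matrix.mul_apply, Matrix.vecMul, dotProduct, Matrix.mulVec] using h11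
    have h12 : (𝓜.condFIM θ Q)⁻¹ = (𝓜.expFIM Q)⁻¹ := sub_eq_zero.1 h10
    rw [← Matrix.nonsing_inv_nonsing_inv _ ((Matrix.isUnit_iff_isUnit_det _).1 h3.isUnit), h12,
      Matrix.nonsing_inv_nonsing_inv _ ((Matrix.isUnit_iff_isUnit_det _).1 hA.isUnit)]
  · intro hae
    have e : 𝓜.ecrb Q = ∫⁻ _, invTrace (𝓜.expFIM Q) ∂𝓜.prior :=
      lintegral_congr_ae (hae.mono fun θ hθ => by simp only [hθ])
    rw [e, lintegral_const, measure_univ, mul_one]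
    rfl

lemma program_le_program {S S' : Matrix (Fin M) (Fin M) ℂ → ℝ≥0∞}
    (h : ∀ Q, Q.PosSemidef → S' Q ≤ S Q) (Δ : ℝ) : 𝓜.program S Δ ≤ 𝓜.program S' Δ := by
  refine sSup_le_sSup ?_
  rintro r ⟨Q, ⟨h1, h2, h3⟩, rfl⟩
  exact ⟨Q, ⟨h1, (EReal.coe_ennreal_le_coe_ennreal_iff.2 (h Q h1)).trans h2, h3⟩, rfl⟩

end Model

/-! ### A channel for which the bound is strictly loose -/

/-- A continuously differentiable probability density on `ℝ` that vanishes outside `[0, 1]`. -/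
noncomputable def bump (t : ℝ) : ℝ := 30 * max (t * (1 - t)) 0 ^ 2

lemma bump_nonneg (t : ℝ) : 0 ≤ bump t := by unfold bump; positivity

lemma continuous_bump : Continuous bump := by unfold bump; fun_prop

lemma bump_eq_zero {t : ℝ} (h : ¬(0 < t ∧ t < 1)) : bump t = 0 := by
  have : t * (1 - t) ≤ 0 := by
    by_contra hc
    push Not at hc
    rcases pos_and_pos_or_neg_and_neg_of_mul_pos hc with h1 | h1
    · exact h ⟨h1.1, by linarith [h1.2]⟩
    · linarith [h1.1, h1.2]
  simp [bump, max_eq_right this]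

/-- The derivative of the bump. -/
noncomputable def bumpDeriv (t : ℝ) : ℝ := 60 * max (t * (1 - t)) 0 * (1 - 2 * t)

lemma hasDerivAt_bump (t : ℝ) : HasDerivAt bump (bumpDeriv t) t := by
  have h1 : HasDerivAt (fun t : ℝ => t * (1 - t)) (1 - 2 * t) t := by
    have := (hasDerivAt_id t).mul ((hasDerivAt_id t).const_sub 1)
    convert! this using 1
    simp; ring
  have h2 := ((hasDerivAt_sq_posPart (t * (1 - t))).comp t h1).const_mul 30
  unfold bumpDeriv
  convert! h2 using 1
  ring

lemma bumpDeriv_sq_le (t : ℝ) : bumpDeriv t ^ 2 ≤ 120 * bump t := by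
  by_cases h : 0 < t ∧ t < 1
  · have h1 : (1 - 2 * t) ^ 2 ≤ 1 := by nlinarith [h.1, h.2]
    have h2 : 0 ≤ max (t * (1 - t)) 0 ^ 2 := sq_nonneg _
    unfold bumpDeriv bump
    nlinarith
  · have h0 := bump_eq_zero h
    have h1 : max (t * (1 - t)) 0 = 0 := by
      unfold bump at h0
      have : max (t * (1 - t)) 0 ^ 2 = 0 := by linarith
      exact pow_eq_zero_iff (by norm_num) |>.1 this
    rw [h0, bumpDeriv, h1]
    simp

lemma integral_bump : ∫ t, bump t = 1 := by
  have e : ∀ t, bump t = (Set.Ioc (0 : ℝ) 1).indicator (fun t => 30 * (t * (1 - t)) ^ 2) t := by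
    intro t
    by_cases h : 0 < t ∧ t < 1
    · have hm : t ∈ Set.Ioc (0 : ℝ) 1 := ⟨h.1, h.2.le⟩
      rw [Set.indicator_of_mem hm, bump, max_eq_left]
      nlinarith [h.1, h.2]
    · rw [bump_eq_zero h]
      by_cases h1 : t ∈ Set.Ioc (0 : ℝ) 1
      · have : t = 1 := by
          by_contra hne
          exact h ⟨h1.1, lt_of_le_of_ne h1.2 hne⟩
        rw [Set.indicator_of_mem h1, this]; norm_num
      · rw [Set.indicator_of_notMem h1]
  simp_rw [e]
  rw [integral_indicator measurableSet_Ioc, ← intervalIntegral.integral_of_le zero_le_one]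
  have e2 : ∀ t : ℝ, 30 * (t * (1 - t)) ^ 2 = 30 * t ^ 2 - 60 * t ^ 3 + 30 * t ^ 4 := fun t => by
    ring
  simp_rw [e2]
  rw [intervalIntegral.integral_add (Continuous.intervalIntegrable (by fun_prop) _ _)
      (Continuous.intervalIntegrable (by fun_prop) _ _),
    intervalIntegral.integral_sub (Continuous.intervalIntegrable (by fun_prop) _ _)
      (Continuous.intervalIntegrable (by fun_prop) _ _)]
  simp only [intervalIntegral.integral_const_mul, integral_pow]
  norm_num

lemma integrable_bump : Integrable bump :=
  Integrable.of_integral_ne_zero (by rw [integral_bump]; norm_num)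

/-- The prior density of the example: weight `p` on `[0, 1]` and weight `1 - p` on `[-1, 0]`. -/
noncomputable def mixDensity (p : ℝ) (t : ℝ) : ℝ := p * bump t + (1 - p) * bump (-t)

lemma mixDensity_nonneg {p : ℝ} (hp : p ∈ unitInterval) (t : ℝ) : 0 ≤ mixDensity p t :=
  add_nonneg (mul_nonneg hp.1 (bump_nonneg _))
    (mul_nonneg (sub_nonneg.2 hp.2) (bump_nonneg _))

lemma continuous_mixDensity (p : ℝ) : Continuous (mixDensity p) := by
  unfold mixDensity
  exact (continuous_const.mul continuous_bump).add
    (continuous_const.mul (continuous_bump.comp continuous_neg))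

lemma hasDerivAt_mixDensity (p t : ℝ) :
    HasDerivAt (mixDensity p) (p * bumpDeriv t - (1 - p) * bumpDeriv (-t)) t := by
  have h := ((hasDerivAt_bump t).const_mul p).add
    (((hasDerivAt_bump (-t)).comp t (hasDerivAt_neg t)).const_mul (1 - p))
  convert! h using 1
  ring

lemma deriv_mixDensity_sq_le {p : ℝ} (hp : p ∈ unitInterval) (t : ℝ) :
    (p * bumpDeriv t - (1 - p) * bumpDeriv (-t)) ^ 2 ≤ 120 * mixDensity p t := by
  have h1 := mul_le_mul_of_nonneg_left (bumpDeriv_sq_le t) hp.1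
  have h2 := mul_le_mul_of_nonneg_left (bumpDeriv_sq_le (-t)) (sub_nonneg.2 hp.2)
  have h3 : 0 ≤ p * (1 - p) * (bumpDeriv t + bumpDeriv (-t)) ^ 2 :=
    mul_nonneg (mul_nonneg hp.1 (sub_nonneg.2 hp.2)) (sq_nonneg _)
  unfold mixDensity
  nlinarith

lemma mixDensity_pos {p t : ℝ} (hp : p ∈ unitInterval) (h : 0 < mixDensity p t) :
    (0 < p ∧ 0 < t ∧ t < 1) ∨ (p < 1 ∧ t < 0 ∧ -1 < t) := by
  by_contra hc
  push Not at hc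
  have h1 : p * bump t = 0 := by
    rcases hp.1.eq_or_lt with h0 | h0
    · rw [← h0, zero_mul]
    · rw [bump_eq_zero (fun hh => absurd hh.2 (not_lt.2 (hc.1 h0 hh.1))), mul_zero]
  have h2 : (1 - p) * bump (-t) = 0 := by
    rcases hp.2.eq_or_lt with h0 | h0
    · rw [h0, sub_self, zero_mul]
    · rw [bump_eq_zero (fun hh => absurd (hc.2 h0 (by linarith [hh.1]))
        (by linarith [hh.2])), mul_zero]
  rw [mixDensity, h1, h2] at h
  simp at h

lemma integral_mixDensity (p : ℝ) : ∫ t, mixDensity p t = 1 := by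
  unfold mixDensity
  rw [integral_add (integrable_bump.const_mul p) ((integrable_bump.comp_neg).const_mul (1 - p)),
    integral_const_mul, integral_const_mul, integral_neg_eq_self bump, integral_bump]
  ring

lemma lintegral_fin_one (F : ℝ → ℝ≥0∞) : ∫⁻ θ : Fin 1 → ℝ, F (θ 0) = ∫⁻ t, F t :=
  (volume_preserving_funUnique (Fin 1) ℝ).lintegral_comp_emb
    (MeasurableEquiv.funUnique (Fin 1) ℝ).measurableEmbedding F

/-- The response of the example: slope `1` for negative and slope `2` for positive arguments. -/
noncomputable def kink (t : ℝ) : ℝ := max t (2 * t)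

/-- The inverse of the response. -/
noncomputable def kinkInv (y : ℝ) : ℝ := min y (y / 2)

lemma kinkInv_kink (t : ℝ) : kinkInv (kink t) = t := by
  unfold kinkInv kink
  rcases le_total t 0 with h | h
  · rw [max_eq_left (by linarith), min_eq_left (by linarith)]
  · rw [max_eq_right (by linarith), min_eq_right (by linarith)]; ring

lemma abs_kinkInv_sub_le (y y' : ℝ) : |kinkInv y - kinkInv y'| ≤ |y - y'| := by
  unfold kinkInv
  refine (abs_min_sub_min_le_max _ _ _ _).trans (max_le le_rfl ?_)
  rw [← sub_div, abs_div, abs_of_pos (by norm_num : (0 : ℝ) < 2)]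
  linarith [abs_nonneg (y - y')]

lemma hasDerivAt_kink_pos {t : ℝ} (ht : 0 < t) : HasDerivAt kink 2 t := by
  have e : kink =ᶠ[𝓝 t] fun t => 2 * t := by
    filter_upwards [eventually_gt_nhds ht] with s hs
    exact max_eq_right (by linarith)
  exact (by simpa using (hasDerivAt_id t).const_mul 2 : HasDerivAt (fun t : ℝ => 2 * t) 2 t)
    |>.congr_of_eventuallyEq e

lemma hasDerivAt_kink_neg {t : ℝ} (ht : t < 0) : HasDerivAt kink 1 t := by
  have e : kink =ᶠ[𝓝 t] fun t => t := by
    filter_upwards [eventually_lt_nhds ht] with s hs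
    exact max_eq_left (by linarith)
  exact (hasDerivAt_id t).congr_of_eventuallyEq e

/-- The channel matrix of the example: only the second antenna illuminates the target. -/
noncomputable def kinkG (θ : Fin 1 → ℝ) : Matrix (Fin 1) (Fin 2) ℂ :=
  Matrix.of fun _ => ![0, (kink (θ 0) : ℂ)]

lemma hasFDerivAt_kinkG {θ : Fin 1 → ℝ} {s : ℝ} (h : HasDerivAt kink s (θ 0)) :
    HasFDerivAt (fun θ' => kinkG θ' 0 1)
      (Complex.ofRealCLM.comp (s • ContinuousLinearMap.proj (R := ℝ) (φ := fun _ : Fin 1 => ℝ) 0))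
      θ := by
  have h1 : HasFDerivAt (fun θ' : Fin 1 → ℝ => kink (θ' 0))
      (s • ContinuousLinearMap.proj (R := ℝ) (φ := fun _ : Fin 1 => ℝ) 0) θ :=
    HasDerivAt.comp_hasFDerivAt (h₂ := kink) (f := fun θ' : Fin 1 → ℝ => θ' 0) θ h
      (ContinuousLinearMap.proj (R := ℝ) (φ := fun _ : Fin 1 => ℝ) 0).hasFDerivAt
  exact Complex.ofRealCLM.hasFDerivAt.comp θ h1

lemma exists_slope {p : ℝ} (hp : p ∈ unitInterval) {θ : Fin 1 → ℝ}
    (h : 0 < mixDensity p (θ 0)) :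
    (0 < p ∧ HasDerivAt kink 2 (θ 0)) ∨ (p < 1 ∧ HasDerivAt kink 1 (θ 0)) :=
  (mixDensity_pos hp h).imp (fun h => ⟨h.1, hasDerivAt_kink_pos h.2.1⟩)
    fun h => ⟨h.1, hasDerivAt_kink_neg h.2.1⟩

/-- The example: the user listens to the first antenna, the sensor to the second one, and the prior
puts weight `p` on `[0, 1]`, where the response has slope `2`, and weight `1 - p` on `[-1, 0]`,
where it has slope `1`. -/
noncomputable def kinkModel (p : unitInterval) : Model 2 1 1 1 where
  H := Matrix.of fun _ => ![1, 0]
  G := kinkG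
  f θ := mixDensity p (θ 0)
  σω := 1
  συ := 1
  P := 2
  σω_pos := one_pos
  συ_pos := one_pos
  P_pos := two_pos
  f_meas := (continuous_mixDensity p).measurable.comp (measurable_pi_apply 0)
  f_nonneg θ := mixDensity_nonneg p.2 _
  f_lintegral := by
    rw [lintegral_fin_one (fun t => ENNReal.ofReal (mixDensity p t)),
      ← ofReal_integral_eq_lintegral_ofReal
        (Integrable.of_integral_ne_zero (by rw [integral_mixDensity]; norm_num))
        (ae_of_all _ (mixDensity_nonneg p.2)), integral_mixDensity, ENNReal.ofReal_one]
  G_meas t m := by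
    have hk : Continuous kink := by unfold kink; fun_prop
    fin_cases m
    · exact measurable_const
    · exact Complex.measurable_ofReal.comp (hk.measurable.comp (measurable_pi_apply 0))
  G_diff θ hθ t m := by
    fin_cases t
    fin_cases m
    · exact differentiableAt_const _
    · rcases exists_slope p.2 hθ with h | h
      · exact (hasFDerivAt_kinkG h.2).differentiableAt
      · exact (hasFDerivAt_kinkG h.2).differentiableAt
  G_inj := by
    refine ⟨Set.univ, ae_of_all _ fun _ => Set.mem_univ _, fun θ _ θ' _ h => ?_⟩
    have h1 : kink (θ 0) = kink (θ' 0) := by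
      have := congrFun₂ h 0 1
      simpa [kinkG] using this
    have h2 : θ 0 = θ' 0 := by rw [← kinkInv_kink (θ 0), h1, kinkInv_kink]
    funext i
    rw [Subsingleton.elim i 0, h2]

lemma kinkModel_dG (p : unitInterval) {θ : Fin 1 → ℝ} {s : ℝ} (h : HasDerivAt kink s (θ 0))
    (i : Fin 1) (t : Fin 1) : (kinkModel p).dG θ i t = ![0, (s : ℂ)] := by
  have hi := Subsingleton.elim i 0
  have ht := Subsingleton.elim t 0
  subst hi ht
  funext m
  fin_cases m
  · change fderiv ℝ (fun _ : Fin 1 → ℝ => (0 : ℂ)) θ _ = 0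
    simp
  · change fderiv ℝ (fun θ' => kinkG θ' 0 1) θ _ = (s : ℂ)
    rw [(hasFDerivAt_kinkG h).fderiv]
    simp

lemma kinkModel_condFIM (p : unitInterval) {θ : Fin 1 → ℝ} {s : ℝ}
    (h : HasDerivAt kink s (θ 0)) (Q : Matrix (Fin 2) (Fin 2) ℂ) (i j : Fin 1) :
    (kinkModel p).condFIM θ Q i j = 2 * s ^ 2 * (Q 1 1).re := by
  rw [Model.condFIM_eq_sum]
  simp only [kinkModel_dG p h]
  have : (kinkModel p).συ = 1 := rfl
  simp [Fin.sum_univ_two, this]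
  ring

lemma kinkModel_ae_slope_one : ∀ᵐ θ ∂(kinkModel 1).prior, HasDerivAt kink 2 (θ 0) := by
  filter_upwards [(kinkModel 1).ae_prior_pos] with θ hθ
  rcases exists_slope (1 : unitInterval).2 hθ with h | h
  · exact h.2
  · simp at h

lemma kinkModel_ae_slope_zero : ∀ᵐ θ ∂(kinkModel 0).prior, HasDerivAt kink 1 (θ 0) := by
  filter_upwards [(kinkModel 0).ae_prior_pos] with θ hθ
  rcases exists_slope (0 : unitInterval).2 hθ with h | h
  · simp at h
  · exact h.2

lemma kinkModel_regular (p : unitInterval) : (kinkModel p).Regular where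
  f_cont := (continuous_mixDensity p).comp (continuous_apply 0)
  f_diff θ _ := by
    change DifferentiableAt ℝ (fun θ : Fin 1 → ℝ => mixDensity p (θ 0)) θ
    exact (hasDerivAt_mixDensity p _).differentiableAt.comp θ (by fun_prop)
  prior_info i := by
    have hi := Subsingleton.elim i 0
    subst hi
    have hscore : ∀ θ : Fin 1 → ℝ, 0 < mixDensity p (θ 0) →
        (kinkModel p).priorScore θ 0 = (p * bumpDeriv (θ 0) - (1 - p) * bumpDeriv (-θ 0))
          / mixDensity p (θ 0) := by
      intro θ hθ
      have h1 := (((hasDerivAt_mixDensity p (θ 0)).log hθ.ne').comp_hasFDerivAt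
        (f := fun θ' : Fin 1 → ℝ => θ' 0) θ
        (ContinuousLinearMap.proj (R := ℝ) (φ := fun _ : Fin 1 => ℝ) 0).hasFDerivAt)
      change fderiv ℝ (fun θ' : Fin 1 → ℝ => Real.log (mixDensity p (θ' 0))) θ _ = _
      have h2 := h1.fderiv
      simp only [Function.comp_def] at h2
      rw [h2]
      simp
    rw [Model.prior, integrable_withDensity_iff_integrable_smul'
      (kinkModel p).f_meas.ennreal_ofReal (by simp)]
    have hK : MeasurableSet (Set.Icc (fun _ => -1) (fun _ => 1) : Set (Fin 1 → ℝ)) :=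
      measurableSet_Icc
    have hint : Integrable ((Set.Icc (fun _ => -1) (fun _ => 1) : Set (Fin 1 → ℝ)).indicator
        fun _ => (120 : ℝ)) := by
      rw [integrable_indicator_iff hK]
      exact integrableOn_const isCompact_Icc.measure_lt_top.ne
    refine hint.mono' ?_ (ae_of_all _ fun θ => ?_)
    · exact ((kinkModel p).f_meas.ennreal_ofReal.ennreal_toReal.mul
        (((kinkModel p).measurable_priorScore 0).pow_const 2)).aestronglyMeasurable
    · change ‖(ENNReal.ofReal (mixDensity p (θ 0))).toReal • (kinkModel p).priorScore θ 0 ^ 2‖ ≤ _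
      rw [ENNReal.toReal_ofReal (mixDensity_nonneg p.2 _), smul_eq_mul]
      rcases (mixDensity_nonneg p.2 (θ 0)).eq_or_lt with h0 | hpos
      · rw [← h0, zero_mul, norm_zero]
        exact Set.indicator_nonneg (fun _ _ => by norm_num) _
      · have hmem : θ ∈ (Set.Icc (fun _ => -1) (fun _ => 1) : Set (Fin 1 → ℝ)) := by
          have := mixDensity_pos p.2 hpos
          constructor <;> intro i <;> rw [Subsingleton.elim i 0] <;>
            rcases this with h | h <;> simp only <;> linarith [h.2.1, h.2.2]
        rw [Set.indicator_of_mem hmem, hscore θ hpos, Real.norm_of_nonneg (by positivity), div_pow,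
          pow_two (mixDensity p (θ 0)), ← mul_div_assoc, mul_div_mul_left _ _ hpos.ne',
          div_le_iff₀ hpos]
        exact deriv_mixDensity_sq_le p.2 _
  fim i t m := by
    have := (kinkModel p).isProbabilityMeasure_prior
    refine Integrable.of_bound
      (((kinkModel p).measurable_dG i t m).norm.pow_const 2).aestronglyMeasurable 4 ?_
    filter_upwards [(kinkModel p).ae_prior_pos] with θ hθ
    rw [Real.norm_of_nonneg (sq_nonneg _)]
    rcases exists_slope p.2 hθ with h | h
    · rw [kinkModel_dG p h.2]
      fin_cases m <;> norm_num
    · rw [kinkModel_dG p h.2]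
      fin_cases m <;> norm_num

/-- The prior of the example is a mixture of its two one-sided versions. -/
lemma kinkModel_prior (p : unitInterval) :
    (kinkModel p).prior = ENNReal.ofReal p • (kinkModel 1).prior
      + ENNReal.ofReal (1 - p) • (kinkModel 0).prior := by
  simp only [Model.prior]
  rw [← withDensity_smul _ (kinkModel 1).f_meas.ennreal_ofReal,
    ← withDensity_smul _ (kinkModel 0).f_meas.ennreal_ofReal,
    ← withDensity_add_left ((kinkModel 1).f_meas.ennreal_ofReal.const_smul _)]
  congr 1
  funext θ
  change ENNReal.ofReal (mixDensity p (θ 0))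
    = ENNReal.ofReal p * ENNReal.ofReal (mixDensity 1 (θ 0))
    + ENNReal.ofReal (1 - p) * ENNReal.ofReal (mixDensity 0 (θ 0))
  have h0 := p.2.1
  have h1 : (0 : ℝ) ≤ 1 - p := sub_nonneg.2 p.2.2
  have hb := bump_nonneg (θ 0)
  have hb' := bump_nonneg (-θ 0)
  simp only [mixDensity, one_mul, sub_self, zero_mul, add_zero, zero_add, sub_zero]
  rw [ENNReal.ofReal_add (mul_nonneg h0 hb) (mul_nonneg h1 hb'), ENNReal.ofReal_mul h0,
    ENNReal.ofReal_mul h1]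

/-- The equal mixture. -/
noncomputable def half : unitInterval := ⟨1 / 2, by norm_num, by norm_num⟩

lemma lintegral_prior_half (F : (Fin 1 → ℝ) → ℝ≥0∞) :
    ∫⁻ θ, F θ ∂(kinkModel half).prior = ENNReal.ofReal (1 / 2) * (∫⁻ θ, F θ ∂(kinkModel 1).prior
      + ∫⁻ θ, F θ ∂(kinkModel 0).prior) := by
  rw [kinkModel_prior half, lintegral_add_measure, lintegral_smul_measure, lintegral_smul_measure]
  have : (1 : ℝ) - (half : ℝ) = 1 / 2 := by norm_num [half]
  rw [this]
  simp only [half, smul_eq_mul]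
  ring

lemma expFIM_kinkModel_one (Q : Matrix (Fin 2) (Fin 2) ℂ) (i j : Fin 1) :
    (kinkModel 1).expFIM Q i j = 8 * (Q 1 1).re := by
  have := (kinkModel 1).isProbabilityMeasure_prior
  have h : ∀ᵐ θ ∂(kinkModel 1).prior, (kinkModel 1).condFIM θ Q i j = 8 * (Q 1 1).re := by
    filter_upwards [kinkModel_ae_slope_one] with θ hθ
    rw [kinkModel_condFIM 1 hθ]; ring
  simp only [Model.expFIM, Matrix.of_apply]
  rw [integral_congr_ae h]
  simp

lemma expFIM_kinkModel_zero (Q : Matrix (Fin 2) (Fin 2) ℂ) (i j : Fin 1) :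
    (kinkModel 0).expFIM Q i j = 2 * (Q 1 1).re := by
  have := (kinkModel 0).isProbabilityMeasure_prior
  have h : ∀ᵐ θ ∂(kinkModel 0).prior, (kinkModel 0).condFIM θ Q i j = 2 * (Q 1 1).re := by
    filter_upwards [kinkModel_ae_slope_zero] with θ hθ
    rw [kinkModel_condFIM 0 hθ]; ring
  simp only [Model.expFIM, Matrix.of_apply]
  rw [integral_congr_ae h]
  simp

lemma expFIM_kinkModel_half (Q : Matrix (Fin 2) (Fin 2) ℂ) (i j : Fin 1) :
    (kinkModel half).expFIM Q i j = 5 * (Q 1 1).re := by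
  -- The conditional information of `kinkModel p` does not depend on `p`.
  have h1 : Integrable (fun θ => (kinkModel half).condFIM θ Q i j) (kinkModel 1).prior :=
    (kinkModel_regular 1).integrable_condFIM Q i j
  have h0 : Integrable (fun θ => (kinkModel half).condFIM θ Q i j) (kinkModel 0).prior :=
    (kinkModel_regular 0).integrable_condFIM Q i j
  have e1 : ∫ θ, (kinkModel half).condFIM θ Q i j ∂(kinkModel 1).prior = 8 * (Q 1 1).re :=
    expFIM_kinkModel_one Q i j
  have e0 : ∫ θ, (kinkModel half).condFIM θ Q i j ∂(kinkModel 0).prior = 2 * (Q 1 1).re :=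
    expFIM_kinkModel_zero Q i j
  change ∫ θ, (kinkModel half).condFIM θ Q i j ∂(kinkModel half).prior = _
  rw [kinkModel_prior half, integral_add_measure (h1.smul_measure ENNReal.ofReal_ne_top)
    (h0.smul_measure ENNReal.ofReal_ne_top), integral_smul_measure, integral_smul_measure]
  rw [e1, e0, ENNReal.toReal_ofReal (by norm_num [half]),
    ENNReal.toReal_ofReal (by norm_num [half])]
  simp only [half, smul_eq_mul]
  ring

lemma trace_fin_one_form (A : Matrix (Fin 1) (Fin 1) ℝ) (B : Matrix (Fin 1) (Fin 1) ℝ) :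
    2 * B.trace - (B * A * Bᵀ).trace = 2 * B 0 0 - B 0 0 ^ 2 * A 0 0 := by
  simp [Matrix.trace, Matrix.mul_apply]
  ring

lemma rate_kinkModel (p : unitInterval) (Q : Matrix (Fin 2) (Fin 2) ℂ) :
    (kinkModel p).rate Q = Real.logb 2 (1 + (Q 0 0).re) := by
  have hH : (kinkModel p).H = Matrix.of fun _ => ![1, 0] := rfl
  have hσ : (kinkModel p).σω = 1 := rfl
  rw [Model.rate, hH, hσ, Matrix.det_fin_one]
  simp [Matrix.mul_apply, Fin.sum_univ_two]

/-- If the second antenna gets at least half of the power, then the rate is at most one bit. -/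
lemma rate_kinkModel_le_one (p : unitInterval) {Q : Matrix (Fin 2) (Fin 2) ℂ} (hQ : Q.PosSemidef)
    (htr : Q.trace.re ≤ 2) (h : 1 ≤ (Q 1 1).re) : (kinkModel p).rate Q ≤ 1 := by
  have h0 : 0 ≤ (Q 0 0).re := (Complex.le_def.1 hQ.diag_nonneg).1
  rw [Matrix.trace_fin_two, Complex.add_re] at htr
  rw [rate_kinkModel, Real.logb_le_iff_le_rpow (by norm_num) (by linarith)]
  norm_num
  linarith

/-- A scheme for the mixture is a scheme for each of its two components. -/
noncomputable def Model.Scheme.ofKink {N m : ℕ} {p : unitInterval}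
    (S : (kinkModel p).Scheme N m) (p' : unitInterval) : (kinkModel p').Scheme N m where
  enc := S.enc
  power := S.power
  dec := S.dec
  dec_meas := S.dec_meas
  est := S.est
  est_meas := S.est_meas

lemma avgRisk_half {N m : ℕ} (S : (kinkModel half).Scheme N m) :
    S.avgRisk = ENNReal.ofReal (1 / 2) * ((S.ofKink 1).avgRisk + (S.ofKink 0).avgRisk) := by
  have h : ∀ w, S.risk w = ENNReal.ofReal (1 / 2)
      * ((S.ofKink 1).risk w + (S.ofKink 0).risk w) := by
    intro w
    simp only [Model.Scheme.risk, Model.mse, lintegral_prior_half, ← Finset.mul_sum,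
      Finset.sum_add_distrib]
    rfl
  simp only [Model.Scheme.avgRisk, h, ← Finset.mul_sum, Finset.sum_add_distrib]
  rw [mul_div_assoc, ENNReal.add_div]

/-- Converse for the example: the van Trees inequality holds in each of the two components, so that
the harmonic rather than the arithmetic mean of the two Fisher informations `8 q` and `2 q` bounds
the risk, `q` being the power on the second antenna. The limit of `N` times the risk is at least
`5 / (16 q)`, which forces `q ≥ 1`. -/
lemma cap_kinkModel_half_le : (kinkModel half).cap (5 / 16) ≤ 1 := by
  refine sSup_le ?_
  rintro r ⟨R, hR, rfl⟩
  obtain ⟨N, m, S, δ, Q, hN, hNtop, hδ, hfin, hrisk, hlim, hQ, htr, hrate⟩ :=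
    Model.exists_limit_of_achievable hR.avgRisk_of_maxRisk
  set J1 := (kinkModel 1).priorInfo 0 0
  set J0 := (kinkModel 0).priorInfo 0 0
  have hpt : ∀ k, 5 / 8 - 5 / 16 * ((S k).avgCov 1 1).re
      - 1 / (N k : ℝ) * (J1 / 128 + J0 / 8) ≤ 5 / 16 + δ k := by
    intro k
    have hmix := avgRisk_half (S k)
    have hne := hfin k
    rw [hmix] at hne
    have hsum : ((S k).ofKink 1).avgRisk + ((S k).ofKink 0).avgRisk ≠ ⊤ := by
      intro ht
      rw [ht, ENNReal.mul_top (by simp)] at hne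
      exact hne rfl
    have hf1 : ((S k).ofKink 1).avgRisk ≠ ⊤ := (ENNReal.add_ne_top.1 hsum).1
    have hf0 : ((S k).ofKink 0).avgRisk ≠ ⊤ := (ENNReal.add_ne_top.1 hsum).2
    -- The test matrices are the inverses of the two informations `8 q` and `2 q` at `q = 1`.
    have h1 := (kinkModel_regular 1).two_mul_trace_sub_le_avgRisk (hN k) ((S k).ofKink 1) hf1
      (Matrix.of fun _ _ => 1 / 8)
    have h0 := (kinkModel_regular 0).two_mul_trace_sub_le_avgRisk (hN k) ((S k).ofKink 0) hf0
      (Matrix.of fun _ _ => 1 / 2)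
    rw [trace_fin_one_form, Matrix.add_apply, expFIM_kinkModel_one, Matrix.smul_apply,
      Matrix.of_apply, smul_eq_mul] at h1
    rw [trace_fin_one_form, Matrix.add_apply, expFIM_kinkModel_zero, Matrix.smul_apply,
      Matrix.of_apply, smul_eq_mul] at h0
    have hr : (S k).avgRisk.toReal = 1 / 2 * (((S k).ofKink 1).avgRisk.toReal
        + ((S k).ofKink 0).avgRisk.toReal) := by
      rw [hmix, ENNReal.toReal_mul, ENNReal.toReal_add hf1 hf0, ENNReal.toReal_ofReal (by norm_num)]
    have hk := hrisk k
    rw [hr] at hk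
    have ec1 : ((S k).ofKink 1).avgCov = (S k).avgCov := rfl
    have ec0 : ((S k).ofKink 0).avgCov = (S k).avgCov := rfl
    rw [ec1] at h1
    rw [ec0] at h0
    linarith
  have hq : Tendsto (fun k => ((S k).avgCov 1 1).re) atTop (𝓝 (Q 1 1).re) := by
    have hc : Continuous fun Q : Matrix (Fin 2) (Fin 2) ℂ => (Q 1 1).re :=
      Complex.continuous_re.comp (by fun_prop)
    exact (hc.tendsto Q).comp hlim
  have hl : Tendsto (fun k => 5 / 8 - 5 / 16 * ((S k).avgCov 1 1).re
      - 1 / (N k : ℝ) * (J1 / 128 + J0 / 8)) atTop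
      (𝓝 (5 / 8 - 5 / 16 * (Q 1 1).re - 0 * (J1 / 128 + J0 / 8))) :=
    (tendsto_const_nhds.sub (hq.const_mul _)).sub
      ((tendsto_one_div_atTop_nhds_zero_nat.comp hNtop).mul_const _)
  have hfinal := le_of_tendsto_of_tendsto' hl (tendsto_const_nhds.add hδ) hpt
  have : R ≤ 1 := hrate.trans (rate_kinkModel_le_one half hQ htr (by linarith))
  exact_mod_cast this

/-- A power of `16/25` on the second antenna satisfies the sensing constraint of the bound, since
`5 * (16 / 25) = 16 / 5`. -/
lemma one_lt_capUB_kinkModel_half : 1 < (kinkModel half).capUB (5 / 16 : ℝ) := by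
  set Q : Matrix (Fin 2) (Fin 2) ℂ := Matrix.diagonal ![((34 / 25 : ℝ) : ℂ), ((16 / 25 : ℝ) : ℂ)]
    with hQ
  have h00 : (Q 0 0).re = 34 / 25 := by
    rw [hQ, Matrix.diagonal_apply_eq, Matrix.cons_val_zero, Complex.ofReal_re]
  have h11 : (Q 1 1).re = 16 / 25 := by
    rw [hQ, Matrix.diagonal_apply_eq, Matrix.cons_val_one, Matrix.cons_val_zero, Complex.ofReal_re]
  have hf : (kinkModel half).Feasible (kinkModel half).bcrb (5 / 16) Q := by
    refine (kinkModel_regular half).feasible_bcrb_iff.2 ⟨⟨?_, ?_⟩, fun B => ?_⟩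
    · refine Matrix.PosSemidef.diagonal fun i => ?_
      fin_cases i
      · exact Complex.zero_le_real.2 (by norm_num)
      · exact Complex.zero_le_real.2 (by norm_num)
    · rw [Matrix.trace_fin_two, Complex.add_re, h00, h11]
      change (34 / 25 + 16 / 25 : ℝ) ≤ 2
      norm_num
    · rw [trace_fin_one_form, expFIM_kinkModel_half, h11]
      nlinarith [sq_nonneg (B 0 0 - 5 / 16)]
  refine lt_of_lt_of_le ?_ (le_sSup ⟨Q, hf, rfl⟩)
  have : 1 < (kinkModel half).rate Q := by
    rw [rate_kinkModel, h00, Real.lt_logb_iff_rpow_lt (by norm_num) (by norm_num)]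
    norm_num
  exact_mod_cast this

lemma ecrb_half (Q : Matrix (Fin 2) (Fin 2) ℂ) :
    (kinkModel half).ecrb Q = ENNReal.ofReal (1 / 2)
      * ((kinkModel 1).ecrb Q + (kinkModel 0).ecrb Q) :=
  lintegral_prior_half _

/-- `E[J⁻¹] = 5 / (16 q)`, where `q` is the power on the second antenna, so feasibility requires
`q ≥ 1`. -/
lemma program_ecrb_kinkModel_half_le :
    (kinkModel half).program (kinkModel half).ecrb (5 / 16 : ℝ) ≤ 1 := by
  refine sSup_le ?_
  rintro r ⟨Q, ⟨hQ, hS, htr⟩, rfl⟩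
  have h := (coe_ennreal_le_coe_real.1 hS).2
  rw [ecrb_half] at h
  have b1 : ENNReal.ofReal (1 / 4 - 1 / 8 * (Q 1 1).re) ≤ (kinkModel 1).ecrb Q := by
    refine le_trans ?_ ((kinkModel_regular 1).bcrb_le_ecrb hQ)
    refine le_trans (ENNReal.ofReal_le_ofReal ?_)
      (ofReal_le_invTrace _ (Matrix.of fun _ _ => 1 / 8))
    rw [trace_fin_one_form, expFIM_kinkModel_one, Matrix.of_apply]
    linarith
  have b0 : ENNReal.ofReal (1 - 1 / 2 * (Q 1 1).re) ≤ (kinkModel 0).ecrb Q := by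
    refine le_trans ?_ ((kinkModel_regular 0).bcrb_le_ecrb hQ)
    refine le_trans (ENNReal.ofReal_le_ofReal ?_)
      (ofReal_le_invTrace _ (Matrix.of fun _ _ => 1 / 2))
    rw [trace_fin_one_form, expFIM_kinkModel_zero, Matrix.of_apply]
    linarith
  have h2 : ENNReal.ofReal (1 / 2 * (5 / 4 - 5 / 8 * (Q 1 1).re)) ≤ ENNReal.ofReal (5 / 16) := by
    rw [ENNReal.ofReal_mul (by norm_num)]
    refine le_trans (mul_le_mul_right ?_ _) h
    refine le_trans ?_ (add_le_add b1 b0)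
    refine le_trans (ENNReal.ofReal_le_ofReal ?_) ENNReal.ofReal_add_le
    linarith
  rw [ENNReal.ofReal_le_ofReal_iff (by norm_num)] at h2
  have := rate_kinkModel_le_one half hQ htr (by linarith)
  exact_mod_cast this

/-- Equal power on both antennas is feasible. -/
lemma program_ecrb_kinkModel_half_pos :
    0 < (kinkModel half).program (kinkModel half).ecrb (5 / 16 : ℝ) := by
  have hpsd : ∀ c : ℝ, 0 ≤ c → (Matrix.of fun _ _ => c : Matrix (Fin 1) (Fin 1) ℝ).PosSemidef := by
    intro c hc
    have : (Matrix.of fun _ _ => c : Matrix (Fin 1) (Fin 1) ℝ) = Matrix.diagonal fun _ => c := by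
      ext i j
      rw [Subsingleton.elim i j, Matrix.diagonal_apply_eq, Matrix.of_apply]
    rw [this]
    exact Matrix.PosSemidef.diagonal fun _ => hc
  have hc : ∀ {p : unitInterval} {s : ℝ}, 0 < s →
      (∀ᵐ θ ∂(kinkModel p).prior, HasDerivAt kink s (θ 0)) →
      (kinkModel p).ecrb 1 ≤ ENNReal.ofReal (1 / (2 * s ^ 2)) := by
    intro p s hs hae
    have := (kinkModel p).isProbabilityMeasure_prior
    calc (kinkModel p).ecrb 1 ≤ ∫⁻ _, ENNReal.ofReal (1 / (2 * s ^ 2)) ∂(kinkModel p).prior := by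
          refine lintegral_mono_ae ?_
          filter_upwards [hae] with θ hθ
          have e : (kinkModel p).condFIM θ 1 = Matrix.of fun _ _ => 2 * s ^ 2 := by
            ext i j
            rw [kinkModel_condFIM p hθ]
            simp
          rw [e]
          refine invTrace_le_ofReal (hpsd _ (by positivity)) fun B => ?_
          rw [trace_fin_one_form, Matrix.of_apply, le_div_iff₀ (by positivity)]
          nlinarith [sq_nonneg (B 0 0 * (2 * s ^ 2) - 1)]
      _ = _ := by simp
  have hf : (kinkModel half).Feasible (kinkModel half).ecrb (5 / 16) 1 := by
    refine ⟨Matrix.PosSemidef.one, coe_ennreal_le_coe_real.2 ⟨by norm_num, ?_⟩, ?_⟩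
    · rw [ecrb_half]
      refine (mul_le_mul_right (add_le_add (hc two_pos kinkModel_ae_slope_one)
        (hc one_pos kinkModel_ae_slope_zero)) _).trans ?_
      rw [← ENNReal.ofReal_add (by norm_num) (by norm_num), ← ENNReal.ofReal_mul (by norm_num)]
      norm_num
    · change _ ≤ (2 : ℝ)
      simp
  refine lt_of_lt_of_le ?_ (le_sSup ⟨1, hf, rfl⟩)
  have : 0 < (kinkModel half).rate 1 := by
    rw [rate_kinkModel]
    exact Real.logb_pos (by norm_num) (by simp)
  exact_mod_cast this

/-- Achievability of zero rate in the example: all the power goes to the second antenna, and the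
inverse response, which is a contraction, is applied to the average observation. -/
lemma cap_kinkModel_half_nonneg : 0 ≤ (kinkModel half).cap (5 / 16 : ℝ) := by
  refine le_sSup ⟨0, ?_, by simp⟩
  intro ε hε
  refine ⟨1, fun N hN => ?_⟩
  have hN' : (0 : ℝ) < N := by exact_mod_cast hN
  have hs2 : (0 : ℝ) < √2 := by positivity
  have hsq : √2 ^ 2 = (2 : ℝ) := Real.sq_sqrt (by norm_num)
  let c : ℝ := 1 / (N * √2)
  let x : Fin 1 → Fin N → Fin 2 → ℂ := fun _ _ => ![0, ((√2 : ℝ) : ℂ)]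
  let est : (Fin N → Fin 1 → ℂ) → (Fin 1 → ℝ) := fun z _ => kinkInv (∑ n, c * (z n 0).re)
  have hkc : Continuous kinkInv := by unfold kinkInv; fun_prop
  have hest : Measurable est := by
    refine measurable_pi_lambda _ fun _ => hkc.measurable.comp ?_
    refine Finset.measurable_fun_sum _ fun n _ => Measurable.const_mul
      (Complex.measurable_re.comp ((measurable_pi_apply 0).comp (measurable_pi_apply n))) _
  let S : (kinkModel half).Scheme N 1 :=
    { enc := x
      power := fun w => by
        change _ ≤ (2 : ℝ)
        simp only [x, Fin.sum_univ_two, Matrix.cons_val_zero, Matrix.cons_val_one, norm_zero,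
          Complex.norm_real, Real.norm_of_nonneg hs2.le, hsq, Finset.sum_const, Finset.card_univ,
          Fintype.card_fin, nsmul_eq_mul]
        field_simp
        norm_num
      dec := fun _ => 0
      dec_meas := measurable_const
      est := fun z _ => est z
      est_meas := fun _ => hest }
  have hmean : ∀ (θ : Fin 1 → ℝ) (w : Fin 1) (n : Fin N),
      ((kinkModel half).G θ *ᵥ x w n) 0 = ((kink (θ 0) * √2 : ℝ) : ℂ) := by
    intro θ w n
    change (kinkG θ *ᵥ x w n) 0 = _
    simp [kinkG, x, Matrix.mulVec, dotProduct, Fin.sum_univ_two]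
  have hin : ∀ θ w, ∫⁻ z, ENNReal.ofReal ((θ 0 - est z 0) ^ 2)
      ∂((kinkModel half).sensorLaw θ (x w)) ≤ ENNReal.ofReal (1 / (4 * N)) := by
    intro θ w
    have hpt : ∀ z : Fin N → Fin 1 → ℂ, (θ 0 - est z 0) ^ 2
        ≤ (∑ n, reDot (fun _ => (c : ℂ)) (z n - (kinkModel half).G θ *ᵥ x w n)) ^ 2 := by
      intro z
      have e : ∑ n, reDot (fun _ => (c : ℂ)) (z n - (kinkModel half).G θ *ᵥ x w n)
          = ∑ n, c * (z n 0).re - kink (θ 0) := by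
        have e1 : ∀ n, reDot (fun _ => (c : ℂ)) (z n - (kinkModel half).G θ *ᵥ x w n)
            = c * (z n 0).re - kink (θ 0) / N := fun n => by
          simp only [reDot, Fin.sum_univ_one, Pi.sub_apply, Fin.isValue, hmean, reMul_eq,
            Complex.sub_re, Complex.ofReal_re, Complex.ofReal_im, zero_mul, add_zero, mul_sub, c]
          field_simp
        simp only [e1, Finset.sum_sub_distrib, Finset.sum_const, Finset.card_univ,
          Fintype.card_fin, nsmul_eq_mul]
        field_simp
      rw [e]
      refine sq_le_sq.2 ?_
      calc |θ 0 - est z 0| = |kinkInv (∑ n, c * (z n 0).re) - kinkInv (kink (θ 0))| := by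
            rw [kinkInv_kink, abs_sub_comm]
        _ ≤ _ := abs_kinkInv_sub_le _ _
    have hL := memLp_sum_reDot (s := 1) one_pos (fun (_ : Fin N) (_ : Fin 1) => (c : ℂ))
      (fun n => (kinkModel half).G θ *ᵥ x w n)
    have hI := integral_sum_reDot_mul_sum_reDot (s := 1) one_pos
      (fun (_ : Fin N) (_ : Fin 1) => (c : ℂ)) (fun (_ : Fin N) (_ : Fin 1) => (c : ℂ))
      (fun n => (kinkModel half).G θ *ᵥ x w n)
    refine (lintegral_mono fun z => ENNReal.ofReal_le_ofReal (hpt z)).trans ?_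
    change ∫⁻ z, _ ∂(Measure.pi fun n => cnLaw 1 ((kinkModel half).G θ *ᵥ x w n)) ≤ _
    rw [← ofReal_integral_eq_lintegral_ofReal hL.integrable_sq (ae_of_all _ fun _ => sq_nonneg _)]
    simp_rw [pow_two]
    rw [hI]
    refine ENNReal.ofReal_le_ofReal (le_of_eq ?_)
    have hc : ((star fun _ : Fin 1 => (c : ℂ)) ⬝ᵥ fun _ => (c : ℂ)).re = c ^ 2 := by
      generalize c = c'
      simp [dotProduct, pow_two]
    have hc2 : c ^ 2 = 1 / (N ^ 2 * 2) := by rw [← hsq]; simp only [c]; ring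
    rw [hc, hc2, Finset.sum_const, Finset.card_univ, Fintype.card_fin, nsmul_eq_mul]
    field_simp
    norm_num
  have hrisk : ∀ w, S.risk w ≤ ENNReal.ofReal (1 / (4 * N)) := by
    intro w
    have := (kinkModel half).isProbabilityMeasure_prior
    simp only [Model.Scheme.risk, Model.mse, Finset.univ_unique, Finset.sum_singleton]
    refine (lintegral_mono fun θ => hin θ w).trans (le_of_eq ?_)
    simp
  refine ⟨1, S, ?_, ?_, coe_ennreal_le_coe_real.2 ⟨by positivity, ?_⟩⟩
  · refine iSup_le fun w => ?_
    have : {y : Fin N → Fin 1 → ℂ | S.dec y ≠ w} = ∅ := by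
      ext y
      simp [Subsingleton.elim (S.dec y) w]
    rw [this]
    simp
  · simp [hε.le]
  · calc (N : ℝ≥0∞) * S.maxRisk ≤ N * ENNReal.ofReal (1 / (4 * N)) :=
          mul_le_mul_right (iSup_le hrisk) _
      _ = ENNReal.ofReal (1 / 4) := by
          rw [← ENNReal.ofReal_natCast, ← ENNReal.ofReal_mul hN'.le]
          congr 1
          field_simp
      _ ≤ _ := ENNReal.ofReal_le_ofReal (by linarith)

end JCAS

theorem mainTheorem6 :
    -- claims for every channel with a regular prior
    (∀ (M L T K : ℕ) (𝓜 : JCAS.Model M L T K), 𝓜.Regular →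
      -- `J(θ | Q)` is the expected Fisher information for any input with covariance `Q`
      (∀ (μ : MeasureTheory.Measure (Fin M → ℂ)) (Q : Matrix (Fin M) (Fin M) ℂ),
        MeasureTheory.IsProbabilityMeasure μ →
        (∀ a, MeasureTheory.Integrable (fun x : Fin M → ℂ => ‖x a‖ ^ 2) μ) →
        (∀ a b, ∫ x, x a * star (x b) ∂μ = Q a b) →
        ∀ θ, 0 < 𝓜.f θ → ∀ i j, 𝓜.condFIM θ Q i j = ∫ x, 𝓜.fisherInfo θ x i j ∂μ) ∧
      -- van Trees inequality for every codeword and estimator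
      (∀ (N : ℕ), 0 < N → ∀ (x : Fin N → Fin M → ℂ) (est : (Fin N → Fin T → ℂ) → (Fin K → ℝ)),
        Measurable est →
        JCAS.invTrace (𝓜.expFIM (JCAS.Model.empCov x) + (1 / N : ℝ) • 𝓜.priorInfo)
          ≤ N * 𝓜.mse x est) ∧
      -- Miller-Chang form, for the risk averaged over the codebook
      (∀ (N m : ℕ), 0 < N → ∀ S : 𝓜.Scheme N m,
        JCAS.invTrace (𝓜.expFIM S.avgCov + (1 / N : ℝ) • 𝓜.priorInfo) ≤ N * S.avgRisk) ∧
      -- the upper bound, for the maximal and for the average risk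
      (∀ Δ : ℝ, 𝓜.cap Δ ≤ 𝓜.capUB Δ ∧ 𝓜.capAvg Δ ≤ 𝓜.capUB Δ) ∧
      -- the maximum in the program is attained
      (∀ Δ : ℝ, (∃ Q, 𝓜.Feasible 𝓜.bcrb Δ Q) →
        ∃ Q, 𝓜.Feasible 𝓜.bcrb Δ Q ∧ 𝓜.capUB Δ = (𝓜.rate Q : EReal)) ∧
      -- comparison of the two sensing constraints and of the two programs
      (∀ Q : Matrix (Fin M) (Fin M) ℂ, Q.PosSemidef →
        𝓜.bcrb Q ≤ 𝓜.ecrb Q ∧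
        (𝓜.ecrb Q ≠ ⊤ →
          (𝓜.bcrb Q = 𝓜.ecrb Q ↔ ∀ᵐ θ ∂𝓜.prior, 𝓜.condFIM θ Q = 𝓜.expFIM Q))) ∧
      (∀ Δ : ℝ, 𝓜.program 𝓜.ecrb Δ ≤ 𝓜.capUB Δ)) ∧
    -- the bound is strictly loose in general
    (∃ (M L T K : ℕ) (𝓜 : JCAS.Model M L T K) (Δ : ℝ), 𝓜.Regular ∧
      0 ≤ 𝓜.cap Δ ∧ 𝓜.cap Δ < 𝓜.capUB Δ ∧
      0 < 𝓜.program 𝓜.ecrb Δ ∧ 𝓜.program 𝓜.ecrb Δ < 𝓜.capUB Δ) := by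
  refine ⟨fun M L T K 𝓜 h => ⟨?_, ?_, ?_, ?_, ?_, ?_, ?_⟩, ?_⟩
  · intro μ Q _ hμ hQ θ hθ i j
    exact 𝓜.condFIM_eq_integral_fisherInfo μ Q hμ hQ hθ i j
  · intro N hN x est hest
    exact h.vanTrees hN x hest
  · intro N m hN S
    exact h.millerChang hN S
  · exact fun Δ => ⟨(JCAS.Model.cap_le_capAvg Δ).trans (h.capAvg_le_capUB Δ), h.capAvg_le_capUB Δ⟩
  · exact h.exists_feasible_capUB_eq
  · exact fun Q hQ => ⟨h.bcrb_le_ecrb hQ, h.bcrb_eq_ecrb_iff hQ⟩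
  · exact JCAS.Model.program_le_program fun Q hQ => h.bcrb_le_ecrb hQ
  · exact ⟨2, 1, 1, 1, JCAS.kinkModel JCAS.half, 5 / 16, JCAS.kinkModel_regular _,
      JCAS.cap_kinkModel_half_nonneg,
      JCAS.cap_kinkModel_half_le.trans_lt JCAS.one_lt_capUB_kinkModel_half,
      JCAS.program_ecrb_kinkModel_half_pos,
      JCAS.program_ecrb_kinkModel_half_le.trans_lt JCAS.one_lt_capUB_kinkModel_half⟩
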